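/- **Setting.** Fix a set of constants $c$ and a set of basic types $b$; each constant $c$ has a basic type $\mathbb b_c$, each basic type $b$ denotes a set $\mathbb B(b)$ of constants, and $c\in\mathbb B(\mathbb b_c)$. Assume that the type of a constant is atomic: for all $c$ and $b$, either $\mathbb B(\mathbb b_c)\subseteq\mathbb B(b)$ or $\mathbb B(\mathbb b_c)\cap\mathbb B(b)=\varnothing$. *Types.* Type variables are either polymorphic or monomorphic (two disjoint countably infinite sets). Types are the finite or infinite terms $t ::= b\mid\alpha\mid t\to t\mid t\times t\mid t\vee t\mid\neg t\mid\mathbb 0$ that are regular (finitely many different sub-terms) and contractive (every infinite branch contains infinitely many arrows or products); $\mathbb 1=\neg\mathbb 0$ and $t\wedge s=\neg(\neg t\vee\neg s)$. A type is monomorphic if no polymorphic variable occurs in it. A test type $\tau$ is a type without variables in which the only arrow that occurs is $\mathbb 0\to\mathbb 1$. *Subtyping.* Let $\mathcal D$ be the set of finite terms $d ::= c^L\mid(d,d)^L\mid\{(d,\partial),\dots,(d,\partial)\}^L$ with $\partial ::= d\mid\Omega$ and $L$ a finite set of type variables. Membership $d:t$ is given by: $c^L:b$ iff $c\in\mathbb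 B(b)$; $d:\alpha$ iff $\alpha$ is in the outermost label of $d$; $(d_1,d_2)^L:t_1\times t_2$ iff $d_1:t_1$ and $d_2:t_2$; $R^L:t_1\to t_2$ iff for all $(d,\partial)\in R$, $d:t_1$ implies $\partial\neq\Omega$ and $\partial:t_2$; $\vee$ and $\neg$ are union and complement in $\mathcal D$; and $d:t$ is false in the remaining cases. Then $t\le s$ iff $d:t$ implies $d:s$ for all $d\in\mathcal D$. *Language.* Expressions $e ::= c\mid x\mid\lambda x.e\mid e\,e\mid(e,e)\mid\pi_i e\mid(e{\in}\tau)\,?\,e:e$, values $v ::= c\mid\lambda x.e\mid(v,v)$, programs $p ::= \mathsf{let}\ x=e;\,p\mid e$, all up to renaming of bound variables. Put $\mathrm{typeof}(c)=\mathbb b_c$, $\mathrm{typeof}(\lambda x.e)=\mathbb 0\to\mathbb 1$, $\mathrm{typeof}((v_1,v_2))=\mathrm{typeof}(v_1)\times\mathrm{typeof}(v_2)$, and let $v\in t$ mean $\mathrm{typeof}(v)\le t$. Reduction $\leadsto$ of expressions is generated by $(\lambda x.e)v\leadsto e\{v/x\}$, $\pi_i(v_1,v_2)\leadsto v_i$,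 $(v{\in}\tau)?e_1:e_2\leadsto e_1$ if $v\in\tau$, $(v{\in}\tau)?e_1:e_2\leadsto e_2$ if $v\in\neg\tau$, under the contexts $E ::= [\,]\mid E\,e\mid v\,E\mid(E,e)\mid(v,E)\mid\pi_iE\mid(E{\in}\tau)?e:e$. Reduction $\leadsto_p$ of programs: $\mathsf{let}\ x=v;p\leadsto_p p\{v/x\}$; and if $e\leadsto e'$ then $e\leadsto_p e'$ and $\mathsf{let}\ x=e;p\leadsto_p\mathsf{let}\ x=e';p$. *Typing of expressions.* $\Gamma\vdash e:t$ is generated by the rules: - $\Gamma\vdash c:\mathbb b_c$, and $\Gamma\vdash x:\Gamma(x)$; - if $\Gamma,x:u\vdash e:t$ with $u$ monomorphic, then $\Gamma\vdash\lambda x.e:u\to t$; - if $\Gamma\vdash e_1:t_1\to t_2$ and $\Gamma\vdash e_2:t_1$, then $\Gamma\vdash e_1e_2:t_2$; - if $\Gamma\vdash e_1:t_1$ and $\Gamma\vdash e_2:t_2$, then $\Gamma\vdash(e_1,e_2):t_1\times t_2$; if $\Gamma\vdash e:t_1\times t_2$, then $\Gamma\vdash\pi_ie:t_i$; - if $\Gamma\vdash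 e:\mathbb 0$, then $\Gamma\vdash(e{\in}\tau)?e_1:e_2\ :\ \mathbb 0$; if $\Gamma\vdash e:\tau$ and $\Gamma\vdash e_1:t_1$, then $\Gamma\vdash(e{\in}\tau)?e_1:e_2\ :\ t_1$; if $\Gamma\vdash e:\neg\tau$ and $\Gamma\vdash e_2:t_2$, then $\Gamma\vdash(e{\in}\tau)?e_1:e_2\ :\ t_2$; - if $\Gamma\vdash e':s$, $\Gamma,x:s\wedge u\vdash e:t$ and $\Gamma,x:s\wedge\neg u\vdash e:t$ with $u$ monomorphic, then $\Gamma\vdash e\{e'/x\}:t$; - if $\Gamma\vdash e:t_1$ and $\Gamma\vdash e:t_2$, then $\Gamma\vdash e:t_1\wedge t_2$; - if $\Gamma\vdash e:t$, then $\Gamma\vdash e:t\sigma$ for every substitution $\sigma$ of types for polymorphic variables; - if $\Gamma\vdash e:t$ and $t\le t'$, then $\Gamma\vdash e:t'$. *Typing of programs.* If $\Gamma\vdash e:t$ and $\varphi$ is a substitution of polymorphic variables for monomorphic ones whose domain contains no variable of $\Gamma$, then $\Gamma\vdash_p e:t\varphi$; if $\Gamma\vdash_p e:t$ and $\Gamma,x:t\vdash_p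 p:t'$, then $\Gamma\vdash_p\mathsf{let}\ x=e;p:t'$. **Theorem (Soundness).** Let $p$ be a program and $\tau$ a test type. If $\varnothing\vdash_p p:\tau$, then either $p$ diverges, that is, there is an infinite sequence $p\leadsto_p p_1\leadsto_p p_2\leadsto_p\cdots$, or $p\leadsto_p^* v$ for some value $v$ with $v\in\tau$. -/

import Mathlib

universe u v

/-! ## Types -/

/-- Type variables: two disjoint countably infinite sorts. -/
inductive TVar : Type
  | poly (n : ℕ)
  | mono (n : ℕ)
  deriving DecidableEq

/-- Root symbols of type terms. -/
inductive TyShape (B : Type v) : Type v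
  | base (b : B)
  | var (a : TVar)
  | arrow
  | prod
  | union
  | neg
  | empty

/-- Number of immediate sub-terms below a root symbol. -/
def TyShape.arity {B : Type v} : TyShape B → ℕ
  | .base _ => 0
  | .var _ => 0
  | .arrow => 2
  | .prod => 2
  | .union => 2
  | .neg => 1
  | .empty => 0

/-- The polynomial functor `X ↦ b | α | X → X | X × X | X ∨ X | ¬ X | 𝟘`. -/
abbrev tyF (B : Type v) : PFunctor.{v, 0} := ⟨TyShape B, fun a => Fin a.arity⟩

/-- Finite and infinite terms coinductively produced by the grammar of types. -/
abbrev RawTy (B : Type v) : Type v := (tyF B).M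

namespace RawTy

variable {B : Type v}

/-- The root symbol of a term. -/
def shape (t : RawTy B) : TyShape B := t.dest.1

/-- `Child s t`: `s` is an immediate sub-term of `t`. -/
def Child (s t : RawTy B) : Prop := ∃ i, t.dest.2 i = s

/-- `Subterm s t`: `s` is a (not necessarily strict) sub-term of `t`. -/
def Subterm (s t : RawTy B) : Prop := Relation.ReflTransGen Child s t

/-- Every term has finitely many different sub-terms. -/
def Regular (t : RawTy B) : Prop := {s | Subterm s t}.Finite

/-- Every infinite branch contains infinitely many occurrences of arrow or product. -/
def Contractive (t : RawTy B) : Prop :=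
  ∀ f : ℕ → RawTy B, f 0 = t → (∀ n, Child (f (n + 1)) (f n)) →
    ∀ N, ∃ n, N ≤ n ∧ ((f n).shape = .arrow ∨ (f n).shape = .prod)

theorem Contractive.of_child {s t : RawTy B} (ht : t.Contractive) (h : Child s t) :
    s.Contractive := by
  intro f hf hc N
  obtain ⟨n, hn, h'⟩ := ht (fun n => Nat.casesOn n t f) rfl
    (by intro n; cases n with
        | zero => simpa [hf] using h
        | succ n => exact hc n) (N + 1)
  cases n with
  | zero => omega
  | succ n => exact ⟨n, by omega, h'⟩

theorem Contractive.of_eventually {f : ℕ → RawTy B} (hc : ∀ n, Child (f (n + 1)) (f n))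
    {m : ℕ} (hm : (f m).Contractive) (N : ℕ) :
    ∃ n, N ≤ n ∧ ((f n).shape = .arrow ∨ (f n).shape = .prod) := by
  obtain ⟨n, hn, h⟩ := hm (fun n => f (m + n)) rfl (fun n => hc (m + n)) N
  exact ⟨m + n, by omega, h⟩

theorem Regular.of_child {s t : RawTy B} (ht : t.Regular) (h : Child s t) : s.Regular :=
  Set.Finite.subset ht fun _ hr => Relation.ReflTransGen.tail hr h

end RawTy

/-- One layer of the grammar of types. -/
inductive TyNode (B : Type v) (X : Type v) : Type v
  | base (b : B)
  | var (a : TVar)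
  | arrow (t s : X)
  | prod (t s : X)
  | union (t s : X)
  | neg (t : X)
  | empty

/-- Types: regular and contractive terms. -/
@[ext]
structure Ty (B : Type v) : Type v where
  raw : RawTy B
  regular : raw.Regular
  contractive : raw.Contractive

namespace Ty

variable {B : Type v}

/-- Decomposition of a type into its root symbol and its immediate sub-terms. -/
def out (t : Ty B) : (tyF B) (Ty B) :=
  ⟨t.raw.dest.1, fun i => ⟨t.raw.dest.2 i, t.regular.of_child ⟨i, rfl⟩,
    t.contractive.of_child ⟨i, rfl⟩⟩⟩

/-- The type with given root symbol and immediate sub-terms. -/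
def node (x : (tyF B) (Ty B)) : Ty B where
  raw := PFunctor.M.mk ⟨x.1, fun i => (x.2 i).raw⟩
  regular := by
    have hf : ({PFunctor.M.mk ⟨x.1, fun i => (x.2 i).raw⟩} ∪
        ⋃ i : Fin x.1.arity, {s | RawTy.Subterm s (x.2 i).raw} : Set (RawTy B)).Finite :=
      (Set.finite_singleton _).union (Set.finite_iUnion fun i => (x.2 i).regular)
    refine hf.subset fun s hs => ?_
    rcases Relation.ReflTransGen.cases_tail hs with h | ⟨r, hr, i, hi⟩
    · exact Or.inl h.symm
    · have hi' : (x.2 i).raw = r := hi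
      subst hi'
      exact Or.inr (Set.mem_iUnion.2 ⟨i, hr⟩)
  contractive := by
    intro f hf hc N
    have h1 := hc 0
    rw [hf] at h1
    obtain ⟨i, hi⟩ := h1
    have hi' : (x.2 i).raw = f 1 := hi
    exact RawTy.Contractive.of_eventually hc (m := 1) (by rw [← hi']; exact (x.2 i).contractive) N

theorem out_node (x : (tyF B) (Ty B)) : (node x).out = x := rfl

theorem node_out (t : Ty B) : node t.out = t := Ty.ext (PFunctor.M.mk_dest t.raw)

theorem out_child (t : Ty B) (i) : RawTy.Child (t.out.2 i).raw t.raw := ⟨i, rfl⟩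

/-- The same decomposition in the form of the grammar. -/
def view (t : Ty B) : TyNode B (Ty B) :=
  match t.out with
  | ⟨.base b, _⟩ => .base b
  | ⟨.var a, _⟩ => .var a
  | ⟨.arrow, f⟩ => .arrow (f (0 : Fin 2)) (f (1 : Fin 2))
  | ⟨.prod, f⟩ => .prod (f (0 : Fin 2)) (f (1 : Fin 2))
  | ⟨.union, f⟩ => .union (f (0 : Fin 2)) (f (1 : Fin 2))
  | ⟨.neg, f⟩ => .neg (f (0 : Fin 1))
  | ⟨.empty, _⟩ => .empty

def base (b : B) : Ty B := node ⟨.base b, Fin.elim0⟩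
def var (a : TVar) : Ty B := node ⟨.var a, Fin.elim0⟩
def arrow (t s : Ty B) : Ty B := node ⟨.arrow, ![t, s]⟩
def prod (t s : Ty B) : Ty B := node ⟨.prod, ![t, s]⟩
def union (t s : Ty B) : Ty B := node ⟨.union, ![t, s]⟩
def neg (t : Ty B) : Ty B := node ⟨.neg, ![t]⟩
def empty : Ty B := node ⟨.empty, Fin.elim0⟩

/-- Abbreviations `𝟙 = ¬ 𝟘` and `t ∧ s = ¬ (¬ t ∨ ¬ s)`. -/
def any : Ty B := neg empty
def inter (t s : Ty B) : Ty B := neg (union (neg t) (neg s))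

/-- The type variables that occur in a type. -/
def vars (t : Ty B) : Set TVar := {a | ∃ s, RawTy.Subterm s t.raw ∧ s.shape = .var a}

/-- Monomorphic types: no polymorphic variable occurs. -/
def IsMono (t : Ty B) : Prop := ∀ n, TVar.poly n ∉ t.vars

/-- Test types: no variable occurs, and the only arrow that occurs is `𝟘 → 𝟙`. -/
def IsTest (t : Ty B) : Prop :=
  t.vars = ∅ ∧ ∀ s, RawTy.Subterm s t.raw → s.shape = .arrow → s = (arrow empty any : Ty B).raw

/-! ### Type substitutions -/

/-- One step of the unfolding of `t σ`; a state `inl t` stands for `t σ`, and `inr t` for `t`. -/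
def substStep (σ : TVar → Ty B) : RawTy B ⊕ RawTy B → (tyF B) (RawTy B ⊕ RawTy B)
  | .inl t =>
    match t.dest with
    | ⟨.var a, _⟩ => (tyF B).map Sum.inr (σ a).raw.dest
    | ⟨.base b, f⟩ => ⟨.base b, fun i => .inl (f i)⟩
    | ⟨.arrow, f⟩ => ⟨.arrow, fun i => .inl (f i)⟩
    | ⟨.prod, f⟩ => ⟨.prod, fun i => .inl (f i)⟩
    | ⟨.union, f⟩ => ⟨.union, fun i => .inl (f i)⟩
    | ⟨.neg, f⟩ => ⟨.neg, fun i => .inl (f i)⟩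
    | ⟨.empty, f⟩ => ⟨.empty, fun i => .inl (f i)⟩
  | .inr t => (tyF B).map Sum.inr t.dest

/-- Simultaneous replacement of all variables `α` of a term by `σ α`. -/
def substRaw (σ : TVar → Ty B) (t : RawTy B) : RawTy B :=
  PFunctor.M.corec (substStep σ) (.inl t)

theorem corec_inr (σ : TVar → Ty B) (t : RawTy B) :
    PFunctor.M.corec (substStep σ) (.inr t) = t := by
  refine PFunctor.M.bisim (fun x y => x = PFunctor.M.corec (substStep σ) (.inr y)) ?_ _ _ rfl
  rintro x y rfl
  rw [PFunctor.M.dest_corec]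
  exact ⟨y.dest.1, fun i => PFunctor.M.corec (substStep σ) (.inr (y.dest.2 i)), y.dest.2,
    rfl, rfl, fun i => rfl⟩

theorem substRaw_of_var (σ : TVar → Ty B) {t : RawTy B} {a : TVar} (h : t.shape = .var a) :
    substRaw σ t = (σ a).raw := by
  have h1 : substStep σ (.inl t) = substStep σ (.inr (σ a).raw) := by
    rcases hd : t.dest with ⟨s, f⟩
    have h' : s = .var a := by rw [RawTy.shape, hd] at h; exact h
    subst h'
    simp only [substStep, hd]
  have h2 : (substRaw σ t).dest = (σ a).raw.dest := by
    conv_rhs => rw [← corec_inr σ (σ a).raw]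
    rw [substRaw, PFunctor.M.dest_corec, PFunctor.M.dest_corec, h1]
  rw [← PFunctor.M.mk_dest (substRaw σ t), h2, PFunctor.M.mk_dest]

theorem dest_substRaw (σ : TVar → Ty B) {t : RawTy B} (h : ∀ a, t.shape ≠ .var a) :
    (substRaw σ t).dest = ⟨t.dest.1, fun i => substRaw σ (t.dest.2 i)⟩ := by
  rw [substRaw, PFunctor.M.dest_corec]
  rcases hd : t.dest with ⟨s, f⟩
  have hs : ∀ a, s ≠ .var a := by rw [RawTy.shape, hd] at h; exact h
  cases s with
  | var a => exact absurd rfl (hs a)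
  | _ => simp only [substStep, hd]; rfl

theorem child_substRaw (σ : TVar → Ty B) {s t : RawTy B} (h : RawTy.Child s (substRaw σ t)) :
    (∃ a, t.shape = .var a ∧ RawTy.Child s (σ a).raw) ∨
      ((∀ a, t.shape ≠ .var a) ∧ ∃ r, RawTy.Child r t ∧ s = substRaw σ r) := by
  by_cases hv : ∃ a, t.shape = .var a
  · obtain ⟨a, ha⟩ := hv
    exact Or.inl ⟨a, ha, by rwa [substRaw_of_var σ ha] at h⟩
  · push Not at hv
    unfold RawTy.Child at h
    rw [dest_substRaw σ hv] at h
    obtain ⟨i, hi⟩ := h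
    exact Or.inr ⟨hv, t.dest.2 i, ⟨i, rfl⟩, hi.symm⟩

theorem regular_substRaw (σ : TVar → Ty B) (t : Ty B) : (substRaw σ t.raw).Regular := by
  have hv : t.vars.Finite := by
    have h1 := (t.regular.image RawTy.shape).preimage
      (f := TyShape.var (B := B)) (fun a _ b _ h => by cases h; rfl)
    refine h1.subset ?_
    rintro a ⟨s, hs, ha⟩
    exact ⟨s, hs, ha⟩
  have hf := (t.regular.image (substRaw σ)).union
    (hv.biUnion fun a _ => (σ a).regular)
  refine hf.subset fun s hs => ?_
  change Relation.ReflTransGen _ _ _ at hs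
  induction hs using Relation.ReflTransGen.head_induction_on with
  | refl => exact Or.inl ⟨t.raw, Relation.ReflTransGen.refl, rfl⟩
  | head hc _ ih =>
    rcases ih with ⟨r, hr, rfl⟩ | hm
    · rcases child_substRaw σ hc with ⟨a, ha, hc'⟩ | ⟨_, q, hq, rfl⟩
      · exact Or.inr (Set.mem_biUnion (show a ∈ t.vars from ⟨r, hr, ha⟩)
          (Relation.ReflTransGen.single hc'))
      · exact Or.inl ⟨q, Relation.ReflTransGen.head hq hr, rfl⟩
    · obtain ⟨a, ha, hm⟩ := Set.mem_iUnion₂.1 hm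
      exact Or.inr (Set.mem_biUnion ha (Relation.ReflTransGen.head hc hm))

theorem contractive_substRaw (σ : TVar → Ty B) (t : Ty B) :
    (substRaw σ t.raw).Contractive := by
  intro f hf hc N
  by_cases hA : ∃ m, (f m).Contractive
  · obtain ⟨m, hm⟩ := hA
    exact RawTy.Contractive.of_eventually hc hm N
  · push Not at hA
    have hnv : ∀ n r, f n = substRaw σ r → ∀ a, r.shape ≠ .var a := by
      intro n r h a ha
      rw [substRaw_of_var σ ha] at h
      exact hA n (h ▸ (σ a).contractive)
    have step : ∀ n r, f n = substRaw σ r → ∃ q, RawTy.Child q r ∧ f (n + 1) = substRaw σ q := by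
      intro n r h
      have h1 := hc n
      rw [h] at h1
      rcases child_substRaw σ h1 with ⟨a, ha, _⟩ | ⟨_, q, hq, he⟩
      · exact absurd ha (hnv n r h a)
      · exact ⟨q, hq, he⟩
    have : Nonempty (RawTy B) := ⟨t.raw⟩
    choose! next hnext using step
    let g : ℕ → RawTy B := fun n => Nat.rec t.raw (fun n r => next n r) n
    have hg : ∀ n, f n = substRaw σ (g n) := by
      intro n
      induction n with
      | zero => exact hf
      | succ n ih => exact (hnext n (g n) ih).2
    obtain ⟨n, hn, h⟩ := t.contractive g rfl (fun n => (hnext n (g n) (hg n)).1) N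
    refine ⟨n, hn, ?_⟩
    have : (f n).shape = (g n).shape := by
      rw [hg n, RawTy.shape, dest_substRaw σ (hnv n _ (hg n))]
      rfl
    rwa [this]

/-- The type `t σ`. -/
def subst (σ : TVar → Ty B) (t : Ty B) : Ty B :=
  ⟨substRaw σ t.raw, regular_substRaw σ t, contractive_substRaw σ t⟩

/-- Instantiation: the substitution replaces polymorphic variables only. -/
def inst (σ : ℕ → Ty B) : Ty B → Ty B :=
  subst fun
    | .poly n => σ n
    | .mono n => var (.mono n)

/-- Generalisation: the substitution replaces the monomorphic variables in the domain of the
partial map `φ` by polymorphic ones. -/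
def gen (φ : ℕ → Option ℕ) : Ty B → Ty B :=
  subst fun
    | .poly n => var (.poly n)
    | .mono n => (φ n).elim (var (.mono n)) fun m => var (.poly m)

/-! ### Induction on unions and negations -/

/-- `Under s t`: `t` is a union or a negation, and `s` is an immediate sub-term of it. -/
def Under (s t : Ty B) : Prop :=
  (t.raw.shape = .union ∨ t.raw.shape = .neg) ∧ RawTy.Child s.raw t.raw

theorem under_wf : WellFounded (Under (B := B)) := by
  rw [wellFounded_iff_isEmpty_descending_chain]
  refine ⟨fun ⟨f, hf⟩ => ?_⟩
  obtain ⟨n, -, h⟩ := (f 0).contractive (fun n => (f n).raw) rfl (fun n => (hf n).2) 0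
  rcases (hf n).1 with h' | h' <;> simp only [h'] at h <;> rcases h with h | h <;> cases h

instance : WellFoundedRelation (Ty B) := ⟨Under, under_wf⟩

theorem under_left {t a b : Ty B} (h : t.view = .union a b) : Under a t := by
  rcases ht : t.out with ⟨s, f⟩
  have hs : t.raw.shape = s := congrArg Sigma.fst ht
  cases s <;> simp only [view, ht, reduceCtorEq, TyNode.union.injEq] at h
  obtain ⟨rfl, rfl⟩ := h
  exact ⟨Or.inl hs, by
    have := out_child t; rw [ht] at this; exact this _⟩

theorem under_right {t a b : Ty B} (h : t.view = .union a b) : Under b t := by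
  rcases ht : t.out with ⟨s, f⟩
  have hs : t.raw.shape = s := congrArg Sigma.fst ht
  cases s <;> simp only [view, ht, reduceCtorEq, TyNode.union.injEq] at h
  obtain ⟨rfl, rfl⟩ := h
  exact ⟨Or.inl hs, by
    have := out_child t; rw [ht] at this; exact this _⟩

theorem under_neg {t a : Ty B} (h : t.view = .neg a) : Under a t := by
  rcases ht : t.out with ⟨s, f⟩
  have hs : t.raw.shape = s := congrArg Sigma.fst ht
  cases s <;> simp only [view, ht, reduceCtorEq, TyNode.neg.injEq] at h
  subst h
  exact ⟨Or.inr hs, by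
    have := out_child t; rw [ht] at this; exact this _⟩

end Ty

/-- Test types as the annotations of type-cases. -/
abbrev TestTy (B : Type v) : Type v := {t : Ty B // t.IsTest}

/-! ## Interpretation of types and subtyping -/

/-- Constants and basic types: every constant `c` has a basic type `basic c`, every basic type `b`
denotes a set `consts b` of constants, and `c` belongs to the set denoted by `basic c`. -/
structure Signature (K : Type u) (B : Type v) where
  basic : K → B
  consts : B → Set K
  mem_basic : ∀ c, c ∈ consts (basic c)

/-- Elements of the interpretation domain, labelled by finite sets of type variables. A finite
relation is given by a list of its pairs; a second component `none` stands for the error `Ω`. -/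
inductive Dom (K : Type u) : Type u
  | const (c : K) (L : Finset TVar)
  | pair (d₁ d₂ : Dom K) (L : Finset TVar)
  | fn (R : List (Dom K × Option (Dom K))) (L : Finset TVar)

/-- The label of an element. -/
def Dom.tags {K : Type u} : Dom K → Finset TVar
  | .const _ L => L
  | .pair _ _ L => L
  | .fn _ L => L

theorem Dom.sizeOf_fst_lt {K : Type u} {R : List (Dom K × Option (Dom K))} {L : Finset TVar}
    {p : Dom K × Option (Dom K)} (h : p ∈ R) : sizeOf p.1 < sizeOf (Dom.fn R L) := by
  have h1 := List.sizeOf_lt_of_mem h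
  rcases p with ⟨d, o⟩
  simp only [Prod.mk.sizeOf_spec, Dom.fn.sizeOf_spec] at *
  omega

theorem Dom.sizeOf_snd_lt {K : Type u} {R : List (Dom K × Option (Dom K))} {L : Finset TVar}
    {p : Dom K × Option (Dom K)} (h : p ∈ R) {d : Dom K} (hd : p.2 = some d) :
    sizeOf d < sizeOf (Dom.fn R L) := by
  have h1 := List.sizeOf_lt_of_mem h
  rcases p with ⟨d', o⟩
  simp only at hd
  subst hd
  simp only [Prod.mk.sizeOf_spec, Dom.fn.sizeOf_spec, Option.some.sizeOf_spec] at *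
  omega

/-- `S.Mem d t`: the element `d` belongs to the type `t`, by lexicographic induction on `d` and on
the unions and negations at the top of `t`. -/
def Signature.Mem {K : Type u} {B : Type v} (S : Signature K B) (d : Dom K) (t : Ty B) : Prop :=
  match _h : t.view with
  | .base b =>
    match d with
    | .const c _ => c ∈ S.consts b
    | _ => False
  | .var a => a ∈ d.tags
  | .prod t₁ t₂ =>
    match d with
    | .pair d₁ d₂ _ => S.Mem d₁ t₁ ∧ S.Mem d₂ t₂
    | _ => False
  | .arrow t₁ t₂ =>
    match d with
    | .fn R _ => ∀ p, ∀ _hp : p ∈ R, S.Mem p.1 t₁ →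
        match _ho : p.2 with
        | some d' => S.Mem d' t₂
        | none => False
    | _ => False
  | .union t₁ t₂ => S.Mem d t₁ ∨ S.Mem d t₂
  | .neg t₁ => ¬ S.Mem d t₁
  | .empty => False
termination_by (sizeOf d, t)
decreasing_by
  · apply Prod.Lex.left; simp only [Dom.pair.sizeOf_spec]; omega
  · apply Prod.Lex.left; simp only [Dom.pair.sizeOf_spec]; omega
  · exact Prod.Lex.left _ _ (Dom.sizeOf_fst_lt _hp)
  · exact Prod.Lex.left _ _ (Dom.sizeOf_snd_lt _hp _ho)
  · exact Prod.Lex.right _ (Ty.under_left _h)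
  · exact Prod.Lex.right _ (Ty.under_right _h)
  · exact Prod.Lex.right _ (Ty.under_neg _h)

namespace Signature

variable {K : Type u} {B : Type v} (S : Signature K B)

/-- Subtyping is inclusion of the interpretations. -/
def Sub (t s : Ty B) : Prop := ∀ d, S.Mem d t → S.Mem d s

/-- The type of a constant is not cut by any basic type. -/
def AtomicConsts : Prop :=
  ∀ c b, S.consts (S.basic c) ⊆ S.consts b ∨ Disjoint (S.consts (S.basic c)) (S.consts b)

end Signature

/-! ## Expressions, values, programs (up to renaming of bound variables: de Bruijn indices) -/

inductive Expr (K : Type u) (B : Type v) : Type (max u v)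
  | const (c : K)
  | var (n : ℕ)
  | lam (e : Expr K B)
  | app (e₁ e₂ : Expr K B)
  | pair (e₁ e₂ : Expr K B)
  | fst (e : Expr K B)
  | snd (e : Expr K B)
  | tcase (e : Expr K B) (τ : TestTy B) (e₁ e₂ : Expr K B)

/-- `letIn e p` is the program `let x = e; p`, which binds the index `0` in `p`. -/
inductive Prog (K : Type u) (B : Type v) : Type (max u v)
  | expr (e : Expr K B)
  | letIn (e : Expr K B) (p : Prog K B)

inductive Val (K : Type u) (B : Type v) : Type (max u v)
  | const (c : K)
  | lam (e : Expr K B)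
  | pair (v₁ v₂ : Val K B)

def Val.toExpr {K : Type u} {B : Type v} : Val K B → Expr K B
  | .const c => .const c
  | .lam e => .lam e
  | .pair v₁ v₂ => .pair v₁.toExpr v₂.toExpr

namespace Expr

variable {K : Type u} {B : Type v}

/-- Extension of a renaming below a binder. -/
def upRen (ρ : ℕ → ℕ) : ℕ → ℕ
  | 0 => 0
  | n + 1 => ρ n + 1

def rename : (ℕ → ℕ) → Expr K B → Expr K B
  | _, const c => const c
  | ρ, var n => var (ρ n)
  | ρ, lam e => lam (rename (upRen ρ) e)
  | ρ, app e₁ e₂ => app (rename ρ e₁) (rename ρ e₂)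
  | ρ, pair e₁ e₂ => pair (rename ρ e₁) (rename ρ e₂)
  | ρ, fst e => fst (rename ρ e)
  | ρ, snd e => snd (rename ρ e)
  | ρ, tcase e τ e₁ e₂ => tcase (rename ρ e) τ (rename ρ e₁) (rename ρ e₂)

/-- Extension of a substitution below a binder. -/
def up (θ : ℕ → Expr K B) : ℕ → Expr K B
  | 0 => var 0
  | n + 1 => rename Nat.succ (θ n)

/-- Capture-avoiding simultaneous substitution. -/
def subst : (ℕ → Expr K B) → Expr K B → Expr K B
  | _, const c => const c
  | θ, var n => θ n
  | θ, lam e => lam (subst (up θ) e)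
  | θ, app e₁ e₂ => app (subst θ e₁) (subst θ e₂)
  | θ, pair e₁ e₂ => pair (subst θ e₁) (subst θ e₂)
  | θ, fst e => fst (subst θ e)
  | θ, snd e => snd (subst θ e)
  | θ, tcase e τ e₁ e₂ => tcase (subst θ e) τ (subst θ e₁) (subst θ e₂)

/-- The substitution that replaces the index `0` by `e'` and removes this index. -/
def single (e' : Expr K B) : ℕ → Expr K B
  | 0 => e'
  | n + 1 => var n

/-- `e{e'/x}`, where `x` is the index `0` of `e`. -/
def subst0 (e e' : Expr K B) : Expr K B := subst (single e') e

end Expr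

namespace Prog

variable {K : Type u} {B : Type v}

def subst : (ℕ → Expr K B) → Prog K B → Prog K B
  | θ, expr e => expr (e.subst θ)
  | θ, letIn e p => letIn (e.subst θ) (subst (Expr.up θ) p)

/-- `p{e'/x}`, where `x` is the index `0` of `p`. -/
def subst0 (p : Prog K B) (e' : Expr K B) : Prog K B := subst (Expr.single e') p

end Prog

namespace Signature

variable {K : Type u} {B : Type v} (S : Signature K B)

/-! ## Call-by-value semantics -/

def typeof : Val K B → Ty B
  | .const c => .base (S.basic c)
  | .lam _ => .arrow .empty .any
  | .pair v₁ v₂ => .prod (typeof v₁) (typeof v₂)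

/-- The dynamic type test `v ∈ t`. -/
def Test (v : Val K B) (t : Ty B) : Prop := S.Sub (S.typeof v) t

/-- Reduction of expressions: the reduction rules, closed under the evaluation contexts
`E ::= [] | E e | v E | (E, e) | (v, E) | πᵢ E | (E ∈ τ) ? e : e`. -/
inductive Step : Expr K B → Expr K B → Prop
  | beta (e : Expr K B) (v : Val K B) : Step (.app (.lam e) v.toExpr) (e.subst0 v.toExpr)
  | fst (v₁ v₂ : Val K B) : Step (.fst (.pair v₁.toExpr v₂.toExpr)) v₁.toExpr
  | snd (v₁ v₂ : Val K B) : Step (.snd (.pair v₁.toExpr v₂.toExpr)) v₂.toExpr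
  | caseThen (v : Val K B) (τ : TestTy B) (e₁ e₂ : Expr K B) (h : S.Test v τ.1) :
      Step (.tcase v.toExpr τ e₁ e₂) e₁
  | caseElse (v : Val K B) (τ : TestTy B) (e₁ e₂ : Expr K B) (h : S.Test v τ.1.neg) :
      Step (.tcase v.toExpr τ e₁ e₂) e₂
  | appL {e e' : Expr K B} (e₂ : Expr K B) : Step e e' → Step (.app e e₂) (.app e' e₂)
  | appR (v : Val K B) {e e' : Expr K B} :
      Step e e' → Step (.app v.toExpr e) (.app v.toExpr e')
  | pairL {e e' : Expr K B} (e₂ : Expr K B) : Step e e' → Step (.pair e e₂) (.pair e' e₂)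
  | pairR (v : Val K B) {e e' : Expr K B} :
      Step e e' → Step (.pair v.toExpr e) (.pair v.toExpr e')
  | fstC {e e' : Expr K B} : Step e e' → Step (.fst e) (.fst e')
  | sndC {e e' : Expr K B} : Step e e' → Step (.snd e) (.snd e')
  | caseC {e e' : Expr K B} (τ : TestTy B) (e₁ e₂ : Expr K B) :
      Step e e' → Step (.tcase e τ e₁ e₂) (.tcase e' τ e₁ e₂)

/-- Reduction of programs. -/
inductive PStep : Prog K B → Prog K B → Prop
  | letV (v : Val K B) (p : Prog K B) : PStep (.letIn v.toExpr p) (p.subst0 v.toExpr)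
  | expr {e e' : Expr K B} : S.Step e e' → PStep (.expr e) (.expr e')
  | letC {e e' : Expr K B} (p : Prog K B) : S.Step e e' → PStep (.letIn e p) (.letIn e' p)

/-- There is an infinite reduction sequence from `p`. -/
def Diverges (p : Prog K B) : Prop :=
  ∃ f : ℕ → Prog K B, f 0 = p ∧ ∀ n, S.PStep (f n) (f (n + 1))

/-! ## Declarative type system; an environment lists the types of the indices `0, 1, …` -/

inductive Typing : List (Ty B) → Expr K B → Ty B → Prop
  | const {Γ : List (Ty B)} (c : K) : Typing Γ (.const c) (.base (S.basic c))
  | ax {Γ : List (Ty B)} {n : ℕ} {t : Ty B} (h : Γ[n]? = some t) : Typing Γ (.var n) t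
  | arrowI {Γ : List (Ty B)} {e : Expr K B} {w t : Ty B} (hw : w.IsMono) :
      Typing (w :: Γ) e t → Typing Γ (.lam e) (.arrow w t)
  | arrowE {Γ : List (Ty B)} {e₁ e₂ : Expr K B} {t₁ t₂ : Ty B} :
      Typing Γ e₁ (.arrow t₁ t₂) → Typing Γ e₂ t₁ → Typing Γ (.app e₁ e₂) t₂
  | prodI {Γ : List (Ty B)} {e₁ e₂ : Expr K B} {t₁ t₂ : Ty B} :
      Typing Γ e₁ t₁ → Typing Γ e₂ t₂ → Typing Γ (.pair e₁ e₂) (.prod t₁ t₂)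
  | prodE₁ {Γ : List (Ty B)} {e : Expr K B} {t₁ t₂ : Ty B} :
      Typing Γ e (.prod t₁ t₂) → Typing Γ (.fst e) t₁
  | prodE₂ {Γ : List (Ty B)} {e : Expr K B} {t₁ t₂ : Ty B} :
      Typing Γ e (.prod t₁ t₂) → Typing Γ (.snd e) t₂
  | caseEmpty {Γ : List (Ty B)} {e : Expr K B} (τ : TestTy B) (e₁ e₂ : Expr K B) :
      Typing Γ e .empty → Typing Γ (.tcase e τ e₁ e₂) .empty
  | caseThen {Γ : List (Ty B)} {e : Expr K B} {τ : TestTy B} {e₁ : Expr K B} (e₂ : Expr K B)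
      {t₁ : Ty B} : Typing Γ e τ.1 → Typing Γ e₁ t₁ → Typing Γ (.tcase e τ e₁ e₂) t₁
  | caseElse {Γ : List (Ty B)} {e : Expr K B} {τ : TestTy B} (e₁ : Expr K B) {e₂ : Expr K B}
      {t₂ : Ty B} : Typing Γ e τ.1.neg → Typing Γ e₂ t₂ → Typing Γ (.tcase e τ e₁ e₂) t₂
  | unionE {Γ : List (Ty B)} {e e' : Expr K B} {s w t : Ty B} (hw : w.IsMono) :
      Typing Γ e' s → Typing (s.inter w :: Γ) e t → Typing (s.inter w.neg :: Γ) e t →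
      Typing Γ (e.subst0 e') t
  | interI {Γ : List (Ty B)} {e : Expr K B} {t₁ t₂ : Ty B} :
      Typing Γ e t₁ → Typing Γ e t₂ → Typing Γ e (t₁.inter t₂)
  | inst {Γ : List (Ty B)} {e : Expr K B} {t : Ty B} (σ : ℕ → Ty B) :
      Typing Γ e t → Typing Γ e (t.inst σ)
  | sub {Γ : List (Ty B)} {e : Expr K B} {t t' : Ty B} (h : S.Sub t t') :
      Typing Γ e t → Typing Γ e t'

/-- Typing of programs. A definition is typed as a one-expression program, so that its type is
generalised before it enters the environment. -/
inductive PTyping : List (Ty B) → Prog K B → Ty B → Prop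
  | expr {Γ : List (Ty B)} {e : Expr K B} {t : Ty B} (φ : ℕ → Option ℕ)
      (hφ : ∀ s ∈ Γ, ∀ n, TVar.mono n ∈ s.vars → φ n = none) :
      S.Typing Γ e t → PTyping Γ (.expr e) (t.gen φ)
  | letIn {Γ : List (Ty B)} {e : Expr K B} {p : Prog K B} {t t' : Ty B} :
      PTyping Γ (.expr e) t → PTyping (t :: Γ) p t' → PTyping Γ (.letIn e p) t'

end Signature

-- Type substitutions, sub-terms and variables

namespace Ty

variable {B : Type v}

-- A direct subject reduction argument breaks at union elimination: the rule types `e{e'/x}` by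
-- splitting the type of one expression `e'`, whereas reduction changes the copies of `e'` one at a
-- time. The proof replaces reduction by a deterministic evaluation that treats all copies alike.
-- Terms receive a diverging constant `bot`, and `approx n` reduces bottom-up every closed sub-term,
-- also below abstractions; each contraction of an application passes to less fuel, and exhausted
-- fuel gives `bot`. A copied expression whose result is closed becomes a single value, which
-- belongs to `u` or to its complement, or `bot`, which has every type. If the result is open, it
-- stays in place and union elimination still applies to it.
--
-- Values are typed semantically by `Sat`, with classical unions and negations. The arrow types of
-- an abstraction are the set-theoretic consequences of finitely many derivable monomorphic arrows
-- (`Arrows`), so a negated arrow holds exactly when the arrow does not. Such types need not be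
-- derivable; they re-enter derivations as axioms about closed normal values (`DTyping`), and a
-- bound on the size of these values makes the definition well-founded. A polymorphic type stands
-- for all its monomorphic instances (`Good`).
--
-- Finitely many types cannot separate a value from a suitable element of the domain
-- (`exists_mem_iff_sat`). Hence subtyping is sound for values (`Sub.sat`), and testing the
-- consequences of arrows on relations with one pair gives the typing of applications
-- (`arrows_apply`). With these, `DTyping.norm` and an induction on fuel show that approximation
-- preserves types: a closed result is `bot` or a value of the given type.
--
-- Actual reduction is compared with approximation in the order `Le`, which refines occurrences of
-- `bot`: if `e` reduces to `e'`, then `approx n e'` lies below `approx (n + 1) e`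
-- (`Step.le_approx`). Stuck expressions have stuck approximations, and these stay stuck upwards. So
-- a normal form reached from a well-typed expression is a value with the dynamic type of a
-- well-typed approximation, and for test types the dynamic type decides membership because
-- constants are atomic. In programs, only the unevaluated definitions are typed, generalised
-- variables being handled through `gen_inst` and `Typing.msubst`; the values computed from them
-- merely lie below them.

theorem raw_ext {x y : RawTy B} (h : x.dest = y.dest) : x = y := by
  rw [← PFunctor.M.mk_dest x, h, PFunctor.M.mk_dest]

theorem subst_node (σ : TVar → Ty B) (s : TyShape B) (f : Fin s.arity → Ty B)
    (h : ∀ a, s ≠ .var a) : subst σ (node ⟨s, f⟩) = node ⟨s, fun i => subst σ (f i)⟩ :=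
  Ty.ext (raw_ext (dest_substRaw σ (t := (node ⟨s, f⟩).raw) h))

theorem subst_base (σ : TVar → Ty B) (b : B) : subst σ (base b) = base b :=
  (subst_node σ (.base b) Fin.elim0 (by simp)).trans
    (congrArg (fun g => node ⟨.base b, g⟩) (funext fun i => i.elim0))

theorem subst_empty (σ : TVar → Ty B) : subst σ (empty : Ty B) = empty :=
  (subst_node σ .empty Fin.elim0 (by simp)).trans
    (congrArg (fun g => node ⟨.empty, g⟩) (funext fun i => i.elim0))

theorem subst_var (σ : TVar → Ty B) (a : TVar) : subst σ (var a) = σ a :=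
  Ty.ext (substRaw_of_var σ rfl)

theorem map_pair {X Y : Type*} (f : X → Y) (x y : X) :
    (fun i : Fin 2 => f (![x, y] i)) = ![f x, f y] := by
  funext i
  fin_cases i <;> rfl

theorem subst_arrow (σ : TVar → Ty B) (t s : Ty B) :
    subst σ (arrow t s) = arrow (subst σ t) (subst σ s) :=
  (subst_node σ .arrow ![t, s] (by simp)).trans
    (congrArg (fun g => node ⟨.arrow, g⟩) (map_pair (subst σ) t s))

theorem subst_prod (σ : TVar → Ty B) (t s : Ty B) :
    subst σ (prod t s) = prod (subst σ t) (subst σ s) :=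
  (subst_node σ .prod ![t, s] (by simp)).trans
    (congrArg (fun g => node ⟨.prod, g⟩) (map_pair (subst σ) t s))

theorem subst_union (σ : TVar → Ty B) (t s : Ty B) :
    subst σ (union t s) = union (subst σ t) (subst σ s) :=
  (subst_node σ .union ![t, s] (by simp)).trans
    (congrArg (fun g => node ⟨.union, g⟩) (map_pair (subst σ) t s))

theorem subst_neg (σ : TVar → Ty B) (t : Ty B) : subst σ (neg t) = neg (subst σ t) :=
  (subst_node σ .neg ![t] (by simp)).trans
    (congrArg (fun g => node ⟨.neg, g⟩) (funext fun i => by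
      rw [Subsingleton.elim (α := Fin 1) i 0]; rfl))

theorem subst_inter (σ : TVar → Ty B) (t s : Ty B) :
    subst σ (inter t s) = inter (subst σ t) (subst σ s) := by
  simp only [inter, subst_neg, subst_union]

/-- Types may be infinite, so equalities of substitution instances are proved by bisimulation. The
relation is restricted to sub-terms of `t`, so that the hypothesis is needed only for variables that
occur. -/
theorem subst_eq_self {σ : TVar → Ty B} {t : Ty B} (h : ∀ a ∈ t.vars, σ a = var a) :
    subst σ t = t := by
  refine Ty.ext (PFunctor.M.bisim
    (fun x y : RawTy B => RawTy.Subterm y t.raw ∧ x = substRaw σ y) ?_ _ _ ⟨.refl, rfl⟩)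
  rintro x (y : RawTy B) ⟨hy, rfl⟩
  by_cases hv : ∃ a, RawTy.shape y = .var a
  · obtain ⟨a, ha⟩ := hv
    have h1 : substRaw σ y = (var a : Ty B).raw := by
      rw [substRaw_of_var σ ha, h a ⟨y, hy, ha⟩]
    rw [h1]
    rcases hd : y.dest with ⟨s, f⟩
    rw [RawTy.shape, hd] at ha
    cases ha
    exact ⟨_, _, _, rfl, rfl, fun i => i.elim0⟩
  · push Not at hv
    refine ⟨y.dest.1, _, _, dest_substRaw σ hv, rfl, fun i => ⟨?_, rfl⟩⟩
    exact Relation.ReflTransGen.head ⟨i, rfl⟩ hy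

theorem shape_substRaw (σ : TVar → Ty B) {t : RawTy B} (h : ∀ a, t.shape ≠ .var a) :
    (substRaw σ t).shape = t.shape := by
  rw [RawTy.shape, dest_substRaw σ h]
  rfl

theorem subst_subst_eq {σ τ υ : TVar → Ty B} {t : Ty B}
    (h : ∀ a ∈ t.vars, subst τ (σ a) = υ a) : subst τ (subst σ t) = subst υ t := by
  -- Equality is part of the relation because both sides coincide once a variable has been reached.
  refine Ty.ext (PFunctor.M.bisim
    (fun x y => x = y ∨ ∃ s, RawTy.Subterm s t.raw ∧ x = substRaw τ (substRaw σ s) ∧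
      y = substRaw υ s) ?_ _ _ (Or.inr ⟨t.raw, .refl, rfl, rfl⟩))
  rintro x y (rfl | ⟨s, hs, rfl, rfl⟩)
  · exact ⟨_, _, _, rfl, rfl, fun i => Or.inl rfl⟩
  · by_cases hv : ∃ a, s.shape = .var a
    · obtain ⟨a, ha⟩ := hv
      have h1 : substRaw τ (substRaw σ s) = substRaw υ s := by
        rw [substRaw_of_var σ ha, substRaw_of_var υ ha, ← h a ⟨s, hs, ha⟩]
        rfl
      rw [h1]
      exact ⟨_, _, _, rfl, rfl, fun i => Or.inl rfl⟩
    · push Not at hv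
      have h1 := dest_substRaw σ hv
      have h2 : ∀ a, (substRaw σ s).shape ≠ .var a := by rwa [shape_substRaw σ hv]
      have h3 := dest_substRaw τ h2
      rw [h1] at h3
      exact ⟨_, _, _, h3, dest_substRaw υ hv, fun i => Or.inr
        ⟨s.dest.2 i, Relation.ReflTransGen.head ⟨i, rfl⟩ hs, rfl, rfl⟩⟩

theorem vars_subst {σ : TVar → Ty B} {t : Ty B} {a : TVar} (h : a ∈ (subst σ t).vars) :
    ∃ b ∈ t.vars, a ∈ (σ b).vars := by
  obtain ⟨s, hs, ha⟩ := h
  have key : (∃ r, RawTy.Subterm r t.raw ∧ s = substRaw σ r) ∨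
      ∃ b ∈ t.vars, RawTy.Subterm s (σ b).raw := by
    clear ha
    change Relation.ReflTransGen _ _ _ at hs
    induction hs using Relation.ReflTransGen.head_induction_on with
    | refl => exact Or.inl ⟨t.raw, .refl, rfl⟩
    | head hc _ ih =>
      rcases ih with ⟨r, hr, rfl⟩ | ⟨b, hb, hm⟩
      · rcases child_substRaw σ hc with ⟨b, hb, hc'⟩ | ⟨_, q, hq, rfl⟩
        · exact Or.inr ⟨b, ⟨r, hr, hb⟩, .single hc'⟩
        · exact Or.inl ⟨q, .head hq hr, rfl⟩
      · exact Or.inr ⟨b, hb, .head hc hm⟩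
  rcases key with ⟨r, hr, rfl⟩ | ⟨b, hb, hm⟩
  · by_cases hv : ∃ b, r.shape = .var b
    · obtain ⟨b, hb⟩ := hv
      rw [substRaw_of_var σ hb] at ha
      exact ⟨b, ⟨r, hr, hb⟩, ⟨_, .refl, ha⟩⟩
    · push Not at hv
      rw [shape_substRaw σ hv] at ha
      exact absurd ha (hv a)
  · exact ⟨b, hb, s, hm, ha⟩

theorem vars_finite (t : Ty B) : t.vars.Finite := by
  have h1 := (t.regular.image RawTy.shape).preimage
    (f := TyShape.var (B := B)) (fun a _ b _ h => by cases h; rfl)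
  exact h1.subset fun a ⟨s, hs, ha⟩ => ⟨s, hs, ha⟩

/-! ### Sub-terms as types -/

/-- `IsSub s t`: the type `s` is a sub-term of the type `t`. -/
def IsSub (s t : Ty B) : Prop := RawTy.Subterm s.raw t.raw

theorem IsSub.refl (t : Ty B) : IsSub t t := Relation.ReflTransGen.refl

theorem IsSub.trans {r s t : Ty B} (h : IsSub r s) (h' : IsSub s t) : IsSub r t :=
  Relation.ReflTransGen.trans h h'

theorem isSub_node (x : (tyF B) (Ty B)) (i) : IsSub (x.2 i) (node x) :=
  .single ⟨i, rfl⟩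

theorem isSub_arrow_left (t s : Ty B) : IsSub t (arrow t s) :=
  isSub_node ⟨.arrow, ![t, s]⟩ (0 : Fin 2)

theorem isSub_arrow_right (t s : Ty B) : IsSub s (arrow t s) :=
  isSub_node ⟨.arrow, ![t, s]⟩ (1 : Fin 2)

theorem isSub_prod_left (t s : Ty B) : IsSub t (prod t s) :=
  isSub_node ⟨.prod, ![t, s]⟩ (0 : Fin 2)

theorem isSub_prod_right (t s : Ty B) : IsSub s (prod t s) :=
  isSub_node ⟨.prod, ![t, s]⟩ (1 : Fin 2)

theorem isSub_union_left (t s : Ty B) : IsSub t (union t s) :=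
  isSub_node ⟨.union, ![t, s]⟩ (0 : Fin 2)

theorem isSub_union_right (t s : Ty B) : IsSub s (union t s) :=
  isSub_node ⟨.union, ![t, s]⟩ (1 : Fin 2)

theorem isSub_neg (t : Ty B) : IsSub t (neg t) :=
  isSub_node ⟨.neg, ![t]⟩ (0 : Fin 1)

theorem IsSub.vars_subset {s t : Ty B} (h : IsSub s t) : s.vars ⊆ t.vars :=
  fun _ ⟨r, hr, ha⟩ => ⟨r, Relation.ReflTransGen.trans hr h, ha⟩

theorem finite_isSub (t : Ty B) : {s | IsSub s t}.Finite :=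
  Set.Finite.preimage (f := Ty.raw) (fun _ _ _ _ h => Ty.ext h) t.regular

theorem mem_vars_var (a : TVar) : a ∈ (var a : Ty B).vars := ⟨_, .refl, rfl⟩

theorem vars_var {a b : TVar} (h : a ∈ (var b : Ty B).vars) : a = b := by
  obtain ⟨s, hs, ha⟩ := h
  rcases Relation.ReflTransGen.cases_tail hs with h | ⟨r, _, i, _⟩
  · rw [← h] at ha
    cases ha
    rfl
  · exact Fin.elim0 i

theorem isMono_var (n : ℕ) : (var (.mono n) : Ty B).IsMono := fun k h => by
  cases vars_var h

theorem isMono_empty : (empty : Ty B).IsMono := fun k h => by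
  obtain ⟨s, hs, ha⟩ := h
  rcases Relation.ReflTransGen.cases_tail hs with h | ⟨r, _, i, _⟩
  · rw [← h] at ha
    cases ha
  · exact Fin.elim0 i

/-- Every type is built by one of the productions of the grammar; the hypotheses on immediate
components of unions and negations make this an induction principle. -/
theorem bool_induction {P : Ty B → Prop} (base : ∀ b, P (base b)) (var : ∀ a, P (var a))
    (arrow : ∀ t s, P (arrow t s)) (prod : ∀ t s, P (prod t s))
    (union : ∀ t s, P t → P s → P (union t s)) (neg : ∀ t, P t → P (neg t)) (empty : P empty)
    (t : Ty B) : P t := by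
  induction t using under_wf.induction with
  | _ t ih =>
    obtain ⟨⟨s, f⟩, rfl⟩ : ∃ x, t = node x := ⟨t.out, (node_out t).symm⟩
    have e0 : ∀ g : Fin 0 → Ty B, g = Fin.elim0 := fun g => funext fun i => i.elim0
    have e1 : ∀ g : Fin 1 → Ty B, g = ![g 0] := fun g => funext fun i => by
      rw [Subsingleton.elim i 0]; rfl
    have e2 : ∀ g : Fin 2 → Ty B, g = ![g 0, g 1] := fun g => funext fun i =>
      Fin.cases rfl (fun j => by rw [Subsingleton.elim j (0 : Fin 1)]; rfl) i
    cases s with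
    | base b => rw [show f = Fin.elim0 from e0 f]; exact base b
    | var a => rw [show f = Fin.elim0 from e0 f]; exact var a
    | arrow => rw [show f = ![f (0 : Fin 2), f (1 : Fin 2)] from e2 f]; exact arrow _ _
    | prod => rw [show f = ![f (0 : Fin 2), f (1 : Fin 2)] from e2 f]; exact prod _ _
    | union =>
      have h0 := ih (f (0 : Fin 2)) ⟨Or.inl rfl, (0 : Fin 2), rfl⟩
      have h1 := ih (f (1 : Fin 2)) ⟨Or.inl rfl, (1 : Fin 2), rfl⟩
      rw [show f = ![f (0 : Fin 2), f (1 : Fin 2)] from e2 f]; exact union _ _ h0 h1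
    | neg =>
      have h0 := ih (f (0 : Fin 1)) ⟨Or.inr rfl, (0 : Fin 1), rfl⟩
      rw [show f = ![f (0 : Fin 1)] from e1 f]; exact neg _ h0
    | empty => rw [show f = Fin.elim0 from e0 f]; exact empty

theorem inst_of_isMono {t : Ty B} (h : t.IsMono) (σ : ℕ → Ty B) : t.inst σ = t :=
  subst_eq_self fun a ha => by
    cases a with
    | poly n => exact absurd ha (h n)
    | mono n => rfl

theorem isMono_inst (t : Ty B) {σ : ℕ → Ty B} (h : ∀ n, (σ n).IsMono) : (t.inst σ).IsMono := by
  intro k hk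
  obtain ⟨b, _, hb⟩ := vars_subst hk
  cases b with
  | poly n => exact h n k hb
  | mono n => exact isMono_var n k hb

theorem inst_inst (t : Ty B) (σ τ : ℕ → Ty B) :
    (t.inst σ).inst τ = t.inst fun n => (σ n).inst τ :=
  subst_subst_eq fun a _ => by
    cases a with
    | poly n => rfl
    | mono n => exact subst_var _ _

theorem subst_of_isTest {t : Ty B} (h : t.IsTest) (σ : TVar → Ty B) : subst σ t = t :=
  subst_eq_self fun a ha => by rw [h.1] at ha; exact ha.elim

/-- Replacement of the monomorphic variables. -/
def msubst (η : ℕ → Ty B) : Ty B → Ty B :=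
  subst fun
    | .poly n => var (.poly n)
    | .mono n => η n

theorem isMono_msubst {η : ℕ → Ty B} (hη : ∀ n, (η n).IsMono) {t : Ty B} (h : t.IsMono) :
    (t.msubst η).IsMono := by
  intro k hk
  obtain ⟨b, hb, hk⟩ := vars_subst hk
  cases b with
  | poly n => exact h n hb
  | mono n => exact hη n k hk

/-- The two substitutions commute because the types `η n` contain no polymorphic variable, so a
later instantiation leaves them alone. This is the instantiation case of `Typing.msubst`. -/
theorem msubst_inst {η : ℕ → Ty B} (hη : ∀ n, (η n).IsMono) (t : Ty B) (σ : ℕ → Ty B) :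
    (t.inst σ).msubst η = (t.msubst η).inst fun n => (σ n).msubst η := by
  have h1 : (t.inst σ).msubst η = subst (fun
    | .poly n => (σ n).msubst η
    | .mono n => η n) t := subst_subst_eq fun a _ => by
      cases a with
      | poly n => rfl
      | mono n => exact subst_var _ _
  rw [h1]
  refine (subst_subst_eq fun a _ => ?_).symm
  cases a with
  | poly n => exact subst_var _ _
  | mono n => exact inst_of_isMono (hη n) _

/-- An instance of a generalised type is an instance of a type in which the generalised
monomorphic variables are replaced. -/
theorem gen_inst (φ : ℕ → Option ℕ) {σ : ℕ → Ty B} (hσ : ∀ n, (σ n).IsMono) (t : Ty B) :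
    (t.gen φ).inst σ =
      (t.msubst fun n => (φ n).elim (var (.mono n)) σ).inst σ := by
  refine (subst_subst_eq fun a _ => ?_).trans (subst_subst_eq fun a _ => rfl).symm
  cases a with
  | poly n => rfl
  | mono n =>
    cases h : φ n with
    | none => simp only [h, Option.elim]
    | some m =>
      simp only [h, Option.elim]
      exact (subst_var _ _).trans (inst_of_isMono (hσ m) σ).symm

end Ty

-- Membership in types and its stability under type substitutions

namespace Signature

variable {K : Type u} {B : Type v} (S : Signature K B)

theorem mem_base {d : Dom K} {b : B} :
    S.Mem d (.base b) ↔ ∃ c L, d = .const c L ∧ c ∈ S.consts b := by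
  rw [Mem]
  change (match d with | .const c _ => c ∈ S.consts b | _ => False) ↔ _
  cases d <;> simp

theorem mem_var {d : Dom K} {a : TVar} : S.Mem d (.var a) ↔ a ∈ d.tags := by
  rw [Mem]
  exact Iff.rfl

theorem mem_prod {d : Dom K} {t s : Ty B} :
    S.Mem d (.prod t s) ↔ ∃ d₁ d₂ L, d = .pair d₁ d₂ L ∧ S.Mem d₁ t ∧ S.Mem d₂ s := by
  rw [Mem]
  change (match d with | .pair d₁ d₂ _ => S.Mem d₁ t ∧ S.Mem d₂ s | _ => False) ↔ _
  cases d <;> simp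

theorem mem_arrow_fn {R : List (Dom K × Option (Dom K))} {L : Finset TVar} {t s : Ty B} :
    S.Mem (.fn R L) (.arrow t s) ↔
      ∀ p ∈ R, S.Mem p.1 t → ∃ d, p.2 = some d ∧ S.Mem d s := by
  rw [Mem]
  change (∀ p, ∀ _ : p ∈ R, S.Mem p.1 t →
    match _ho : p.2 with
    | some d' => S.Mem d' s
    | none => False) ↔ _
  refine forall_congr' fun p => forall_congr' fun _ => forall_congr' fun _ => ?_
  rcases p with ⟨p, _ | o⟩ <;> simp

theorem mem_arrow {d : Dom K} {t s : Ty B} :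
    S.Mem d (.arrow t s) ↔ ∃ R L, d = .fn R L ∧
      ∀ p ∈ R, S.Mem p.1 t → ∃ d, p.2 = some d ∧ S.Mem d s := by
  cases d with
  | fn R L =>
    rw [mem_arrow_fn]
    simp only [Dom.fn.injEq]
    exact ⟨fun h => ⟨R, L, ⟨rfl, rfl⟩, h⟩, fun ⟨_, _, ⟨h, _⟩, h'⟩ => h ▸ h'⟩
  | _ =>
    rw [Mem]
    change False ↔ _
    simp

theorem mem_union {d : Dom K} {t s : Ty B} :
    S.Mem d (.union t s) ↔ S.Mem d t ∨ S.Mem d s := by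
  rw [Mem]
  exact Iff.rfl

theorem mem_neg {d : Dom K} {t : Ty B} : S.Mem d (.neg t) ↔ ¬ S.Mem d t := by
  rw [Mem]
  exact Iff.rfl

theorem mem_empty {d : Dom K} : S.Mem d .empty ↔ False := by
  rw [Mem]
  exact Iff.rfl

theorem mem_top_arrow {d : Dom K} :
    S.Mem d (.arrow .empty .any) ↔ ∃ R L, d = .fn R L := by
  simp [mem_arrow, mem_empty]

/-- Membership in `t σ` is membership in `t` after a change of labels, uniformly in all types `t`
with variables in a given finite set. -/
theorem exists_relabel (σ : TVar → Ty B) (V : Finset TVar) (d : Dom K) :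
    ∃ d' : Dom K, ∀ t : Ty B, t.vars ⊆ V → (S.Mem d (t.subst σ) ↔ S.Mem d' t) := by
  classical
  induction hn : sizeOf d using Nat.strong_induction_on generalizing d with
  | _ n ih =>
    subst hn
    -- The size bound sits inside the existential so that `choose` gives a total function, which can
    -- be mapped over the pairs of a relation.
    have ih' : ∀ x : Dom K, ∃ x' : Dom K, sizeOf x < sizeOf d →
        ∀ t : Ty B, t.vars ⊆ V → (S.Mem x (t.subst σ) ↔ S.Mem x' t) := fun x => by
      by_cases h : sizeOf x < sizeOf d
      · obtain ⟨x', hx⟩ := ih _ h x rfl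
        exact ⟨x', fun _ => hx⟩
      · exact ⟨x, fun h' => absurd h' h⟩
    choose g hg using ih'
    -- The new label records which types `σ a` contain `d`. It has to be finite, hence the
    -- restriction to a finite set of variables fixed in advance.
    let L' : Finset TVar := V.filter fun a => S.Mem d (σ a)
    have hL : ∀ a ∈ V, (S.Mem d (σ a) ↔ a ∈ L') := fun a ha => by simp [L', ha]
    clear_value L'
    have hvar : ∀ a, (Ty.var a : Ty B).vars ⊆ V → (S.Mem d (σ a) ↔ a ∈ L') := fun a ha =>
      hL a (ha (Ty.mem_vars_var a))
    refine ⟨match d with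
      | .const c _ => .const c L'
      | .pair d₁ d₂ _ => .pair (g d₁) (g d₂) L'
      | .fn R _ => .fn (R.map fun p => (g p.1, p.2.map g)) L', fun t => ?_⟩
    induction t using Ty.bool_induction with
    | base b => intro _; rw [Ty.subst_base, mem_base, mem_base]; cases d <;> simp
    | var a =>
      intro h
      rw [Ty.subst_var, mem_var, hvar a h]
      cases d <;> rfl
    | prod t s =>
      intro h
      rw [Ty.subst_prod, mem_prod, mem_prod]
      have h1 := (Ty.isSub_prod_left t s).vars_subset.trans h
      have h2 := (Ty.isSub_prod_right t s).vars_subset.trans h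
      cases d with
      | pair d₁ d₂ L =>
        have e1 := hg d₁ (by simp only [Dom.pair.sizeOf_spec]; omega) t h1
        have e2 := hg d₂ (by simp only [Dom.pair.sizeOf_spec]; omega) s h2
        simp [e1, e2]
      | _ => simp
    | arrow t s =>
      intro h
      rw [Ty.subst_arrow]
      have h1 := (Ty.isSub_arrow_left t s).vars_subset.trans h
      have h2 := (Ty.isSub_arrow_right t s).vars_subset.trans h
      cases d with
      | fn R L =>
        rw [mem_arrow_fn, mem_arrow_fn, List.forall_mem_map]
        refine forall_congr' fun p => forall_congr' fun hp => ?_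
        refine imp_congr (hg p.1 (Dom.sizeOf_fst_lt hp) t h1) ?_
        rcases p with ⟨p, _ | o⟩
        · simp
        · simpa using hg o (Dom.sizeOf_snd_lt hp rfl) s h2
      | _ => simp [mem_arrow]
    | union t s iht ihs =>
      intro h
      rw [Ty.subst_union, mem_union, mem_union,
        iht ((Ty.isSub_union_left t s).vars_subset.trans h),
        ihs ((Ty.isSub_union_right t s).vars_subset.trans h)]
    | neg t iht =>
      intro h
      rw [Ty.subst_neg, mem_neg, mem_neg, iht ((Ty.isSub_neg t).vars_subset.trans h)]
    | empty => intro _; rw [Ty.subst_empty, mem_empty, mem_empty]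

variable {S}

/-- Subtyping is preserved by type substitutions. -/
theorem Sub.subst {t t' : Ty B} (h : S.Sub t t') (σ : TVar → Ty B) :
    S.Sub (t.subst σ) (t'.subst σ) := by
  intro d hd
  obtain ⟨d', hd'⟩ := S.exists_relabel σ
    (t.vars_finite.toFinset ∪ t'.vars_finite.toFinset) d
  rw [hd' t' (by intro a ha; simp [ha])]
  rw [hd' t (by intro a ha; simp [ha])] at hd
  exact h d' hd

/-- Typing is preserved by replacing monomorphic variables with monomorphic types. -/
theorem Typing.msubst {Γ : List (Ty B)} {e : Expr K B} {t : Ty B} (h : S.Typing Γ e t)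
    {η : ℕ → Ty B} (hη : ∀ n, (η n).IsMono) :
    S.Typing (Γ.map (Ty.msubst η)) e (t.msubst η) := by
  induction h with
  | const c => rw [Ty.msubst, Ty.subst_base]; exact .const c
  | ax h => exact .ax (by simp [h])
  | arrowI hw _ ih =>
    rw [Ty.msubst, Ty.subst_arrow]
    exact .arrowI (Ty.isMono_msubst hη hw) ih
  | arrowE _ _ ih₁ ih₂ =>
    rw [Ty.msubst, Ty.subst_arrow] at ih₁
    exact .arrowE ih₁ ih₂
  | prodI _ _ ih₁ ih₂ =>
    rw [Ty.msubst, Ty.subst_prod]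
    exact .prodI ih₁ ih₂
  | prodE₁ _ ih =>
    rw [Ty.msubst, Ty.subst_prod] at ih
    exact .prodE₁ ih
  | prodE₂ _ ih =>
    rw [Ty.msubst, Ty.subst_prod] at ih
    exact .prodE₂ ih
  | caseEmpty τ e₁ e₂ _ ih =>
    rw [Ty.msubst, Ty.subst_empty] at ih ⊢
    exact .caseEmpty τ e₁ e₂ ih
  | @caseThen _ _ τ _ e₂ _ _ _ ih₁ ih₂ =>
    rw [Ty.msubst, Ty.subst_of_isTest τ.2] at ih₁
    exact .caseThen e₂ ih₁ ih₂
  | @caseElse _ _ τ e₁ _ _ _ _ ih₁ ih₂ =>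
    rw [Ty.msubst, Ty.subst_neg, Ty.subst_of_isTest τ.2] at ih₁
    exact .caseElse e₁ ih₁ ih₂
  | unionE hw _ _ _ ih ih₁ ih₂ =>
    rw [List.map_cons, Ty.msubst, Ty.subst_inter] at ih₁ ih₂
    rw [Ty.subst_neg] at ih₂
    exact .unionE (Ty.isMono_msubst hη hw) ih ih₁ ih₂
  | interI _ _ ih₁ ih₂ =>
    rw [Ty.msubst, Ty.subst_inter]
    exact .interI ih₁ ih₂
  | inst σ _ ih =>
    rw [Ty.msubst_inst hη]
    exact .inst _ ih
  | sub h _ ih => exact .sub (h.subst _) ih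

end Signature

/-! ## Expressions with a diverging constant -/

/-- Expressions extended with a closed expression `bot` that diverges. -/
inductive Tm (K : Type u) (B : Type v) : Type (max u v)
  | const (c : K)
  | var (n : ℕ)
  | lam (e : Tm K B)
  | app (e₁ e₂ : Tm K B)
  | pair (e₁ e₂ : Tm K B)
  | fst (e : Tm K B)
  | snd (e : Tm K B)
  | tcase (e : Tm K B) (τ : TestTy B) (e₁ e₂ : Tm K B)
  | bot

namespace Tm

variable {K : Type u} {B : Type v}

def rename : (ℕ → ℕ) → Tm K B → Tm K B
  | _, const c => const c
  | ρ, var n => var (ρ n)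
  | ρ, lam e => lam (rename (Expr.upRen ρ) e)
  | ρ, app e₁ e₂ => app (rename ρ e₁) (rename ρ e₂)
  | ρ, pair e₁ e₂ => pair (rename ρ e₁) (rename ρ e₂)
  | ρ, fst e => fst (rename ρ e)
  | ρ, snd e => snd (rename ρ e)
  | ρ, tcase e τ e₁ e₂ => tcase (rename ρ e) τ (rename ρ e₁) (rename ρ e₂)
  | _, bot => bot

def up (θ : ℕ → Tm K B) : ℕ → Tm K B
  | 0 => var 0
  | n + 1 => rename Nat.succ (θ n)

def subst : (ℕ → Tm K B) → Tm K B → Tm K B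
  | _, const c => const c
  | θ, var n => θ n
  | θ, lam e => lam (subst (up θ) e)
  | θ, app e₁ e₂ => app (subst θ e₁) (subst θ e₂)
  | θ, pair e₁ e₂ => pair (subst θ e₁) (subst θ e₂)
  | θ, fst e => fst (subst θ e)
  | θ, snd e => snd (subst θ e)
  | θ, tcase e τ e₁ e₂ => tcase (subst θ e) τ (subst θ e₁) (subst θ e₂)
  | _, bot => bot

/-- Extension of a substitution by a term for the index `0`. -/
def cons (g : Tm K B) (θ : ℕ → Tm K B) : ℕ → Tm K B
  | 0 => g
  | n + 1 => θ n

def subst0 (e e' : Tm K B) : Tm K B := subst (cons e' var) e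

/-- `Occ n e`: the index `n` occurs free in `e`. -/
def Occ : ℕ → Tm K B → Prop
  | _, const _ => False
  | n, var m => m = n
  | n, lam e => Occ (n + 1) e
  | n, app e₁ e₂ => Occ n e₁ ∨ Occ n e₂
  | n, pair e₁ e₂ => Occ n e₁ ∨ Occ n e₂
  | n, fst e => Occ n e
  | n, snd e => Occ n e
  | n, tcase e _ e₁ e₂ => Occ n e ∨ Occ n e₁ ∨ Occ n e₂
  | _, bot => False

def Closed (e : Tm K B) : Prop := ∀ n, ¬ Occ n e

def size : Tm K B → ℕ
  | const _ => 1
  | var _ => 1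
  | lam e => size e + 1
  | app e₁ e₂ => size e₁ + size e₂ + 1
  | pair e₁ e₂ => size e₁ + size e₂ + 1
  | fst e => size e + 1
  | snd e => size e + 1
  | tcase e _ e₁ e₂ => size e + size e₁ + size e₂ + 1
  | bot => 1

def IsVal : Tm K B → Prop
  | const _ => True
  | lam _ => True
  | pair e₁ e₂ => IsVal e₁ ∧ IsVal e₂
  | _ => False

-- Calculus of substitutions, free indices and sizes

theorem subst_congr {θ θ' : ℕ → Tm K B} {e : Tm K B} (h : ∀ n, Occ n e → θ n = θ' n) :
    subst θ e = subst θ' e := by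
  induction e generalizing θ θ' with
  | const | bot => rfl
  | var n => simp [subst, h n rfl]
  | lam e ih =>
    simp only [subst]
    rw [ih]
    intro n hn
    cases n with
    | zero => rfl
    | succ n => simp [up, h n hn]
  | app _ _ ih₁ ih₂ | pair _ _ ih₁ ih₂ =>
    simp only [subst]
    rw [ih₁ fun n hn => h n (Or.inl hn), ih₂ fun n hn => h n (Or.inr hn)]
  | fst _ ih | snd _ ih => simp only [subst]; rw [ih h]
  | tcase _ _ _ _ ih ih₁ ih₂ =>
    simp only [subst]
    rw [ih fun n hn => h n (Or.inl hn), ih₁ fun n hn => h n (Or.inr (Or.inl hn)),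
      ih₂ fun n hn => h n (Or.inr (Or.inr hn))]

theorem rename_eq_subst (ρ : ℕ → ℕ) (e : Tm K B) : rename ρ e = subst (fun n => var (ρ n)) e := by
  induction e generalizing ρ with
  | lam e ih =>
    simp only [rename, subst, ih]
    congr 2
    funext n
    cases n <;> rfl
  | _ => simp only [rename, subst, *]

theorem subst_var (e : Tm K B) : subst var e = e := by
  induction e with
  | lam e ih =>
    simp only [subst]
    rw [show up (var : ℕ → Tm K B) = var from funext fun n => by cases n <;> rfl, ih]
  | _ => simp only [subst, *]

theorem Closed.subst {e : Tm K B} (h : Closed e) (θ : ℕ → Tm K B) : subst θ e = e :=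
  (subst_congr fun n hn => absurd hn (h n)).trans (subst_var e)

theorem Closed.rename {e : Tm K B} (h : Closed e) (ρ : ℕ → ℕ) : rename ρ e = e := by
  rw [rename_eq_subst, h.subst]

theorem rename_rename (ρ ρ' : ℕ → ℕ) (e : Tm K B) :
    rename ρ' (rename ρ e) = rename (fun n => ρ' (ρ n)) e := by
  induction e generalizing ρ ρ' with
  | lam e ih =>
    simp only [rename, ih]
    congr 2
    funext n
    cases n <;> rfl
  | _ => simp only [rename, *]

theorem subst_rename (ρ : ℕ → ℕ) (θ : ℕ → Tm K B) (e : Tm K B) :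
    subst θ (rename ρ e) = subst (fun n => θ (ρ n)) e := by
  induction e generalizing ρ θ with
  | lam e ih =>
    simp only [rename, subst, ih]
    congr 2
    funext n
    cases n <;> rfl
  | _ => simp only [rename, subst, *]

theorem rename_subst (ρ : ℕ → ℕ) (θ : ℕ → Tm K B) (e : Tm K B) :
    rename ρ (subst θ e) = subst (fun n => rename ρ (θ n)) e := by
  induction e generalizing ρ θ with
  | lam e ih =>
    simp only [rename, subst, ih]
    congr 2
    funext n
    cases n with
    | zero => rfl
    | succ n => simp only [up, rename_rename]; rfl
  | _ => simp only [rename, subst, *]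

theorem subst_subst (θ θ' : ℕ → Tm K B) (e : Tm K B) :
    subst θ' (subst θ e) = subst (fun n => subst θ' (θ n)) e := by
  induction e generalizing θ θ' with
  | lam e ih =>
    simp only [subst, ih]
    congr 2
    funext n
    cases n with
    | zero => rfl
    | succ n => simp only [up, rename_subst, subst_rename]
  | _ => simp only [subst, *]

theorem subst_cons_up (g : Tm K B) (θ : ℕ → Tm K B) (e : Tm K B) :
    subst0 (subst (up θ) e) g = subst (cons g θ) e := by
  rw [subst0, subst_subst]
  congr 1
  funext n
  cases n with
  | zero => rfl
  | succ n => simp only [up, subst_rename, cons]; exact subst_var _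

theorem subst_subst0 (θ : ℕ → Tm K B) (e e' : Tm K B) :
    subst θ (subst0 e e') = subst (cons (subst θ e') θ) e := by
  rw [subst0, subst_subst]
  congr 1
  funext n
  cases n <;> rfl

theorem rename_subst0 (ρ : ℕ → ℕ) (e e' : Tm K B) :
    rename ρ (subst0 e e') = subst0 (rename (Expr.upRen ρ) e) (rename ρ e') := by
  rw [subst0, subst0, rename_subst, subst_rename]
  congr 1
  funext n
  cases n <;> rfl

theorem occ_rename {ρ : ℕ → ℕ} {e : Tm K B} {n : ℕ} :
    Occ n (rename ρ e) ↔ ∃ m, Occ m e ∧ ρ m = n := by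
  induction e generalizing ρ n with
  | const | bot => simp [rename, Occ]
  | var m => simp [rename, Occ]
  | lam e ih =>
    simp only [rename, Occ, ih]
    constructor
    · rintro ⟨m, hm, h⟩
      cases m with
      | zero => cases h
      | succ m => exact ⟨m, hm, Nat.succ.inj h⟩
    · rintro ⟨m, hm, rfl⟩
      exact ⟨m + 1, hm, rfl⟩
  | fst _ ih | snd _ ih => simp only [rename, Occ, ih]
  | app _ _ ih₁ ih₂ | pair _ _ ih₁ ih₂ =>
    simp only [rename, Occ, ih₁, ih₂, or_and_right, exists_or]
  | tcase _ _ _ _ ih ih₁ ih₂ => simp only [rename, Occ, ih, ih₁, ih₂, or_and_right, exists_or]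

theorem occ_subst {θ : ℕ → Tm K B} {e : Tm K B} {n : ℕ} :
    Occ n (subst θ e) ↔ ∃ m, Occ m e ∧ Occ n (θ m) := by
  induction e generalizing θ n with
  | const | bot => simp [subst, Occ]
  | var m => simp [subst, Occ]
  | lam e ih =>
    simp only [subst, Occ, ih]
    constructor
    · rintro ⟨m, hm, h⟩
      cases m with
      | zero => cases h
      | succ m =>
        obtain ⟨k, hk, h⟩ := occ_rename.1 h
        cases h
        exact ⟨m, hm, hk⟩
    · rintro ⟨m, hm, h⟩
      exact ⟨m + 1, hm, occ_rename.2 ⟨n, h, rfl⟩⟩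
  | fst _ ih | snd _ ih => simp only [subst, Occ, ih]
  | app _ _ ih₁ ih₂ | pair _ _ ih₁ ih₂ =>
    simp only [subst, Occ, ih₁, ih₂, or_and_right, exists_or]
  | tcase _ _ _ _ ih ih₁ ih₂ => simp only [subst, Occ, ih, ih₁, ih₂, or_and_right, exists_or]

theorem closed_subst {θ : ℕ → Tm K B} (h : ∀ n, Closed (θ n)) (e : Tm K B) :
    Closed (subst θ e) := fun n hn => by
  obtain ⟨m, _, hm⟩ := occ_subst.1 hn
  exact h m n hm

theorem Closed.subst0 {e g : Tm K B} (h : Closed (lam e)) (hg : Closed g) :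
    Closed (subst0 e g) := fun n hn => by
  obtain ⟨m, hm, hn⟩ := occ_subst.1 hn
  cases m with
  | zero => exact hg n hn
  | succ m => exact h m hm

theorem closed_app {a b : Tm K B} : Closed (app a b) ↔ Closed a ∧ Closed b := by
  simp only [Closed, Occ, not_or, forall_and]

theorem closed_pair {a b : Tm K B} : Closed (pair a b) ↔ Closed a ∧ Closed b := by
  simp only [Closed, Occ, not_or, forall_and]

theorem closed_tcase {a b c : Tm K B} {τ : TestTy B} :
    Closed (tcase a τ b c) ↔ Closed a ∧ Closed b ∧ Closed c := by
  simp only [Closed, Occ, not_or, forall_and]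

theorem closed_fst {a : Tm K B} : Closed (fst a) ↔ Closed a := Iff.rfl

theorem closed_snd {a : Tm K B} : Closed (snd a) ↔ Closed a := Iff.rfl

theorem closed_bot : Closed (bot : Tm K B) := fun _ h => h

theorem size_pos (e : Tm K B) : 0 < size e := by
  cases e <;> simp [size]

theorem size_rename (ρ : ℕ → ℕ) (e : Tm K B) : size (rename ρ e) = size e := by
  induction e generalizing ρ <;> simp only [rename, size, *]

theorem size_le_subst (θ : ℕ → Tm K B) (e : Tm K B) : size e ≤ size (subst θ e) := by
  induction e generalizing θ with
  | var n => exact size_pos _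
  | const | bot => exact le_rfl
  | lam e ih => exact Nat.succ_le_succ (ih _)
  | fst _ ih | snd _ ih => exact Nat.succ_le_succ (ih _)
  | app _ _ ih₁ ih₂ | pair _ _ ih₁ ih₂ => exact Nat.succ_le_succ (add_le_add (ih₁ θ) (ih₂ θ))
  | tcase _ _ _ _ ih ih₁ ih₂ =>
    exact Nat.succ_le_succ (add_le_add (add_le_add (ih θ) (ih₁ θ)) (ih₂ θ))

theorem size_le_subst_of_occ {θ : ℕ → Tm K B} {e : Tm K B} {n : ℕ} (h : Occ n e) :
    size (θ n) ≤ size (subst θ e) := by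
  induction e generalizing θ n with
  | var m => cases h; exact le_rfl
  | const | bot => cases h
  | lam e ih =>
    have := ih (θ := up θ) (n := n + 1) h
    simp only [up, size_rename] at this
    exact this.trans (Nat.le_succ _)
  | fst _ ih | snd _ ih => exact (ih h).trans (Nat.le_succ _)
  | app _ _ ih₁ ih₂ | pair _ _ ih₁ ih₂ =>
    simp only [subst, size]
    rcases h with h | h
    · have := ih₁ (θ := θ) h; omega
    · have := ih₂ (θ := θ) h; omega
  | tcase _ _ _ _ ih ih₁ ih₂ =>
    simp only [subst, size]
    rcases h with h | h | h
    · have := ih (θ := θ) h; omega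
    · have := ih₁ (θ := θ) h; omega
    · have := ih₂ (θ := θ) h; omega

end Tm

namespace Expr

variable {K : Type u} {B : Type v}

/-- The inclusion of expressions. -/
def toTm : Expr K B → Tm K B
  | const c => .const c
  | var n => .var n
  | lam e => .lam (toTm e)
  | app e₁ e₂ => .app (toTm e₁) (toTm e₂)
  | pair e₁ e₂ => .pair (toTm e₁) (toTm e₂)
  | fst e => .fst (toTm e)
  | snd e => .snd (toTm e)
  | tcase e τ e₁ e₂ => .tcase (toTm e) τ (toTm e₁) (toTm e₂)

theorem toTm_rename (ρ : ℕ → ℕ) (e : Expr K B) : (rename ρ e).toTm = e.toTm.rename ρ := by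
  induction e generalizing ρ <;> simp only [rename, toTm, Tm.rename, *]

theorem toTm_subst (θ : ℕ → Expr K B) (e : Expr K B) :
    (subst θ e).toTm = e.toTm.subst fun n => (θ n).toTm := by
  induction e generalizing θ with
  | lam e ih =>
    simp only [subst, toTm, Tm.subst, ih]
    congr 2
    funext n
    cases n with
    | zero => rfl
    | succ n => simp only [up, Tm.up, toTm_rename]
  | _ => simp only [subst, toTm, Tm.subst, *]

theorem toTm_subst0 (e e' : Expr K B) : (e.subst0 e').toTm = e.toTm.subst0 e'.toTm := by
  rw [subst0, toTm_subst, Tm.subst0]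
  congr 1
  funext n
  cases n <;> rfl

end Expr

/-! ## Reduction of all closed sub-terms with bounded fuel -/

namespace Tm

variable {K : Type u} {B : Type v}

open Classical in
/-- Reduction at the root of an application, where `F` continues the evaluation of a reduct. -/
noncomputable def redApp (F : Tm K B → Tm K B) (a b : Tm K B) : Tm K B :=
  if Closed (app a b) then
    -- Left-to-right evaluation: a diverging argument counts only once the function is a value.
    -- Otherwise a stuck function applied to `bot` would pass for a diverging term, and stuck
    -- expressions could no longer be detected.
    if a = bot ∨ IsVal a ∧ b = bot then bot
    else if IsVal b then
      match a with
      | lam e => F (subst0 e b)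
      | a => app a b
    else app a b
  else app a b

open Classical in
noncomputable def redPair (a b : Tm K B) : Tm K B :=
  if Closed (pair a b) ∧ (a = bot ∨ IsVal a ∧ b = bot) then bot else pair a b

open Classical in
noncomputable def redFst (a : Tm K B) : Tm K B :=
  if Closed a then
    match a with
    | bot => bot
    | pair x y => if IsVal x ∧ IsVal y then x else fst (pair x y)
    | a => fst a
  else fst a

open Classical in
noncomputable def redSnd (a : Tm K B) : Tm K B :=
  if Closed a then
    match a with
    | bot => bot
    | pair x y => if IsVal x ∧ IsVal y then y else snd (pair x y)
    | a => snd a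
  else snd a

end Tm

namespace Signature

variable {K : Type u} {B : Type v} (S : Signature K B)

/-- The dynamic type of a value. -/
def tmType : Tm K B → Ty B
  | .const c => .base (S.basic c)
  | .lam _ => .arrow .empty .any
  | .pair e₁ e₂ => .prod (tmType e₁) (tmType e₂)
  | _ => .empty

-- The second branch is taken without testing the complement of `τ`. This agrees with the semantics:
-- by `sub_tmType_or` a value passes one of the two tests, and by `exists_mem_tmType` it cannot pass
-- both.
open Classical Tm in
noncomputable def redCase (a : Tm K B) (τ : TestTy B) (b c : Tm K B) : Tm K B :=
  if Closed (tcase a τ b c) then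
    if a = bot then bot
    else if IsVal a then if S.Sub (S.tmType a) τ.1 then b else c
    else tcase a τ b c
  else tcase a τ b c

/-- Bottom-up reduction of all closed sub-terms. -/
noncomputable def norm (F : Tm K B → Tm K B) : Tm K B → Tm K B
  | .const c => .const c
  | .var n => .var n
  | .lam e => .lam (norm F e)
  | .app e₁ e₂ => .redApp F (norm F e₁) (norm F e₂)
  | .pair e₁ e₂ => .redPair (norm F e₁) (norm F e₂)
  | .fst e => .redFst (norm F e)
  | .snd e => .redSnd (norm F e)
  | .tcase e τ e₁ e₂ => S.redCase (norm F e) τ (norm F e₁) (norm F e₂)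
  | .bot => .bot

/-- Normal terms: no closed sub-term is reducible. -/
def Nf : Tm K B → Prop
  | .const _ => True
  | .var _ => True
  | .lam e => Nf e
  | .app a b => Nf a ∧ Nf b ∧ ∀ F, Tm.redApp F a b = .app a b
  | .pair a b => Nf a ∧ Nf b ∧ Tm.redPair a b = .pair a b
  | .fst a => Nf a ∧ Tm.redFst a = .fst a
  | .snd a => Nf a ∧ Tm.redSnd a = .snd a
  | .tcase a τ b c => Nf a ∧ Nf b ∧ Nf c ∧ S.redCase a τ b c = .tcase a τ b c
  | .bot => True

variable {S}

-- Normality and closedness of reduced terms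

theorem norm_of_nf {e : Tm K B} (h : S.Nf e) (F : Tm K B → Tm K B) : S.norm F e = e := by
  induction e with
  | const | var | bot => rfl
  | lam e ih => rw [norm, ih h]
  | app a b iha ihb => rw [norm, iha h.1, ihb h.2.1, h.2.2]
  | pair a b iha ihb => rw [norm, iha h.1, ihb h.2.1, h.2.2]
  | fst a ih => rw [norm, ih h.1, h.2]
  | snd a ih => rw [norm, ih h.1, h.2]
  | tcase a τ b c iha ihb ihc => rw [norm, iha h.1, ihb h.2.1, ihc h.2.2.1, h.2.2.2]

/-- The properties of a continuation used below. -/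
structure Evaluator (S : Signature K B) (F : Tm K B → Tm K B) : Prop where
  closed : ∀ x, x.Closed → (F x).Closed
  nf : ∀ x, S.Nf (F x)

open Tm

theorem nf_redApp {F : Tm K B → Tm K B} (hF : ∀ x, S.Nf (F x)) {a b : Tm K B} (ha : S.Nf a)
    (hb : S.Nf b) : S.Nf (redApp F a b) := by
  have key : (∀ F', redApp F' a b = app a b) ∨ S.Nf (redApp F a b) := by
    by_cases hc : Closed (app a b)
    · by_cases hbot : a = bot ∨ IsVal a ∧ b = bot
      · right; simp only [redApp, hc, hbot, if_true]; trivial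
      · by_cases hv : IsVal b
        · cases a with
          | lam e => right; simp only [redApp, hc, hbot, hv, if_true, if_false]; exact hF _
          | bot => exact absurd (Or.inl rfl) hbot
          | _ => left; intro F'; simp only [redApp, hc, hbot, hv, if_true, if_false]
        · left; intro F'; simp only [redApp, hc, hbot, hv, if_true, if_false]
    · left; intro F'; simp only [redApp, hc, if_false]
  rcases key with h | h
  · rw [h]; exact ⟨ha, hb, h⟩
  · exact h

theorem nf_redPair {a b : Tm K B} (ha : S.Nf a) (hb : S.Nf b) : S.Nf (redPair a b) := by
  by_cases h : redPair a b = pair a b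
  · rw [h]; exact ⟨ha, hb, h⟩
  · unfold redPair at *
    split_ifs at * with h'
    · trivial
    · exact absurd rfl h

theorem nf_redFst {a : Tm K B} (ha : S.Nf a) : S.Nf (redFst a) := by
  by_cases h : redFst a = fst a
  · rw [h]; exact ⟨ha, h⟩
  · unfold redFst at *
    split_ifs at * with h'
    · cases a with
      | bot => trivial
      | pair x y =>
        simp only at h ⊢
        split_ifs at * with h''
        · exact ha.1
        · exact absurd rfl h
      | _ => exact absurd rfl h
    · exact absurd rfl h

theorem nf_redSnd {a : Tm K B} (ha : S.Nf a) : S.Nf (redSnd a) := by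
  by_cases h : redSnd a = snd a
  · rw [h]; exact ⟨ha, h⟩
  · unfold redSnd at *
    split_ifs at * with h'
    · cases a with
      | bot => trivial
      | pair x y =>
        simp only at h ⊢
        split_ifs at * with h''
        · exact ha.2.1
        · exact absurd rfl h
      | _ => exact absurd rfl h
    · exact absurd rfl h

theorem nf_redCase {a b c : Tm K B} {τ : TestTy B} (ha : S.Nf a) (hb : S.Nf b) (hc : S.Nf c) :
    S.Nf (S.redCase a τ b c) := by
  by_cases h : S.redCase a τ b c = tcase a τ b c
  · rw [h]; exact ⟨ha, hb, hc, h⟩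
  · unfold redCase at *
    split_ifs at *
    · trivial
    · exact hb
    · exact hc
    · exact absurd rfl h
    · exact absurd rfl h

theorem nf_norm {F : Tm K B → Tm K B} (hF : ∀ x, S.Nf (F x)) (e : Tm K B) :
    S.Nf (S.norm F e) := by
  induction e with
  | const | var | bot => trivial
  | lam e ih => exact ih
  | app a b iha ihb => exact nf_redApp hF iha ihb
  | pair a b iha ihb => exact nf_redPair iha ihb
  | fst a ih => exact nf_redFst ih
  | snd a ih => exact nf_redSnd ih
  | tcase a τ b c iha ihb ihc => exact nf_redCase iha ihb ihc

theorem closed_redApp {F : Tm K B → Tm K B} (hF : ∀ x, x.Closed → (F x).Closed) {a b : Tm K B}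
    (h : Closed (app a b)) : Closed (redApp F a b) := by
  unfold redApp
  split_ifs
  · exact closed_bot
  · cases a with
    | lam e => exact hF _ ((closed_app.1 h).1.subst0 (closed_app.1 h).2)
    | _ => exact h
  · exact h

theorem closed_redPair {a b : Tm K B} (h : Closed (pair a b)) : Closed (redPair a b) := by
  unfold redPair
  split_ifs
  · exact closed_bot
  · exact h

theorem closed_redFst {a : Tm K B} (h : Closed a) : Closed (redFst a) := by
  unfold redFst
  split_ifs
  cases a with
  | bot => exact h
  | pair x y =>
    simp only
    split_ifs
    · exact (closed_pair.1 h).1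
    · exact h
  | _ => exact h

theorem closed_redSnd {a : Tm K B} (h : Closed a) : Closed (redSnd a) := by
  unfold redSnd
  split_ifs
  cases a with
  | bot => exact h
  | pair x y =>
    simp only
    split_ifs
    · exact (closed_pair.1 h).2
    · exact h
  | _ => exact h

theorem closed_redCase {a b c : Tm K B} {τ : TestTy B} (h : Closed (tcase a τ b c)) :
    Closed (S.redCase a τ b c) := by
  unfold redCase
  split_ifs
  · exact closed_bot
  · exact (closed_tcase.1 h).2.1
  · exact (closed_tcase.1 h).2.2
  · exact h

theorem redApp_of_not_closed (F : Tm K B → Tm K B) {a b : Tm K B} (h : ¬ Closed (app a b)) :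
    redApp F a b = app a b := if_neg h

theorem redPair_of_not_closed {a b : Tm K B} (h : ¬ Closed (pair a b)) :
    redPair a b = pair a b := if_neg fun h' => h h'.1

theorem redFst_of_not_closed {a : Tm K B} (h : ¬ Closed a) : redFst a = fst a := if_neg h

theorem redSnd_of_not_closed {a : Tm K B} (h : ¬ Closed a) : redSnd a = snd a := if_neg h

theorem redCase_of_not_closed {a b c : Tm K B} {τ : TestTy B} (h : ¬ Closed (tcase a τ b c)) :
    S.redCase a τ b c = tcase a τ b c := if_neg h

/-- Reduction acts on closed terms only and returns closed terms, so no free index can appear. Free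
indices may disappear, when a closed conditional drops to one branch inside a larger term or the
like, but only as part of reduced closed sub-terms. -/
theorem occ_norm {F : Tm K B → Tm K B} (hF : ∀ x, x.Closed → (F x).Closed) {e : Tm K B} {n : ℕ}
    (h : Occ n (S.norm F e)) : Occ n e := by
  induction e generalizing n with
  | const | var | bot => exact h
  | lam e ih => exact ih h
  | app a b iha ihb =>
    by_cases hc : Closed (app (S.norm F a) (S.norm F b))
    · exact absurd h (closed_redApp hF hc n)
    · rw [norm, redApp_of_not_closed F hc] at h
      exact h.imp iha ihb
  | pair a b iha ihb =>
    by_cases hc : Closed (pair (S.norm F a) (S.norm F b))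
    · exact absurd h (closed_redPair hc n)
    · rw [norm, redPair_of_not_closed hc] at h
      exact h.imp iha ihb
  | fst a ih =>
    by_cases hc : Closed (S.norm F a)
    · exact absurd h (closed_redFst hc n)
    · rw [norm, redFst_of_not_closed hc] at h
      exact ih h
  | snd a ih =>
    by_cases hc : Closed (S.norm F a)
    · exact absurd h (closed_redSnd hc n)
    · rw [norm, redSnd_of_not_closed hc] at h
      exact ih h
  | tcase a τ b c iha ihb ihc =>
    by_cases hc : Closed (tcase (S.norm F a) τ (S.norm F b) (S.norm F c))
    · exact absurd h (closed_redCase hc n)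
    · rw [norm, redCase_of_not_closed hc] at h
      exact h.imp iha (Or.imp ihb ihc)

theorem closed_norm {F : Tm K B → Tm K B} (hF : ∀ x, x.Closed → (F x).Closed) {e : Tm K B}
    (h : Closed e) : Closed (S.norm F e) := fun n hn => h n (occ_norm hF hn)

-- Interaction of reduction with substitution

/-- Reduction commutes with substitutions that do not close any open term. -/
theorem norm_subst_of_preserve {F : Tm K B → Tm K B} (hF : S.Evaluator F)
    {P : (ℕ → Tm K B) → Prop} (hup : ∀ θ, P θ → P (up θ))
    (hnf : ∀ θ, P θ → ∀ n, S.norm F (θ n) = θ n)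
    (hcl : ∀ θ, P θ → ∀ e, Closed (subst θ e) → Closed e) (θ : ℕ → Tm K B) (hθ : P θ)
    (e : Tm K B) : S.norm F (subst θ e) = subst θ (S.norm F e) := by
  induction e generalizing θ with
  | const | bot => rfl
  | var n => exact hnf θ hθ n
  | lam e ih => simp only [subst, norm]; rw [ih _ (hup θ hθ)]
  | app a b iha ihb =>
    simp only [subst, norm]
    rw [iha θ hθ, ihb θ hθ]
    by_cases hc : Closed (app (S.norm F a) (S.norm F b))
    · rw [(closed_app.1 hc).1.subst, (closed_app.1 hc).2.subst, (closed_redApp hF.closed hc).subst]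
    · rw [redApp_of_not_closed F hc, redApp_of_not_closed F fun h => hc (hcl θ hθ _ h)]
      rfl
  | pair a b iha ihb =>
    simp only [subst, norm]
    rw [iha θ hθ, ihb θ hθ]
    by_cases hc : Closed (pair (S.norm F a) (S.norm F b))
    · rw [(closed_pair.1 hc).1.subst, (closed_pair.1 hc).2.subst, (closed_redPair hc).subst]
    · rw [redPair_of_not_closed hc, redPair_of_not_closed fun h => hc (hcl θ hθ _ h)]
      rfl
  | fst a ih =>
    simp only [subst, norm]
    rw [ih θ hθ]
    by_cases hc : Closed (S.norm F a)
    · rw [hc.subst, (closed_redFst hc).subst]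
    · rw [redFst_of_not_closed hc, redFst_of_not_closed fun h => hc (hcl θ hθ _ h)]
      rfl
  | snd a ih =>
    simp only [subst, norm]
    rw [ih θ hθ]
    by_cases hc : Closed (S.norm F a)
    · rw [hc.subst, (closed_redSnd hc).subst]
    · rw [redSnd_of_not_closed hc, redSnd_of_not_closed fun h => hc (hcl θ hθ _ h)]
      rfl
  | tcase a τ b c iha ihb ihc =>
    simp only [subst, norm]
    rw [iha θ hθ, ihb θ hθ, ihc θ hθ]
    by_cases hc : Closed (tcase (S.norm F a) τ (S.norm F b) (S.norm F c))
    · have hc' := closed_tcase.1 hc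
      rw [hc'.1.subst, hc'.2.1.subst, hc'.2.2.subst, (closed_redCase hc).subst]
    · rw [redCase_of_not_closed hc, redCase_of_not_closed fun h => hc (hcl θ hθ _ h)]
      rfl

theorem norm_rename {F : Tm K B → Tm K B} (hF : S.Evaluator F) (ρ : ℕ → ℕ) (e : Tm K B) :
    S.norm F (rename ρ e) = rename ρ (S.norm F e) := by
  rw [rename_eq_subst, rename_eq_subst]
  refine norm_subst_of_preserve hF (P := fun θ => ∃ ρ : ℕ → ℕ, θ = fun n => var (ρ n))
    ?_ ?_ ?_ _ ⟨ρ, rfl⟩ e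
  · rintro _ ⟨ρ, rfl⟩
    exact ⟨Expr.upRen ρ, funext fun n => by cases n <;> rfl⟩
  · rintro _ ⟨ρ, rfl⟩ n
    rfl
  · rintro _ ⟨ρ, rfl⟩ e h n hn
    exact h (ρ n) (occ_subst.2 ⟨n, hn, rfl⟩)

/-- Substituting open normal terms creates no redex: an open sub-term stays open, and the inserted
terms are already normal. This is what keeps a union elimination on an open expression intact. -/
theorem norm_subst_of_open {F : Tm K B → Tm K B} (hF : S.Evaluator F) {θ : ℕ → Tm K B}
    (ho : ∀ n, ¬ Closed (θ n)) (hn : ∀ n, S.Nf (θ n)) (e : Tm K B) :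
    S.norm F (subst θ e) = subst θ (S.norm F e) := by
  refine norm_subst_of_preserve hF
    (P := fun θ => ∀ n, ¬ Closed (θ n) ∧ S.norm F (θ n) = θ n) ?_ ?_ ?_ _
    (fun n => ⟨ho n, norm_of_nf (hn n) F⟩) e
  · intro θ h n
    cases n with
    | zero => exact ⟨fun h => h 0 rfl, rfl⟩
    | succ n =>
      refine ⟨fun hc => (h n).1 fun m hm => hc (m + 1) (occ_rename.2 ⟨m, hm, rfl⟩), ?_⟩
      rw [up, norm_rename hF, (h n).2]
  · exact fun θ h n => (h n).2
  · intro θ h e hc n hn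
    refine (h n).1 fun m hm => hc m (occ_subst.2 ⟨n, hn, hm⟩)

theorem norm_up {F : Tm K B → Tm K B} (hF : S.Evaluator F) {θ θ' : ℕ → Tm K B}
    (h : ∀ n, S.norm F (θ n) = S.norm F (θ' n)) (n : ℕ) :
    S.norm F (up θ n) = S.norm F (up θ' n) := by
  cases n with
  | zero => rfl
  | succ n => simp only [up, norm_rename hF, h n]

/-- Reduction is bottom-up, so the inserted terms matter only through their results. All copies of a
substituted expression can therefore be evaluated at once. -/
theorem norm_subst_congr {F : Tm K B → Tm K B} (hF : S.Evaluator F) {θ θ' : ℕ → Tm K B}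
    (h : ∀ n, S.norm F (θ n) = S.norm F (θ' n)) (e : Tm K B) :
    S.norm F (subst θ e) = S.norm F (subst θ' e) := by
  induction e generalizing θ θ' with
  | const | bot => rfl
  | var n => exact h n
  | lam e ih => simp only [subst, norm]; rw [ih (norm_up hF h)]
  | app a b iha ihb => simp only [subst, norm]; rw [iha h, ihb h]
  | pair a b iha ihb => simp only [subst, norm]; rw [iha h, ihb h]
  | fst a ih => simp only [subst, norm]; rw [ih h]
  | snd a ih => simp only [subst, norm]; rw [ih h]
  | tcase a τ b c iha ihb ihc => simp only [subst, norm]; rw [iha h, ihb h, ihc h]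

theorem norm_norm {F : Tm K B → Tm K B} (hF : S.Evaluator F) (e : Tm K B) :
    S.norm F (S.norm F e) = S.norm F e := norm_of_nf (nf_norm hF.nf e) F

/-- A term may be reduced before a substitution. -/
theorem norm_subst_norm {F : Tm K B → Tm K B} (hF : S.Evaluator F) (θ : ℕ → Tm K B) (e : Tm K B) :
    S.norm F (subst θ (S.norm F e)) = S.norm F (subst θ e) := by
  induction e generalizing θ with
  | const | bot | var => rfl
  | lam e ih => simp only [subst, norm]; rw [ih]
  | app a b iha ihb =>
    have h := congrArg₂ (redApp F) (iha θ) (ihb θ)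
    simp only [subst, norm]
    -- A closed reduct is not touched by `θ`, and reducing it again changes nothing. In the open
    -- case the root has not been reduced yet. The remaining constructors are treated in the same
    -- way.
    by_cases hc : Closed (app (S.norm F a) (S.norm F b))
    · rw [← h, (closed_redApp hF.closed hc).subst, (closed_app.1 hc).1.subst,
        (closed_app.1 hc).2.subst, norm_norm hF, norm_norm hF]
      exact norm_norm hF (app a b)
    · rw [redApp_of_not_closed F hc]
      exact h
  | pair a b iha ihb =>
    have h := congrArg₂ redPair (iha θ) (ihb θ)
    simp only [subst, norm]
    by_cases hc : Closed (pair (S.norm F a) (S.norm F b))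
    · rw [← h, (closed_redPair hc).subst, (closed_pair.1 hc).1.subst,
        (closed_pair.1 hc).2.subst, norm_norm hF, norm_norm hF]
      exact norm_norm hF (pair a b)
    · rw [redPair_of_not_closed hc]
      exact h
  | fst a ih =>
    have h := congrArg redFst (ih θ)
    simp only [subst, norm]
    by_cases hc : Closed (S.norm F a)
    · rw [← h, (closed_redFst hc).subst, hc.subst, norm_norm hF]
      exact norm_norm hF (fst a)
    · rw [redFst_of_not_closed hc]
      exact h
  | snd a ih =>
    have h := congrArg redSnd (ih θ)
    simp only [subst, norm]
    by_cases hc : Closed (S.norm F a)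
    · rw [← h, (closed_redSnd hc).subst, hc.subst, norm_norm hF]
      exact norm_norm hF (snd a)
    · rw [redSnd_of_not_closed hc]
      exact h
  | tcase a τ b c iha ihb ihc =>
    have h : S.redCase (S.norm F (subst θ (S.norm F a))) τ (S.norm F (subst θ (S.norm F b)))
        (S.norm F (subst θ (S.norm F c))) = S.redCase (S.norm F (subst θ a)) τ
        (S.norm F (subst θ b)) (S.norm F (subst θ c)) := by rw [iha, ihb, ihc]
    simp only [subst, norm]
    by_cases hc : Closed (tcase (S.norm F a) τ (S.norm F b) (S.norm F c))
    · have hc' := closed_tcase.1 hc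
      rw [← h, (closed_redCase hc).subst, hc'.1.subst, hc'.2.1.subst, hc'.2.2.subst,
        norm_norm hF, norm_norm hF, norm_norm hF]
      exact norm_norm hF (tcase a τ b c)
    · rw [redCase_of_not_closed hc]
      exact h

-- Approximations with bounded fuel

variable (S)

mutual

/-- Evaluation of a reduct with fuel `n`. -/
noncomputable def fuel : ℕ → Tm K B → Tm K B
  | 0 => fun _ => .bot
  | n + 1 => approx n

/-- The approximation of a term by reduction of its closed sub-terms with fuel `n`. -/
noncomputable def approx (n : ℕ) : Tm K B → Tm K B := S.norm (fuel n)

end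

theorem evaluator_fuel (n : ℕ) : S.Evaluator (S.fuel n) := by
  induction n with
  | zero =>
    rw [fuel]
    exact ⟨fun _ _ => closed_bot, fun _ => trivial⟩
  | succ n ih =>
    rw [fuel, approx]
    exact ⟨fun _ => closed_norm ih.closed, nf_norm ih.nf⟩

variable {S}

theorem nf_approx (n : ℕ) (e : Tm K B) : S.Nf (S.approx n e) := by
  rw [approx]; exact nf_norm (S.evaluator_fuel n).nf e

theorem approx_of_nf {e : Tm K B} (h : S.Nf e) (n : ℕ) : S.approx n e = e := by
  rw [approx]; exact norm_of_nf h _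

theorem closed_approx {e : Tm K B} (h : Closed e) (n : ℕ) : Closed (S.approx n e) := by
  rw [approx]; exact closed_norm (S.evaluator_fuel n).closed h

theorem approx_subst_congr {θ θ' : ℕ → Tm K B} {n : ℕ}
    (h : ∀ k, S.approx n (θ k) = S.approx n (θ' k)) (e : Tm K B) :
    S.approx n (subst θ e) = S.approx n (subst θ' e) := by
  rw [approx] at *; exact norm_subst_congr (S.evaluator_fuel n) h e

theorem approx_subst_approx (n : ℕ) (θ : ℕ → Tm K B) (e : Tm K B) :
    S.approx n (subst θ (S.approx n e)) = S.approx n (subst θ e) := by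
  rw [approx]; exact norm_subst_norm (S.evaluator_fuel n) θ e

end Signature

namespace Signature

variable {K : Type u} {B : Type v} (S : Signature K B)

open Tm

/-! ## Types of normal terms -/

/-- The type system on extended expressions, relative to a set `Ax` of typing axioms. -/
inductive DTyping (Ax : Tm K B → Ty B → Prop) : List (Ty B) → Tm K B → Ty B → Prop
  | axm {Γ : List (Ty B)} {e : Tm K B} {t : Ty B} (h : Ax e t) : DTyping Ax Γ e t
  | bot {Γ : List (Ty B)} (t : Ty B) : DTyping Ax Γ .bot t
  | const {Γ : List (Ty B)} (c : K) : DTyping Ax Γ (.const c) (.base (S.basic c))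
  | ax {Γ : List (Ty B)} {n : ℕ} {t : Ty B} (h : Γ[n]? = some t) : DTyping Ax Γ (.var n) t
  | arrowI {Γ : List (Ty B)} {e : Tm K B} {w t : Ty B} (hw : w.IsMono) :
      DTyping Ax (w :: Γ) e t → DTyping Ax Γ (.lam e) (.arrow w t)
  | arrowE {Γ : List (Ty B)} {e₁ e₂ : Tm K B} {t₁ t₂ : Ty B} :
      DTyping Ax Γ e₁ (.arrow t₁ t₂) → DTyping Ax Γ e₂ t₁ → DTyping Ax Γ (.app e₁ e₂) t₂
  | prodI {Γ : List (Ty B)} {e₁ e₂ : Tm K B} {t₁ t₂ : Ty B} :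
      DTyping Ax Γ e₁ t₁ → DTyping Ax Γ e₂ t₂ → DTyping Ax Γ (.pair e₁ e₂) (.prod t₁ t₂)
  | prodE₁ {Γ : List (Ty B)} {e : Tm K B} {t₁ t₂ : Ty B} :
      DTyping Ax Γ e (.prod t₁ t₂) → DTyping Ax Γ (.fst e) t₁
  | prodE₂ {Γ : List (Ty B)} {e : Tm K B} {t₁ t₂ : Ty B} :
      DTyping Ax Γ e (.prod t₁ t₂) → DTyping Ax Γ (.snd e) t₂
  | caseEmpty {Γ : List (Ty B)} {e : Tm K B} (τ : TestTy B) (e₁ e₂ : Tm K B) :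
      DTyping Ax Γ e .empty → DTyping Ax Γ (.tcase e τ e₁ e₂) .empty
  | caseThen {Γ : List (Ty B)} {e : Tm K B} {τ : TestTy B} {e₁ : Tm K B} (e₂ : Tm K B)
      {t₁ : Ty B} : DTyping Ax Γ e τ.1 → DTyping Ax Γ e₁ t₁ →
      DTyping Ax Γ (.tcase e τ e₁ e₂) t₁
  | caseElse {Γ : List (Ty B)} {e : Tm K B} {τ : TestTy B} (e₁ : Tm K B) {e₂ : Tm K B}
      {t₂ : Ty B} : DTyping Ax Γ e τ.1.neg → DTyping Ax Γ e₂ t₂ →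
      DTyping Ax Γ (.tcase e τ e₁ e₂) t₂
  | unionE {Γ : List (Ty B)} {e e' : Tm K B} {s w t : Ty B} (hw : w.IsMono) :
      DTyping Ax Γ e' s → DTyping Ax (s.inter w :: Γ) e t →
      DTyping Ax (s.inter w.neg :: Γ) e t → DTyping Ax Γ (e.subst0 e') t
  | interI {Γ : List (Ty B)} {e : Tm K B} {t₁ t₂ : Ty B} :
      DTyping Ax Γ e t₁ → DTyping Ax Γ e t₂ → DTyping Ax Γ e (t₁.inter t₂)
  | inst {Γ : List (Ty B)} {e : Tm K B} {t : Ty B} (σ : ℕ → Ty B) :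
      DTyping Ax Γ e t → DTyping Ax Γ e (t.inst σ)
  | sub {Γ : List (Ty B)} {e : Tm K B} {t t' : Ty B} (h : S.Sub t t') :
      DTyping Ax Γ e t → DTyping Ax Γ e t'

variable {S}

theorem Typing.toDTyping {Γ : List (Ty B)} {e : Expr K B} {t : Ty B} (h : S.Typing Γ e t)
    (Ax : Tm K B → Ty B → Prop) : S.DTyping Ax Γ e.toTm t := by
  induction h with
  | const c => exact .const c
  | ax h => exact .ax h
  | arrowI hw _ ih => exact .arrowI hw ih
  | arrowE _ _ ih₁ ih₂ => exact .arrowE ih₁ ih₂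
  | prodI _ _ ih₁ ih₂ => exact .prodI ih₁ ih₂
  | prodE₁ _ ih => exact .prodE₁ ih
  | prodE₂ _ ih => exact .prodE₂ ih
  | caseEmpty τ e₁ e₂ _ ih => exact .caseEmpty τ _ _ ih
  | caseThen e₂ _ _ ih₁ ih₂ => exact .caseThen _ ih₁ ih₂
  | caseElse e₁ _ _ ih₁ ih₂ => exact .caseElse _ ih₁ ih₂
  | unionE hw _ _ _ ih ih₁ ih₂ => rw [Expr.toTm_subst0]; exact .unionE hw ih ih₁ ih₂
  | interI _ _ ih₁ ih₂ => exact .interI ih₁ ih₂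
  | inst σ _ ih => exact .inst σ ih
  | sub h _ ih => exact .sub h ih

/-- Renaming of a typed term. The environment matters only for the indices that occur in the term,
and the axioms only for terms that are not larger. -/
theorem DTyping.rename {Ax : Tm K B → Ty B → Prop} (hAx : ∀ w t, Ax w t → Closed w)
    {Γ : List (Ty B)} {e : Tm K B} {t : Ty B} (h : S.DTyping Ax Γ e t) {m : ℕ}
    (hm : size e ≤ m) {Δ : List (Ty B)} {ρ : ℕ → ℕ}
    (hρ : ∀ n, Occ n e → ∀ s, Γ[n]? = some s → Δ[ρ n]? = some s) :
    S.DTyping (fun w t => size w ≤ m ∧ Ax w t) Δ (e.rename ρ) t := by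
  have hup : ∀ {Γ Δ : List (Ty B)} {ρ : ℕ → ℕ} {e : Tm K B} (w : Ty B),
      (∀ n, Occ (n + 1) e → ∀ s, Γ[n]? = some s → Δ[ρ n]? = some s) →
      ∀ n, Occ n e → ∀ s, (w :: Γ)[n]? = some s → (w :: Δ)[Expr.upRen ρ n]? = some s := by
    intro Γ Δ ρ e w h n hn s hs
    cases n with
    | zero => exact hs
    | succ n => exact h n hn s hs
  induction h generalizing Δ ρ with
  | @axm _ e t h => rw [(hAx _ _ h).rename]; exact .axm ⟨hm, h⟩
  | bot t => exact .bot t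
  | const c => exact .const c
  | ax h => exact .ax (hρ _ rfl _ h)
  | arrowI hw _ ih =>
    simp only [size] at hm
    exact .arrowI hw (ih (by omega) (hup _ hρ))
  | arrowE _ _ ih₁ ih₂ =>
    simp only [size] at hm
    exact .arrowE (ih₁ (by omega) fun n hn => hρ n (Or.inl hn))
      (ih₂ (by omega) fun n hn => hρ n (Or.inr hn))
  | prodI _ _ ih₁ ih₂ =>
    simp only [size] at hm
    exact .prodI (ih₁ (by omega) fun n hn => hρ n (Or.inl hn))
      (ih₂ (by omega) fun n hn => hρ n (Or.inr hn))
  | prodE₁ _ ih =>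
    simp only [size] at hm
    exact .prodE₁ (ih (by omega) hρ)
  | prodE₂ _ ih =>
    simp only [size] at hm
    exact .prodE₂ (ih (by omega) hρ)
  | caseEmpty τ e₁ e₂ _ ih =>
    simp only [size] at hm
    exact .caseEmpty τ _ _ (ih (by omega) fun n hn => hρ n (Or.inl hn))
  | caseThen e₂ _ _ ih₁ ih₂ =>
    simp only [size] at hm
    exact .caseThen _ (ih₁ (by omega) fun n hn => hρ n (Or.inl hn))
      (ih₂ (by omega) fun n hn => hρ n (Or.inr (Or.inl hn)))
  | caseElse e₁ _ _ ih₁ ih₂ =>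
    simp only [size] at hm
    exact .caseElse _ (ih₁ (by omega) fun n hn => hρ n (Or.inl hn))
      (ih₂ (by omega) fun n hn => hρ n (Or.inr (Or.inr hn)))
  | @unionE Γ e e' s w t hw _ _ _ ih ih₁ ih₂ =>
    have hm' := (size_le_subst _ e).trans hm
    have hocc : ∀ n, Occ (n + 1) e → Occ n (e.subst0 e') := fun n hn =>
      occ_subst.2 ⟨n + 1, hn, rfl⟩
    -- If the index occurs, then `e'` is a part of `e{e'/x}` and the size bound carries over to it.
    -- Otherwise `e'` has vanished and may be larger than `m`; the rule is dropped, and one premise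
    -- on `e` suffices because its type for the index is irrelevant.
    by_cases h0 : Occ 0 e
    · rw [rename_subst0]
      have hocc' : ∀ n, Occ n e' → Occ n (e.subst0 e') := fun n hn =>
        occ_subst.2 ⟨0, h0, hn⟩
      exact .unionE hw
        (ih ((size_le_subst_of_occ (θ := cons e' var) h0).trans hm) fun n hn => hρ n (hocc' n hn))
        (ih₁ hm' (hup _ fun n hn => hρ n (hocc n hn)))
        (ih₂ hm' (hup _ fun n hn => hρ n (hocc n hn)))
    -- The value of `n - 1` at `0` plays no role, since the index `0` does not occur.
    · have h1 : (e.subst0 e').rename ρ = e.rename fun n => ρ (n - 1) := by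
        rw [subst0, rename_subst, rename_eq_subst]
        refine subst_congr fun n hn => ?_
        cases n with
        | zero => exact absurd hn h0
        | succ n => rfl
      rw [h1]
      refine ih₁ hm' fun n hn r hr => ?_
      cases n with
      | zero => exact absurd hn h0
      | succ n => exact hρ n (hocc n hn) r hr
  | interI _ _ ih₁ ih₂ => exact .interI (ih₁ hm hρ) (ih₂ hm hρ)
  | inst σ _ ih => exact .inst σ (ih hm hρ)
  | sub h _ ih => exact .sub h (ih hm hρ)

theorem DTyping.mono {Ax Ax' : Tm K B → Ty B → Prop} (hAx : ∀ w t, Ax w t → Ax' w t)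
    {Γ : List (Ty B)} {e : Tm K B} {t : Ty B} (h : S.DTyping Ax Γ e t) : S.DTyping Ax' Γ e t := by
  induction h with
  | axm h => exact .axm (hAx _ _ h)
  | bot t => exact .bot t
  | const c => exact .const c
  | ax h => exact .ax h
  | arrowI hw _ ih => exact .arrowI hw ih
  | arrowE _ _ ih₁ ih₂ => exact .arrowE ih₁ ih₂
  | prodI _ _ ih₁ ih₂ => exact .prodI ih₁ ih₂
  | prodE₁ _ ih => exact .prodE₁ ih
  | prodE₂ _ ih => exact .prodE₂ ih
  | caseEmpty τ e₁ e₂ _ ih => exact .caseEmpty τ _ _ ih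
  | caseThen e₂ _ _ ih₁ ih₂ => exact .caseThen _ ih₁ ih₂
  | caseElse e₁ _ _ ih₁ ih₂ => exact .caseElse _ ih₁ ih₂
  | unionE hw _ _ _ ih ih₁ ih₂ => exact .unionE hw ih ih₁ ih₂
  | interI _ _ ih₁ ih₂ => exact .interI ih₁ ih₂
  | inst σ _ ih => exact .inst σ ih
  | sub h _ ih => exact .sub h ih

-- Semantic types of values

variable (S)

/-- `S.Sat Q v t`: the value `v` belongs to `t`, where `Q e` is the set of the arrow types of
`lam e`. No value belongs to a variable. -/
def Sat (Q : Tm K B → Ty B → Ty B → Prop) (v : Tm K B) (t : Ty B) : Prop :=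
  match _h : t.view with
  | .base b =>
    match v with
    | .const c => c ∈ S.consts b
    | _ => False
  | .var _ => False
  | .prod t₁ t₂ =>
    match v with
    | .pair v₁ v₂ => Sat Q v₁ t₁ ∧ Sat Q v₂ t₂
    | _ => False
  | .arrow t₁ t₂ =>
    match v with
    | .lam e => Q e t₁ t₂
    | _ => False
  | .union t₁ t₂ => Sat Q v t₁ ∨ Sat Q v t₂
  | .neg t₁ => ¬ Sat Q v t₁
  | .empty => False
termination_by (size v, t)
decreasing_by
  · apply Prod.Lex.left; simp only [size]; omega
  · apply Prod.Lex.left; simp only [size]; omega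
  · exact Prod.Lex.right _ (Ty.under_left _h)
  · exact Prod.Lex.right _ (Ty.under_right _h)
  · exact Prod.Lex.right _ (Ty.under_neg _h)

variable {S} {Q : Tm K B → Ty B → Ty B → Prop} {v : Tm K B} {t s : Ty B}

theorem sat_base {b : B} : S.Sat Q v (.base b) ↔ ∃ c, v = .const c ∧ c ∈ S.consts b := by
  rw [Sat]
  change (match v with | .const c => c ∈ S.consts b | _ => False) ↔ _
  cases v <;> simp

theorem sat_var {a : TVar} : S.Sat Q v (.var a) ↔ False := by
  rw [Sat]
  exact Iff.rfl

theorem sat_prod :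
    S.Sat Q v (.prod t s) ↔ ∃ v₁ v₂, v = .pair v₁ v₂ ∧ S.Sat Q v₁ t ∧ S.Sat Q v₂ s := by
  rw [Sat]
  change (match v with | .pair v₁ v₂ => S.Sat Q v₁ t ∧ S.Sat Q v₂ s | _ => False) ↔ _
  cases v <;> simp

theorem sat_arrow : S.Sat Q v (.arrow t s) ↔ ∃ e, v = .lam e ∧ Q e t s := by
  rw [Sat]
  change (match v with | .lam e => Q e t s | _ => False) ↔ _
  cases v <;> simp

theorem sat_union : S.Sat Q v (.union t s) ↔ S.Sat Q v t ∨ S.Sat Q v s := by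
  rw [Sat]
  exact Iff.rfl

theorem sat_neg : S.Sat Q v (.neg t) ↔ ¬ S.Sat Q v t := by
  rw [Sat]
  exact Iff.rfl

theorem sat_empty : S.Sat Q v .empty ↔ False := by
  rw [Sat]
  exact Iff.rfl

theorem sat_inter : S.Sat Q v (.inter t s) ↔ S.Sat Q v t ∧ S.Sat Q v s := by
  rw [Ty.inter, sat_neg, sat_union, sat_neg, sat_neg]
  tauto

/-- `Q` is consulted only at bodies of abstractions that are components of `v`, and these are
strictly smaller than `v`. -/
theorem sat_congr {Q Q' : Tm K B → Ty B → Ty B → Prop} (v : Tm K B)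
    (h : ∀ e a b, size e < size v → (Q e a b ↔ Q' e a b)) (t : Ty B) :
    S.Sat Q v t ↔ S.Sat Q' v t := by
  induction hn : size v using Nat.strong_induction_on generalizing v t with
  | _ n ih =>
    subst hn
    induction t using Ty.bool_induction with
    | base b => rw [sat_base, sat_base]
    | var a => rw [sat_var, sat_var]
    | prod t s =>
      rw [sat_prod, sat_prod]
      refine exists_congr fun v₁ => exists_congr fun v₂ => and_congr_right ?_
      rintro rfl
      simp only [size] at h ih
      exact and_congr
        (ih _ (by omega) v₁ (fun e a b he => h e a b (by omega)) t rfl)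
        (ih _ (by omega) v₂ (fun e a b he => h e a b (by omega)) s rfl)
    | arrow t s =>
      rw [sat_arrow, sat_arrow]
      refine exists_congr fun e => and_congr_right ?_
      rintro rfl
      exact h e t s (by simp [size])
    | union t s iht ihs => rw [sat_union, sat_union, iht, ihs]
    | neg t iht => rw [sat_neg, sat_neg, iht]
    | empty => rw [sat_empty, sat_empty]

variable (S)

/-- Closed normal values, as the subjects of axioms. -/
def ClosedVal (w : Tm K B) : Prop := Closed w ∧ S.Nf w ∧ IsVal w

/-- The arrow types that `lam e` has by subsumption from those given by the rule of abstractions. -/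
def ArrowCore (Ax : Tm K B → Ty B → Prop) (e : Tm K B) (a b : Ty B) : Prop :=
  ∃ P : List (Ty B × Ty B),
    (∀ p ∈ P, p.1.IsMono ∧ p.2.IsMono ∧ S.DTyping Ax [p.1] e p.2) ∧
    ∀ R L, (∀ p ∈ P, S.Mem (.fn R L) (.arrow p.1 p.2)) → S.Mem (.fn R L) (.arrow a b)

/-- The arrow types of `lam e`. The axioms are the types of the values that are not larger
than `e`. -/
def Arrows (e : Tm K B) (a b : Ty B) : Prop :=
  S.ArrowCore (fun w t => size w ≤ size e ∧ S.ClosedVal w ∧ ∀ σ : ℕ → Ty B, (∀ n, (σ n).IsMono) →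
    -- The bound on `e'` only serves the termination of the recursion. It holds automatically, since
    -- `e'` is the body of an abstraction inside a value of size at most `size e`; `arrows_iff`
    -- removes it.
    S.Sat (fun e' a' b' => ∃ _ : size e' < size e, Arrows e' a' b') w (t.inst σ)) e a b
termination_by size e

/-- The types of closed normal values. -/
def ValTy (w : Tm K B) (t : Ty B) : Prop :=
  S.ClosedVal w ∧ ∀ σ : ℕ → Ty B, (∀ n, (σ n).IsMono) → S.Sat S.Arrows w (t.inst σ)

variable {S}

theorem arrows_iff {e : Tm K B} {a b : Ty B} :
    S.Arrows e a b ↔ S.ArrowCore (fun w t => size w ≤ size e ∧ S.ValTy w t) e a b := by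
  rw [Arrows]
  suffices h : (fun w t => size w ≤ size e ∧ S.ClosedVal w ∧
      ∀ σ : ℕ → Ty B, (∀ n, (σ n).IsMono) →
      S.Sat (fun e' a' b' => ∃ _ : size e' < size e, S.Arrows e' a' b') w (t.inst σ)) =
      fun w t => size w ≤ size e ∧ S.ValTy w t by rw [h]
  funext w t
  refine propext (and_congr_right fun hw => and_congr_right fun _ =>
    forall_congr' fun σ => forall_congr' fun _ => sat_congr w (fun e' a' b' he => ?_) _)
  exact ⟨fun h => h.2, fun h => ⟨by omega, h⟩⟩

/-- Arrow types are closed under consequences of finitely many of them. -/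
theorem arrows_of_forall {e : Tm K B} {P : Set (Ty B × Ty B)} (hP : P.Finite)
    (h : ∀ p ∈ P, S.Arrows e p.1 p.2) {a b : Ty B}
    (hab : ∀ R L, (∀ p ∈ P, S.Mem (.fn R L) (.arrow p.1 p.2)) → S.Mem (.fn R L) (.arrow a b)) :
    S.Arrows e a b := by
  have h' : ∀ p : Ty B × Ty B, ∃ l : List (Ty B × Ty B), p ∈ P →
      (∀ q ∈ l, q.1.IsMono ∧ q.2.IsMono ∧
        S.DTyping (fun w t => size w ≤ size e ∧ S.ValTy w t) [q.1] e q.2) ∧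
      ∀ R L, (∀ q ∈ l, S.Mem (.fn R L) (.arrow q.1 q.2)) → S.Mem (.fn R L) (.arrow p.1 p.2) := by
    intro p
    by_cases hp : p ∈ P
    · obtain ⟨l, hl⟩ := arrows_iff.1 (h p hp)
      exact ⟨l, fun _ => hl⟩
    · exact ⟨[], fun h => absurd h hp⟩
  choose l hl using h'
  refine arrows_iff.2 ⟨hP.toFinset.toList.flatMap l, ?_, ?_⟩
  · intro q hq
    obtain ⟨p, hp, hq⟩ := List.mem_flatMap.1 hq
    exact (hl p (by simpa using hp)).1 q hq
  · intro R L hR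
    refine hab R L fun p hp => (hl p hp).2 R L fun q hq => hR q ?_
    exact List.mem_flatMap.2 ⟨p, by simpa using hp, hq⟩

/-- Every finite relation belongs to `𝟘 → 𝟙`, so this type follows from no derivation at all, and
even an untyped abstraction has it. -/
theorem arrows_top (e : Tm K B) : S.Arrows e .empty .any :=
  arrows_of_forall Set.finite_empty (by simp) fun R L _ => S.mem_top_arrow.2 ⟨R, L, rfl⟩

-- Values as elements of the interpretation domain

/-- A value is indistinguishable from some element of the interpretation domain by finitely many
types. -/
theorem exists_mem_iff_sat {A : Set (Ty B)} (hA : A.Finite)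
    (hsub : ∀ t ∈ A, ∀ s, Ty.IsSub s t → s ∈ A) {v : Tm K B} (hv : IsVal v) :
    ∃ d : Dom K, ∀ t ∈ A, (S.Mem d t ↔ S.Sat S.Arrows v t) := by
  induction v with
  | const c =>
    refine ⟨.const c ∅, fun t => ?_⟩
    induction t using Ty.bool_induction with
    | base b => intro _; rw [mem_base, sat_base]; simp
    | var a => intro _; rw [mem_var, sat_var]; simp [Dom.tags]
    | prod t s => intro _; rw [mem_prod, sat_prod]; simp
    | arrow t s => intro _; rw [mem_arrow, sat_arrow]; simp
    | union t s iht ihs =>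
      intro h
      rw [mem_union, sat_union, iht (hsub _ h _ (Ty.isSub_union_left t s)),
        ihs (hsub _ h _ (Ty.isSub_union_right t s))]
    | neg t iht => intro h; rw [mem_neg, sat_neg, iht (hsub _ h _ (Ty.isSub_neg t))]
    | empty => intro _; rw [mem_empty, sat_empty]
  | pair v₁ v₂ ih₁ ih₂ =>
    obtain ⟨d₁, h₁⟩ := ih₁ hv.1
    obtain ⟨d₂, h₂⟩ := ih₂ hv.2
    refine ⟨.pair d₁ d₂ ∅, fun t => ?_⟩
    induction t using Ty.bool_induction with
    | base b => intro _; rw [mem_base, sat_base]; simp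
    | var a => intro _; rw [mem_var, sat_var]; simp [Dom.tags]
    | prod t s =>
      intro h
      rw [mem_prod, sat_prod]
      simp [h₁ _ (hsub _ h _ (Ty.isSub_prod_left t s)),
        h₂ _ (hsub _ h _ (Ty.isSub_prod_right t s))]
    | arrow t s => intro _; rw [mem_arrow, sat_arrow]; simp
    | union t s iht ihs =>
      intro h
      rw [mem_union, sat_union, iht (hsub _ h _ (Ty.isSub_union_left t s)),
        ihs (hsub _ h _ (Ty.isSub_union_right t s))]
    | neg t iht => intro h; rw [mem_neg, sat_neg, iht (hsub _ h _ (Ty.isSub_neg t))]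
    | empty => intro _; rw [mem_empty, sat_empty]
  | lam e =>
    let At : Set (Ty B × Ty B) := {p | Ty.arrow p.1 p.2 ∈ A}
    have hAt : At.Finite := ((hA.prod hA).subset fun p hp =>
      ⟨hsub _ hp _ (Ty.isSub_arrow_left _ _), hsub _ hp _ (Ty.isSub_arrow_right _ _)⟩)
    have hneg : ∀ p : Ty B × Ty B, ∃ R : List (Dom K × Option (Dom K)),
        (∀ q ∈ At, S.Arrows e q.1 q.2 → S.Mem (.fn R ∅) (.arrow q.1 q.2)) ∧
        (¬ S.Arrows e p.1 p.2 → ¬ S.Mem (.fn R ∅) (.arrow p.1 p.2)) := by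
      intro p
      by_cases hp : S.Arrows e p.1 p.2
      · exact ⟨[], fun q _ _ => by rw [mem_arrow_fn]; simp, fun h => absurd hp h⟩
      -- If every relation satisfying the arrows of `A` that hold also satisfied `p`, then `p` would
      -- be a consequence of finitely many arrow types of `lam e`, and would itself hold.
      · by_contra hcon
        push Not at hcon
        refine hp (arrows_of_forall (hAt.subset (Set.sep_subset At fun q => S.Arrows e q.1 q.2))
          (fun q hq => hq.2) fun R L hR => ?_)
        have := (hcon R fun q hq hq' => mem_arrow_fn S |>.2 ((mem_arrow_fn S).1 (hR q ⟨hq, hq'⟩))).2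
        exact (mem_arrow_fn S).2 ((mem_arrow_fn S).1 this)
    choose r hr using hneg
    -- Membership in an arrow is a condition on each pair separately. So the concatenation satisfies
    -- all the arrows that hold and violates each one that fails through its own relation. The label
    -- is empty because no value belongs to a variable.
    refine ⟨.fn (hAt.toFinset.toList.flatMap r) ∅, fun t => ?_⟩
    induction t using Ty.bool_induction with
    | base b => intro _; rw [mem_base, sat_base]; simp
    | var a => intro _; rw [mem_var, sat_var]; simp [Dom.tags]
    | prod t s => intro _; rw [mem_prod, sat_prod]; simp
    | arrow t s =>
      intro h
      have h' : (t, s) ∈ At := h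
      rw [mem_arrow_fn, sat_arrow]
      constructor
      · intro hm
        refine ⟨e, rfl, ?_⟩
        by_contra hn
        refine (hr (t, s)).2 hn ((mem_arrow_fn S).2 fun p hp => hm p ?_)
        exact List.mem_flatMap.2 ⟨(t, s), by simpa using h', hp⟩
      · rintro ⟨e', he, ha⟩ p hp
        cases he
        obtain ⟨q, hq, hp⟩ := List.mem_flatMap.1 hp
        exact (mem_arrow_fn S).1 ((hr q).1 (t, s) h' ha) p hp
    | union t s iht ihs =>
      intro h
      rw [mem_union, sat_union, iht (hsub _ h _ (Ty.isSub_union_left t s)),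
        ihs (hsub _ h _ (Ty.isSub_union_right t s))]
    | neg t iht => intro h; rw [mem_neg, sat_neg, iht (hsub _ h _ (Ty.isSub_neg t))]
    | empty => intro _; rw [mem_empty, sat_empty]
  | _ => exact hv.elim

theorem exists_mem_iff_sat_of_finite {A : Set (Ty B)} (hA : A.Finite) {v : Tm K B} (hv : IsVal v) :
    ∃ d : Dom K, ∀ t ∈ A, (S.Mem d t ↔ S.Sat S.Arrows v t) := by
  obtain ⟨d, hd⟩ := exists_mem_iff_sat (S := S) (A := ⋃ t ∈ A, {s | Ty.IsSub s t})
    (hA.biUnion fun t _ => t.finite_isSub)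
    (fun t ht s hs => by
      obtain ⟨r, hr, ht⟩ := Set.mem_iUnion₂.1 ht
      exact Set.mem_iUnion₂.2 ⟨r, hr, hs.trans ht⟩) hv
  exact ⟨d, fun t ht => hd t (Set.mem_iUnion₂.2 ⟨t, ht, Ty.IsSub.refl t⟩)⟩

/-- Only the two types `t` and `t'` have to be respected, so an element of the domain can stand in
for the value. -/
theorem Sub.sat {t t' : Ty B} (h : S.Sub t t') {v : Tm K B} (hv : IsVal v)
    (ht : S.Sat S.Arrows v t) : S.Sat S.Arrows v t' := by
  obtain ⟨d, hd⟩ := exists_mem_iff_sat_of_finite (S := S) (A := {t, t'})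
    (Set.toFinite _) hv
  exact (hd t' (by simp)).1 (h d ((hd t (by simp)).2 ht))

/-- The application of an abstraction with an arrow type. -/
theorem arrows_apply {e : Tm K B} {a b : Ty B} (h : S.Arrows e a b) {w r : Tm K B} (hw : IsVal w)
    (ha : S.Sat S.Arrows w a)
    (hr : ∀ c c' : Ty B, c.IsMono → c'.IsMono → S.DTyping S.ValTy [c] e c' →
      S.Sat S.Arrows w c → r = bot ∨ IsVal r ∧ S.Sat S.Arrows r c') :
    r = bot ∨ IsVal r ∧ S.Sat S.Arrows r b := by
  obtain ⟨P, hP, hab⟩ := arrows_iff.1 h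
  have hP' : ∀ p ∈ P, S.Sat S.Arrows w p.1 → r = bot ∨ IsVal r ∧ S.Sat S.Arrows r p.2 :=
    fun p hp => hr p.1 p.2 (hP p hp).1 (hP p hp).2.1 ((hP p hp).2.2.mono fun _ _ h => h.2)
  obtain ⟨d, hd⟩ := exists_mem_iff_sat_of_finite (S := S) (A := {t | t = a ∨ ∃ p ∈ P, t = p.1})
    ((Set.finite_singleton a).union (((List.finite_toSet P).image Prod.fst).subset
      (by rintro _ ⟨p, hp, rfl⟩; exact ⟨p, hp, rfl⟩))) hw
  have hda : S.Mem d a := (hd a (Or.inl rfl)).2 ha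
  by_cases hbot : r = bot
  · exact Or.inl hbot
  refine Or.inr ?_
  have hv : IsVal r := by
    by_contra hv
    -- If `r` were neither `bot` nor a value, the relation sending `d` to the error would satisfy
    -- all premises vacuously, hence also `a → b`; but `d` belongs to `a`.
    have h1 := hab [(d, none)] ∅ fun p hp => (mem_arrow_fn S).2 fun q hq hm => by
      rw [List.mem_singleton.1 hq] at hm
      rcases hP' p hp ((hd p.1 (Or.inr ⟨p, hp, rfl⟩)).1 hm) with h | h
      · exact absurd h hbot
      · exact absurd h.1 hv
    obtain ⟨_, h2, _⟩ := (mem_arrow_fn S).1 h1 (d, none) (by simp) hda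
    cases h2
  refine ⟨hv, ?_⟩
  obtain ⟨d', hd'⟩ := exists_mem_iff_sat_of_finite (S := S) (A := {t | t = b ∨ ∃ p ∈ P, t = p.2})
    ((Set.finite_singleton b).union (((List.finite_toSet P).image Prod.snd).subset
      (by rintro _ ⟨p, hp, rfl⟩; exact ⟨p, hp, rfl⟩))) hv
  -- The one-pair graph of the observed call satisfies the premises, hence `a → b`, and this says
  -- that `d'`, and so `r`, belongs to `b`.
  have h1 := hab [(d, some d')] ∅ fun p hp => (mem_arrow_fn S).2 fun q hq hm => by
    rw [List.mem_singleton.1 hq] at hm ⊢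
    rcases hP' p hp ((hd p.1 (Or.inr ⟨p, hp, rfl⟩)).1 hm) with h | h
    · exact absurd h hbot
    · exact ⟨d', rfl, (hd' p.2 (Or.inr ⟨p, hp, rfl⟩)).2 h.2⟩
  obtain ⟨x, h2, h3⟩ := (mem_arrow_fn S).1 h1 (d, some d') (by simp) hda
  cases h2
  exact (hd' b (Or.inl rfl)).1 h3

end Signature

theorem Ty.IsTest.of_isSub {B : Type v} {s t : Ty B} (h : t.IsTest) (hs : Ty.IsSub s t) :
    s.IsTest :=
  ⟨Set.subset_eq_empty hs.vars_subset h.1, fun r hr => h.2 r (Relation.ReflTransGen.trans hr hs)⟩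

theorem Ty.IsTest.neg {B : Type v} {t : Ty B} (h : t.IsTest) : t.neg.IsTest := by
  have key : ∀ s, RawTy.Subterm s t.neg.raw → s = t.neg.raw ∨ RawTy.Subterm s t.raw := by
    intro s hs
    rcases Relation.ReflTransGen.cases_tail hs with h | ⟨r, hr, i, hi⟩
    · exact Or.inl h.symm
    · refine Or.inr ?_
      rw [← hi, show i = (0 : Fin 1) from Subsingleton.elim (α := Fin 1) i 0] at hr
      exact hr
  refine ⟨Set.eq_empty_of_forall_notMem ?_, ?_⟩
  · rintro a ⟨s, hs, ha⟩
    rcases key s hs with rfl | hs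
    · cases ha
    · exact Set.notMem_empty a (h.1 ▸ ⟨s, hs, ha⟩)
  · intro s hs ha
    rcases key s hs with rfl | hs
    · cases ha
    · exact h.2 s hs ha

namespace Signature

variable {K : Type u} {B : Type v} {S : Signature K B}

open Tm

/-! ## Test types -/

/-- The dynamic type of a value decides every test type: a basic type cannot cut the type of a
constant, by atomicity, and the only arrow allowed contains all functional elements and all
abstractions. -/
theorem mem_iff_sat_of_isTest (hS : S.AtomicConsts) {v : Tm K B} (hv : IsVal v) {d : Dom K}
    (hd : S.Mem d (S.tmType v)) {t : Ty B} (ht : t.IsTest) :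
    S.Mem d t ↔ S.Sat S.Arrows v t := by
  induction v generalizing d t with
  | const c =>
    obtain ⟨c', L, rfl, hc'⟩ := S.mem_base.1 hd
    induction t using Ty.bool_induction with
    | base b =>
      rw [mem_base, sat_base]
      have h1 : c' ∈ S.consts b ↔ c ∈ S.consts b := by
        rcases hS c b with h | h
        · exact iff_of_true (h hc') (h (S.mem_basic c))
        · exact iff_of_false (Set.disjoint_left.1 h hc') (Set.disjoint_left.1 h (S.mem_basic c))
      simp [h1]
    | var a => exact absurd (Ty.mem_vars_var a) (by rw [ht.1]; exact Set.notMem_empty a)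
    | prod t s => rw [mem_prod, sat_prod]; simp
    | arrow t s => rw [mem_arrow, sat_arrow]; simp
    | union t s iht ihs =>
      rw [mem_union, sat_union, iht (ht.of_isSub (Ty.isSub_union_left t s)),
        ihs (ht.of_isSub (Ty.isSub_union_right t s))]
    | neg t iht => rw [mem_neg, sat_neg, iht (ht.of_isSub (Ty.isSub_neg t))]
    | empty => rw [mem_empty, sat_empty]
  | pair v₁ v₂ ih₁ ih₂ =>
    obtain ⟨d₁, d₂, L, rfl, h₁, h₂⟩ := S.mem_prod.1 hd
    induction t using Ty.bool_induction with
    | base b => rw [mem_base, sat_base]; simp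
    | var a => exact absurd (Ty.mem_vars_var a) (by rw [ht.1]; exact Set.notMem_empty a)
    | prod t s =>
      rw [mem_prod, sat_prod]
      simp [ih₁ hv.1 h₁ (ht.of_isSub (Ty.isSub_prod_left t s)),
        ih₂ hv.2 h₂ (ht.of_isSub (Ty.isSub_prod_right t s))]
    | arrow t s => rw [mem_arrow, sat_arrow]; simp
    | union t s iht ihs =>
      rw [mem_union, sat_union, iht (ht.of_isSub (Ty.isSub_union_left t s)),
        ihs (ht.of_isSub (Ty.isSub_union_right t s))]
    | neg t iht => rw [mem_neg, sat_neg, iht (ht.of_isSub (Ty.isSub_neg t))]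
    | empty => rw [mem_empty, sat_empty]
  | lam e =>
    obtain ⟨R, L, rfl⟩ := S.mem_top_arrow.1 hd
    induction t using Ty.bool_induction with
    | base b => rw [mem_base, sat_base]; simp
    | var a => exact absurd (Ty.mem_vars_var a) (by rw [ht.1]; exact Set.notMem_empty a)
    | prod t s => rw [mem_prod, sat_prod]; simp
    | arrow t s =>
      have h : Ty.arrow t s = .arrow .empty .any := Ty.ext (ht.2 _ .refl rfl)
      rw [h]
      exact iff_of_true hd (sat_arrow.2 ⟨e, rfl, arrows_top e⟩)
    | union t s iht ihs =>
      rw [mem_union, sat_union, iht (ht.of_isSub (Ty.isSub_union_left t s)),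
        ihs (ht.of_isSub (Ty.isSub_union_right t s))]
    | neg t iht => rw [mem_neg, sat_neg, iht (ht.of_isSub (Ty.isSub_neg t))]
    | empty => rw [mem_empty, sat_empty]
  | _ => exact hv.elim

/-- Dynamic types are inhabited. So a value cannot pass the tests for a type and for its complement.
-/
theorem exists_mem_tmType {v : Tm K B} (hv : IsVal v) : ∃ d, S.Mem d (S.tmType v) := by
  induction v with
  | const c => exact ⟨.const c ∅, S.mem_base.2 ⟨c, ∅, rfl, S.mem_basic c⟩⟩
  | lam e => exact ⟨.fn [] ∅, S.mem_top_arrow.2 ⟨[], ∅, rfl⟩⟩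
  | pair v₁ v₂ ih₁ ih₂ =>
    obtain ⟨d₁, h₁⟩ := ih₁ hv.1
    obtain ⟨d₂, h₂⟩ := ih₂ hv.2
    exact ⟨.pair d₁ d₂ ∅, S.mem_prod.2 ⟨d₁, d₂, ∅, rfl, h₁, h₂⟩⟩
  | _ => exact hv.elim

theorem sub_tmType_iff (hS : S.AtomicConsts) {v : Tm K B} (hv : IsVal v) {t : Ty B}
    (ht : t.IsTest) : S.Sub (S.tmType v) t ↔ S.Sat S.Arrows v t := by
  constructor
  · intro h
    obtain ⟨d, hd⟩ := exists_mem_tmType (S := S) hv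
    exact (mem_iff_sat_of_isTest hS hv hd ht).1 (h d hd)
  · exact fun h d hd => (mem_iff_sat_of_isTest hS hv hd ht).2 h

theorem sub_tmType_or (hS : S.AtomicConsts) {v : Tm K B} (hv : IsVal v) {t : Ty B}
    (ht : t.IsTest) : S.Sub (S.tmType v) t ∨ S.Sub (S.tmType v) t.neg := by
  rw [sub_tmType_iff hS hv ht, sub_tmType_iff hS hv ht.neg, sat_neg]
  exact em _

/-! ## Soundness of approximation -/

variable (S) in
/-- Closed normal terms of type `t`: the diverging term and the values of type `t`. -/
def Good (g : Tm K B) (t : Ty B) : Prop :=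
  Closed g ∧ S.Nf g ∧
    (g = bot ∨ IsVal g ∧ ∀ σ : ℕ → Ty B, (∀ n, (σ n).IsMono) → S.Sat S.Arrows g (t.inst σ))

theorem good_bot (t : Ty B) : S.Good bot t := ⟨closed_bot, trivial, Or.inl rfl⟩

theorem Good.dtyping {g : Tm K B} {t : Ty B} (h : S.Good g t) (Γ : List (Ty B)) :
    S.DTyping S.ValTy Γ g t := by
  obtain ⟨h1, h2, rfl | h3⟩ := h
  · exact .bot t
  · exact .axm ⟨⟨h1, h2, h3.1⟩, h3.2⟩

theorem Good.imp {g : Tm K B} {t t' : Ty B} (h : S.Good g t)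
    (h' : IsVal g → (∀ σ : ℕ → Ty B, (∀ n, (σ n).IsMono) → S.Sat S.Arrows g (t.inst σ)) →
      ∀ σ : ℕ → Ty B, (∀ n, (σ n).IsMono) → S.Sat S.Arrows g (t'.inst σ)) : S.Good g t' :=
  ⟨h.1, h.2.1, h.2.2.imp id fun ⟨h1, h2⟩ => ⟨h1, h' h1 h2⟩⟩

theorem Good.sub {g : Tm K B} {t t' : Ty B} (h : S.Good g t) (ht : S.Sub t t') : S.Good g t' :=
  h.imp fun hv h σ hσ => (ht.subst _).sat hv (h σ hσ)

/-- A monomorphic instance of an arbitrary instance of `t` is again a monomorphic instance of `t`.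
This is why `Good` may quantify over monomorphic instances only. -/
theorem Good.inst {g : Tm K B} {t : Ty B} (h : S.Good g t) (σ : ℕ → Ty B) :
    S.Good g (t.inst σ) :=
  h.imp fun _ h τ hτ => by
    rw [Ty.inst_inst]
    exact h _ fun n => Ty.isMono_inst _ hτ

theorem Good.inter {g : Tm K B} {t t' : Ty B} (h : S.Good g t) (h' : S.Good g t') :
    S.Good g (t.inter t') := by
  refine h.imp fun hv h1 σ hσ => ?_
  obtain ⟨_, _, rfl | h2⟩ := h'
  · exact hv.elim
  · rw [Ty.inst, Ty.subst_inter]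
    exact sat_inter.2 ⟨h1 σ hσ, h2.2 σ hσ⟩

/-- Since `w` is monomorphic, its instances are all equal to `w`. The classical alternative between
`w` and its complement is thus decided once, for all instances of `s`. -/
theorem Good.split {g : Tm K B} {s : Ty B} (h : S.Good g s) {w : Ty B} (hw : w.IsMono) :
    S.Good g (s.inter w) ∨ S.Good g (s.inter w.neg) := by
  by_cases hg : S.Sat S.Arrows g w
  · refine Or.inl (h.imp fun _ h σ hσ => ?_)
    rw [Ty.inst, Ty.subst_inter]
    refine sat_inter.2 ⟨h σ hσ, ?_⟩
    rwa [← Ty.inst_of_isMono hw σ] at hg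
  · refine Or.inr (h.imp fun _ h σ hσ => ?_)
    rw [Ty.inst, Ty.subst_inter, Ty.subst_neg]
    refine sat_inter.2 ⟨h σ hσ, sat_neg.2 ?_⟩
    rwa [← Ty.inst_of_isMono hw σ] at hg

theorem Good.sat_instance {g : Tm K B} {t : Ty B} (h : S.Good g t) (hg : g ≠ bot) :
    IsVal g ∧ S.Sat S.Arrows g (t.inst fun _ => .empty) := by
  obtain ⟨_, _, rfl | h⟩ := h
  · exact absurd rfl hg
  · exact ⟨h.1, h.2 _ fun _ => Ty.isMono_empty⟩

theorem good_of_isMono {g : Tm K B} {t : Ty B} (hc : Closed g) (hn : S.Nf g) (ht : t.IsMono)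
    (h : g = bot ∨ IsVal g ∧ S.Sat S.Arrows g t) : S.Good g t :=
  ⟨hc, hn, h.imp id fun h => ⟨h.1, fun σ _ => by rw [Ty.inst_of_isMono ht]; exact h.2⟩⟩

theorem Good.of_isMono {g : Tm K B} {t : Ty B} (h : S.Good g t) (ht : t.IsMono) :
    g = bot ∨ IsVal g ∧ S.Sat S.Arrows g t :=
  h.2.2.imp id fun h => ⟨h.1, by
    have := h.2 (fun _ => .empty) fun _ => Ty.isMono_empty
    rwa [Ty.inst_of_isMono ht] at this⟩

theorem Good.lam_of_arrow {g : Tm K B} {t s : Ty B} (h : S.Good g (.arrow t s)) (hg : g ≠ bot) :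
    ∃ e, g = lam e ∧ ∀ σ : ℕ → Ty B, (∀ n, (σ n).IsMono) → S.Arrows e (t.inst σ) (s.inst σ) := by
  obtain ⟨_, h1⟩ := h.sat_instance hg
  rw [Ty.inst, Ty.subst_arrow] at h1
  obtain ⟨e, rfl, _⟩ := sat_arrow.1 h1
  obtain ⟨_, _, h | h⟩ := h
  · cases h
  · refine ⟨e, rfl, fun σ hσ => ?_⟩
    have := h.2 σ hσ
    rw [Ty.inst, Ty.subst_arrow] at this
    obtain ⟨e', he, h'⟩ := sat_arrow.1 this
    cases he
    exact h'

theorem Good.pair_of_prod {g : Tm K B} {t s : Ty B} (h : S.Good g (.prod t s)) (hg : g ≠ bot) :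
    ∃ g₁ g₂, g = pair g₁ g₂ ∧ IsVal g₁ ∧ IsVal g₂ ∧ S.Good g₁ t ∧ S.Good g₂ s := by
  obtain ⟨hv, h1⟩ := h.sat_instance hg
  rw [Ty.inst, Ty.subst_prod] at h1
  obtain ⟨g₁, g₂, rfl, _⟩ := sat_prod.1 h1
  obtain ⟨hc, hn, h | h⟩ := h
  · cases h
  have h' : ∀ σ : ℕ → Ty B, (∀ n, (σ n).IsMono) →
      S.Sat S.Arrows g₁ (t.inst σ) ∧ S.Sat S.Arrows g₂ (s.inst σ) := fun σ hσ => by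
    have := h.2 σ hσ
    rw [Ty.inst, Ty.subst_prod] at this
    obtain ⟨x, y, he, h'⟩ := sat_prod.1 this
    cases he
    exact h'
  exact ⟨g₁, g₂, rfl, hv.1, hv.2,
    ⟨(closed_pair.1 hc).1, hn.1, Or.inr ⟨hv.1, fun σ hσ => (h' σ hσ).1⟩⟩,
    ⟨(closed_pair.1 hc).2, hn.2.1, Or.inr ⟨hv.2, fun σ hσ => (h' σ hσ).2⟩⟩⟩

variable (S) in
/-- Results of approximation in the environment `Δ`. -/
def Res (Δ : List (Ty B)) (g : Tm K B) (t : Ty B) : Prop :=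
  S.Good g t ∨ ¬ Closed g ∧ S.DTyping S.ValTy Δ g t

theorem Res.dtyping {Δ : List (Ty B)} {g : Tm K B} {t : Ty B} (h : S.Res Δ g t) :
    S.DTyping S.ValTy Δ g t := h.elim (fun h => h.dtyping Δ) And.right

theorem Res.good {Δ : List (Ty B)} {g : Tm K B} {t : Ty B} (h : S.Res Δ g t) (hc : Closed g) :
    S.Good g t := h.resolve_right fun h => h.1 hc

/-- A substitution of closed normal terms and variables. -/
def GoodSubst (S : Signature K B) (Γ Δ : List (Ty B)) (θ : ℕ → Tm K B) : Prop :=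
  ∀ k s, Γ[k]? = some s → S.Good (θ k) s ∨ ∃ m, θ k = var m ∧ Δ[m]? = some s

theorem GoodSubst.up {Γ Δ : List (Ty B)} {θ : ℕ → Tm K B} (h : S.GoodSubst Γ Δ θ) (w : Ty B) :
    S.GoodSubst (w :: Γ) (w :: Δ) (up θ) := by
  intro k s hk
  cases k with
  | zero => exact Or.inr ⟨0, rfl, hk⟩
  | succ k =>
    rcases h k s hk with h | ⟨m, hm, hs⟩
    · exact Or.inl (by rw [Tm.up, h.1.rename]; exact h)
    · exact Or.inr ⟨m + 1, by rw [Tm.up, hm]; rfl, hs⟩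

theorem GoodSubst.cons {Γ Δ : List (Ty B)} {θ : ℕ → Tm K B} (h : S.GoodSubst Γ Δ θ) {g : Tm K B}
    {w : Ty B} (hg : S.Good g w) : S.GoodSubst (w :: Γ) Δ (cons g θ) := by
  intro k s hk
  cases k with
  | zero =>
    cases hk
    exact Or.inl hg
  | succ k => exact h k s hk

theorem closed_of_valTy {w : Tm K B} {t : Ty B} (h : S.ValTy w t) : Closed w := h.1.1

/-- A derivation for the body yields, by instantiation, one derivable monomorphic arrow for each
`σ`, and `Arrows` needs no more. -/
theorem good_lam {e : Tm K B} {w t : Ty B} {Δ : List (Ty B)} (hw : w.IsMono)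
    (hc : Closed (lam e)) (hn : S.Nf e) (h : S.DTyping S.ValTy (w :: Δ) e t) :
    S.Good (lam e) (.arrow w t) := by
  refine ⟨hc, hn, Or.inr ⟨trivial, fun σ hσ => ?_⟩⟩
  rw [Ty.inst, Ty.subst_arrow]
  refine sat_arrow.2 ⟨e, rfl, arrows_iff.2 ⟨[(w.inst σ, t.inst σ)], ?_, ?_⟩⟩
  · simp only [List.mem_singleton, forall_eq]
    refine ⟨Ty.isMono_inst _ hσ, Ty.isMono_inst _ hσ, ?_⟩
    rw [Ty.inst_of_isMono hw]
    -- The identity renaming only cleans the derivation: as `lam e` is closed, the environment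
    -- shrinks to the parameter, and the axioms to values not larger than `e`, as `Arrows` demands.
    have h1 := h.rename (fun _ _ => closed_of_valTy) (m := size e) le_rfl (Δ := [w])
      (ρ := id) (fun n hn s hs => by
        cases n with
        | zero => exact hs
        | succ n => exact absurd hn (hc n))
    rw [rename_eq_subst, show (fun n => (var (id n) : Tm K B)) = var from rfl, Tm.subst_var] at h1
    exact .inst σ h1
  · intro R L h
    exact h _ (List.mem_singleton.2 rfl)

/-- The hypothesis `hbeta` on reducts of typed bodies is later supplied by induction on fuel.
`arrows_apply` extends it from the derivable arrows of the abstraction to each instance of `t → s`.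
-/
theorem good_redApp {F : Tm K B → Tm K B} (hF : S.Evaluator F)
    (hbeta : ∀ (e w : Tm K B) (c c' : Ty B), S.DTyping S.ValTy [c] e c' → S.Good w c →
      Closed (subst0 e w) → S.Good (F (subst0 e w)) c')
    {a b : Tm K B} {t s : Ty B} (ha : S.Good a (.arrow t s)) (hb : S.Good b t) :
    S.Good (redApp F a b) s := by
  have hc : Closed (app a b) := closed_app.2 ⟨ha.1, hb.1⟩
  by_cases hbot : a = bot ∨ IsVal a ∧ b = bot
  · unfold redApp
    rw [if_pos hc, if_pos hbot]
    exact good_bot s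
  · have ha' : a ≠ bot := fun h => hbot (Or.inl h)
    have hb' : b ≠ bot := fun h => hbot (Or.inr ⟨(ha.sat_instance ha').1, h⟩)
    have hbv := (hb.sat_instance hb').1
    obtain ⟨e, rfl, he⟩ := ha.lam_of_arrow ha'
    rw [redApp, if_pos hc, if_neg hbot, if_pos hbv]
    have hcl : Closed (subst0 e b) := Closed.subst0 ha.1 hb.1
    have key : ∀ σ : ℕ → Ty B, (∀ n, (σ n).IsMono) → F (subst0 e b) = bot ∨
        IsVal (F (subst0 e b)) ∧ S.Sat S.Arrows (F (subst0 e b)) (s.inst σ) := fun σ hσ => by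
      have hsat : S.Sat S.Arrows b (t.inst σ) :=
        (hb.2.2.resolve_left hb').2 σ hσ
      refine arrows_apply (he σ hσ) hbv hsat fun c c' hcm hcm' hd hw => ?_
      exact (hbeta e b c c' hd (good_of_isMono hb.1 hb.2.1 hcm (Or.inr ⟨hbv, hw⟩)) hcl).of_isMono
        hcm'
    refine ⟨hF.closed _ hcl, hF.nf _, ?_⟩
    -- Whether the result is `bot` does not depend on `σ`, so the disjunction in `key` can be taken
    -- out of the quantifier.
    by_cases hr : F (subst0 e b) = bot
    · exact Or.inl hr
    · exact Or.inr ⟨((key (fun _ => .empty) fun _ => Ty.isMono_empty).resolve_left hr).1,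
        fun σ hσ => ((key σ hσ).resolve_left hr).2⟩

theorem good_redPair {a b : Tm K B} {t s : Ty B} (ha : S.Good a t) (hb : S.Good b s) :
    S.Good (redPair a b) (.prod t s) := by
  have hc : Closed (pair a b) := closed_pair.2 ⟨ha.1, hb.1⟩
  refine ⟨closed_redPair hc, nf_redPair ha.2.1 hb.2.1, ?_⟩
  by_cases hbot : a = bot ∨ IsVal a ∧ b = bot
  · exact Or.inl (if_pos ⟨hc, hbot⟩)
  · have ha' : a ≠ bot := fun h => hbot (Or.inl h)
    have hb' : b ≠ bot := fun h => hbot (Or.inr ⟨(ha.sat_instance ha').1, h⟩)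
    rw [redPair, if_neg fun h => hbot h.2]
    refine Or.inr ⟨⟨(ha.sat_instance ha').1, (hb.sat_instance hb').1⟩, fun σ hσ => ?_⟩
    rw [Ty.inst, Ty.subst_prod]
    exact sat_prod.2 ⟨a, b, rfl, (ha.2.2.resolve_left ha').2 σ hσ,
      (hb.2.2.resolve_left hb').2 σ hσ⟩

theorem good_redFst {a : Tm K B} {t s : Ty B} (ha : S.Good a (.prod t s)) :
    S.Good (redFst a) t := by
  by_cases hbot : a = bot
  · rw [hbot, redFst, if_pos closed_bot]
    exact good_bot t
  · obtain ⟨x, y, rfl, hx, hy, h1, _⟩ := ha.pair_of_prod hbot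
    rw [redFst, if_pos ha.1]
    simp only [hx, hy, and_self, if_true]
    exact h1

theorem good_redSnd {a : Tm K B} {t s : Ty B} (ha : S.Good a (.prod t s)) :
    S.Good (redSnd a) s := by
  by_cases hbot : a = bot
  · rw [hbot, redSnd, if_pos closed_bot]
    exact good_bot s
  · obtain ⟨x, y, rfl, hx, hy, _, h1⟩ := ha.pair_of_prod hbot
    rw [redSnd, if_pos ha.1]
    simp only [hx, hy, and_self, if_true]
    exact h1

theorem good_redCase_of_bot {a b c : Tm K B} {τ : TestTy B} {t : Ty B} (ha : a = bot)
    (hc : Closed (tcase a τ b c)) : S.Good (S.redCase a τ b c) t := by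
  rw [redCase, if_pos hc, if_pos ha]
  exact good_bot t

theorem good_redCase_then (hS : S.AtomicConsts) {a b c : Tm K B} {τ : TestTy B} {t : Ty B}
    (hc : Closed (tcase a τ b c)) (ha : S.Good a τ.1) (hb : S.Good b t) :
    S.Good (S.redCase a τ b c) t := by
  by_cases hbot : a = bot
  · exact good_redCase_of_bot hbot hc
  · obtain ⟨hv, h⟩ := ha.sat_instance hbot
    rw [Ty.inst, Ty.subst_of_isTest τ.2] at h
    rw [redCase, if_pos hc, if_neg hbot, if_pos hv, if_pos ((sub_tmType_iff hS hv τ.2).2 h)]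
    exact hb

theorem good_redCase_else (hS : S.AtomicConsts) {a b c : Tm K B} {τ : TestTy B} {t : Ty B}
    (hc : Closed (tcase a τ b c)) (ha : S.Good a τ.1.neg) (hb : S.Good c t) :
    S.Good (S.redCase a τ b c) t := by
  by_cases hbot : a = bot
  · exact good_redCase_of_bot hbot hc
  · obtain ⟨hv, h⟩ := ha.sat_instance hbot
    rw [Ty.inst, Ty.subst_neg, Ty.subst_of_isTest τ.2, sat_neg] at h
    rw [redCase, if_pos hc, if_neg hbot, if_pos hv,
      if_neg fun h' => h ((sub_tmType_iff hS hv τ.2).1 h')]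
    exact hb

/-- Reduction of closed sub-terms preserves types. -/
theorem DTyping.norm (hS : S.AtomicConsts) {F : Tm K B → Tm K B} (hF : S.Evaluator F)
    (hbeta : ∀ (e w : Tm K B) (c c' : Ty B), S.DTyping S.ValTy [c] e c' → S.Good w c →
      Closed (subst0 e w) → S.Good (F (subst0 e w)) c')
    {Γ Δ : List (Ty B)} {e : Tm K B} {t : Ty B} (h : S.DTyping S.ValTy Γ e t) {θ : ℕ → Tm K B}
    (hθ : S.GoodSubst Γ Δ θ) : S.Res Δ (S.norm F (subst θ e)) t := by
  induction h generalizing Δ θ with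
  | axm h =>
    rw [h.1.1.subst, norm_of_nf h.1.2.1]
    exact Or.inl ⟨h.1.1, h.1.2.1, Or.inr ⟨h.1.2.2, h.2⟩⟩
  | bot t => exact Or.inl (good_bot t)
  | const c =>
    refine Or.inl ⟨fun _ h => h, trivial, Or.inr ⟨trivial, fun σ _ => ?_⟩⟩
    rw [Ty.inst, Ty.subst_base]
    exact sat_base.2 ⟨c, rfl, S.mem_basic c⟩
  | @ax _ n t h =>
    rcases hθ n t h with h | ⟨m, hm, h⟩
    · refine Or.inl ?_
      rw [subst, norm_of_nf h.2.1]
      exact h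
    · refine Or.inr ?_
      rw [subst, hm]
      exact ⟨fun hc => hc m rfl, .ax h⟩
  | @arrowI _ e w t hw _ ih =>
    have h1 := (ih (hθ.up w)).dtyping
    by_cases hc : Closed (lam (S.norm F (subst (Tm.up θ) e)))
    · exact Or.inl (good_lam hw hc (nf_norm hF.nf _) h1)
    · exact Or.inr ⟨hc, .arrowI hw h1⟩
  | @arrowE _ a b _ _ _ _ ih₁ ih₂ =>
    simp only [subst, Signature.norm]
    by_cases hc : Closed (app (S.norm F (subst θ a)) (S.norm F (subst θ b)))
    · exact Or.inl (good_redApp hF hbeta ((ih₁ hθ).good (closed_app.1 hc).1)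
        ((ih₂ hθ).good (closed_app.1 hc).2))
    · rw [redApp_of_not_closed F hc]
      exact Or.inr ⟨hc, .arrowE (ih₁ hθ).dtyping (ih₂ hθ).dtyping⟩
  | @prodI _ a b _ _ _ _ ih₁ ih₂ =>
    simp only [subst, Signature.norm]
    by_cases hc : Closed (pair (S.norm F (subst θ a)) (S.norm F (subst θ b)))
    · exact Or.inl (good_redPair ((ih₁ hθ).good (closed_pair.1 hc).1)
        ((ih₂ hθ).good (closed_pair.1 hc).2))
    · rw [redPair_of_not_closed hc]
      exact Or.inr ⟨hc, .prodI (ih₁ hθ).dtyping (ih₂ hθ).dtyping⟩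
  | @prodE₁ _ a _ _ _ ih =>
    simp only [subst, Signature.norm]
    by_cases hc : Closed (S.norm F (subst θ a))
    · exact Or.inl (good_redFst ((ih hθ).good hc))
    · rw [redFst_of_not_closed hc]
      exact Or.inr ⟨hc, .prodE₁ (ih hθ).dtyping⟩
  | @prodE₂ _ a _ _ _ ih =>
    simp only [subst, Signature.norm]
    by_cases hc : Closed (S.norm F (subst θ a))
    · exact Or.inl (good_redSnd ((ih hθ).good hc))
    · rw [redSnd_of_not_closed hc]
      exact Or.inr ⟨hc, .prodE₂ (ih hθ).dtyping⟩
  | @caseEmpty _ a τ b c _ ih =>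
    simp only [subst, Signature.norm]
    by_cases hc : Closed (tcase (S.norm F (subst θ a)) τ (S.norm F (subst θ b))
        (S.norm F (subst θ c)))
    · refine Or.inl (good_redCase_of_bot ?_ hc)
      by_contra hbot
      have h := (((ih hθ).good (closed_tcase.1 hc).1).sat_instance hbot).2
      rw [Ty.inst, Ty.subst_empty, sat_empty] at h
      exact h
    · rw [redCase_of_not_closed hc]
      exact Or.inr ⟨hc, .caseEmpty τ _ _ (ih hθ).dtyping⟩
  | @caseThen _ a τ b c _ _ _ ih₁ ih₂ =>
    simp only [subst, Signature.norm]
    by_cases hc : Closed (tcase (S.norm F (subst θ a)) τ (S.norm F (subst θ b))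
        (S.norm F (subst θ c)))
    · exact Or.inl (good_redCase_then hS hc ((ih₁ hθ).good (closed_tcase.1 hc).1)
        ((ih₂ hθ).good (closed_tcase.1 hc).2.1))
    · rw [redCase_of_not_closed hc]
      exact Or.inr ⟨hc, .caseThen _ (ih₁ hθ).dtyping (ih₂ hθ).dtyping⟩
  | @caseElse _ a τ b c _ _ _ ih₁ ih₂ =>
    simp only [subst, Signature.norm]
    by_cases hc : Closed (tcase (S.norm F (subst θ a)) τ (S.norm F (subst θ b))
        (S.norm F (subst θ c)))
    · exact Or.inl (good_redCase_else hS hc ((ih₁ hθ).good (closed_tcase.1 hc).1)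
        ((ih₂ hθ).good (closed_tcase.1 hc).2.2))
    · rw [redCase_of_not_closed hc]
      exact Or.inr ⟨hc, .caseElse _ (ih₁ hθ).dtyping (ih₂ hθ).dtyping⟩
  | @unionE _ e e' s w t hw _ _ _ ih ih₁ ih₂ =>
    rw [subst_subst0]
    -- All copies of `e'` are replaced by their common result `g`.
    have hcongr : S.norm F (subst (Tm.cons (subst θ e') θ) e) =
        S.norm F (subst (Tm.cons (S.norm F (subst θ e')) θ) e) :=
      norm_subst_congr hF (fun n => by
        cases n with
        | zero => exact (norm_norm hF _).symm
        | succ n => rfl) e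
    rw [hcongr]
    have hg := ih hθ
    have hgn : S.Nf (S.norm F (subst θ e')) := nf_norm hF.nf _
    generalize S.norm F (subst θ e') = g at hg hgn
    rcases hg with hg | ⟨hgo, hg⟩
    -- A closed `g` satisfies the hypothesis of one of the two branches, whose derivation alone
    -- types the result.
    · rcases hg.split hw with hg | hg
      · exact ih₁ (hθ.cons hg)
      · exact ih₂ (hθ.cons hg)
    -- An open `g` creates no redex, so reduction passes through the substitution and union
    -- elimination applies again to the reduced terms.
    · have ho : ∀ n, ¬ Closed (Tm.cons g Tm.var n) := fun n => by
        cases n with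
        | zero => exact hgo
        | succ n => exact fun h => h n rfl
      rw [← subst_cons_up, subst0, norm_subst_of_open hF ho (fun n => by
        cases n with
        | zero => exact hgn
        | succ n => trivial)]
      have h1 := ih₁ (hθ.up (s.inter w))
      have h2 := ih₂ (hθ.up (s.inter w.neg))
      by_cases hc : Closed (S.norm F (subst (Tm.up θ) e))
      · rw [hc.subst]
        exact Or.inl (h1.good hc)
      · refine Or.inr ⟨fun hc' => hc fun n hn => ho n fun m hm => ?_,
          .unionE hw hg h1.dtyping h2.dtyping⟩
        exact hc' m (occ_subst.2 ⟨n, hn, hm⟩)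
  | interI _ _ ih₁ ih₂ =>
    rcases ih₁ hθ with h1 | ⟨hc, h1⟩
    · exact Or.inl (h1.inter ((ih₂ hθ).good h1.1))
    · exact Or.inr ⟨hc, .interI h1 (ih₂ hθ).dtyping⟩
  | inst σ _ ih =>
    exact (ih hθ).imp (fun h => h.inst σ) fun h => ⟨h.1, .inst σ h.2⟩
  | sub h _ ih =>
    exact (ih hθ).imp (fun h' => h'.sub h) fun h' => ⟨h'.1, .sub h h'.2⟩

/-- Contracting a redex at fuel `n + 1` continues with `approx n`, so the induction hypothesis types
the reduct. At fuel `0` the reduct is `bot`, which has every type. -/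
theorem DTyping.res_approx (hS : S.AtomicConsts) (n : ℕ)
    {Γ Δ : List (Ty B)} {e : Tm K B} {t : Ty B} (h : S.DTyping S.ValTy Γ e t) {θ : ℕ → Tm K B}
    (hθ : S.GoodSubst Γ Δ θ) : S.Res Δ (S.approx n (subst θ e)) t := by
  induction n generalizing Γ Δ e t θ with
  | zero =>
    rw [approx]
    exact h.norm hS (S.evaluator_fuel 0) (fun e w c c' _ _ _ => by rw [fuel]; exact good_bot c') hθ
  | succ n ih =>
    rw [approx]
    refine h.norm hS (S.evaluator_fuel (n + 1)) (fun e w c c' hd hw hc => ?_) hθ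
    rw [fuel]
    refine (ih (Δ := []) hd (θ := Tm.cons w Tm.var) ?_).good (closed_approx hc n)
    intro k s hk
    cases k with
    | zero => cases hk; exact Or.inl hw
    | succ k => cases hk

end Signature

/-! ## Approximation and reduction -/

namespace Tm

variable {K : Type u} {B : Type v}

/-- `Le e e'`: `e` results from `e'` by replacing closed sub-terms with `bot`. -/
inductive Le : Tm K B → Tm K B → Prop
  | bot {e : Tm K B} (h : Closed e) : Le bot e
  | const (c : K) : Le (const c) (const c)
  | var (n : ℕ) : Le (var n) (var n)
  | lam {e e' : Tm K B} : Le e e' → Le (lam e) (lam e')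
  | app {a a' b b' : Tm K B} : Le a a' → Le b b' → Le (app a b) (app a' b')
  | pair {a a' b b' : Tm K B} : Le a a' → Le b b' → Le (pair a b) (pair a' b')
  | fst {a a' : Tm K B} : Le a a' → Le (fst a) (fst a')
  | snd {a a' : Tm K B} : Le a a' → Le (snd a) (snd a')
  | tcase {a a' : Tm K B} (τ : TestTy B) {b b' c c' : Tm K B} : Le a a' → Le b b' → Le c c' →
      Le (tcase a τ b c) (tcase a' τ b' c')

theorem Le.refl (e : Tm K B) : Le e e := by
  induction e with
  | const c => exact .const c
  | var n => exact .var n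
  | lam _ ih => exact .lam ih
  | app _ _ ih₁ ih₂ => exact .app ih₁ ih₂
  | pair _ _ ih₁ ih₂ => exact .pair ih₁ ih₂
  | fst _ ih => exact .fst ih
  | snd _ ih => exact .snd ih
  | tcase _ τ _ _ ih ih₁ ih₂ => exact .tcase τ ih ih₁ ih₂
  | bot => exact .bot closed_bot

/-- Only closed terms are replaced with `bot`, hence related terms are closed simultaneously and the
closedness conditions of the reductions agree. -/
theorem Le.occ_iff {e e' : Tm K B} (h : Le e e') (n : ℕ) : Occ n e ↔ Occ n e' := by
  induction h generalizing n with
  | bot h => exact iff_of_false id (h n)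
  | const | var => exact Iff.rfl
  | lam _ ih => exact ih (n + 1)
  | app _ _ ih₁ ih₂ => exact or_congr (ih₁ n) (ih₂ n)
  | pair _ _ ih₁ ih₂ => exact or_congr (ih₁ n) (ih₂ n)
  | fst _ ih => exact ih n
  | snd _ ih => exact ih n
  | tcase τ _ _ _ ih ih₁ ih₂ => exact or_congr (ih n) (or_congr (ih₁ n) (ih₂ n))

theorem Le.closed_iff {e e' : Tm K B} (h : Le e e') : Closed e ↔ Closed e' :=
  forall_congr' fun n => not_congr (h.occ_iff n)

theorem Le.trans {a b c : Tm K B} (h : Le a b) (h' : Le b c) : Le a c := by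
  induction h generalizing c with
  | bot h => exact .bot (h'.closed_iff.1 h)
  | const | var => exact h'
  | lam _ ih => cases h' with | lam h' => exact .lam (ih h')
  | app _ _ ih₁ ih₂ => cases h' with | app h₁ h₂ => exact .app (ih₁ h₁) (ih₂ h₂)
  | pair _ _ ih₁ ih₂ => cases h' with | pair h₁ h₂ => exact .pair (ih₁ h₁) (ih₂ h₂)
  | fst _ ih => cases h' with | fst h' => exact .fst (ih h')
  | snd _ ih => cases h' with | snd h' => exact .snd (ih h')
  | tcase τ _ _ _ ih ih₁ ih₂ =>
    cases h' with | tcase _ h h₁ h₂ => exact .tcase τ (ih h) (ih₁ h₁) (ih₂ h₂)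

theorem Le.rename {e e' : Tm K B} (h : Le e e') (ρ : ℕ → ℕ) :
    Le (Tm.rename ρ e) (Tm.rename ρ e') := by
  induction h generalizing ρ with
  | bot h => rw [h.rename]; exact .bot h
  | const | var => exact Le.refl _
  | lam _ ih => exact .lam (ih _)
  | app _ _ ih₁ ih₂ => exact .app (ih₁ ρ) (ih₂ ρ)
  | pair _ _ ih₁ ih₂ => exact .pair (ih₁ ρ) (ih₂ ρ)
  | fst _ ih => exact .fst (ih ρ)
  | snd _ ih => exact .snd (ih ρ)
  | tcase τ _ _ _ ih ih₁ ih₂ => exact .tcase τ (ih ρ) (ih₁ ρ) (ih₂ ρ)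

theorem Le.subst {e e' : Tm K B} (h : Le e e') {θ θ' : ℕ → Tm K B} (hθ : ∀ n, Le (θ n) (θ' n)) :
    Le (Tm.subst θ e) (Tm.subst θ' e') := by
  induction h generalizing θ θ' with
  | bot h => rw [h.subst]; exact .bot h
  | const => exact Le.refl _
  | var n => exact hθ n
  | lam _ ih =>
    refine .lam (ih fun n => ?_)
    cases n with
    | zero => exact .var 0
    | succ n => exact (hθ n).rename _
  | app _ _ ih₁ ih₂ => exact .app (ih₁ hθ) (ih₂ hθ)
  | pair _ _ ih₁ ih₂ => exact .pair (ih₁ hθ) (ih₂ hθ)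
  | fst _ ih => exact .fst (ih hθ)
  | snd _ ih => exact .snd (ih hθ)
  | tcase τ _ _ _ ih ih₁ ih₂ => exact .tcase τ (ih hθ) (ih₁ hθ) (ih₂ hθ)

theorem Le.isVal {e e' : Tm K B} (h : Le e e') (hv : IsVal e) : IsVal e' := by
  induction h with
  | const | lam => trivial
  | pair _ _ ih₁ ih₂ => exact ⟨ih₁ hv.1, ih₂ hv.2⟩
  | _ => exact hv.elim

/-- An application that is not reducible at its root. -/
theorem redApp_eq_app (F : Tm K B → Tm K B) {a b : Tm K B} (ha : a ≠ bot)
    (h : ¬ IsVal a ∨ b ≠ bot ∧ (¬ IsVal b ∨ ∀ e, a ≠ lam e)) : redApp F a b = app a b := by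
  unfold redApp
  by_cases hc : Closed (app a b)
  · rw [if_pos hc, if_neg (by rintro (h' | h') <;> tauto)]
    split_ifs with hv
    · cases a with
      | lam e => exact absurd rfl ((h.resolve_left fun h => h trivial).2.resolve_left
          (fun h => h hv) e)
      | _ => rfl
    · rfl
  · exact if_neg hc

theorem redPair_eq_pair {a b : Tm K B} (ha : a ≠ bot) (h : ¬ IsVal a ∨ b ≠ bot) :
    redPair a b = pair a b :=
  if_neg (by rintro ⟨_, h' | h'⟩ <;> tauto)

theorem redFst_eq_fst {a : Tm K B} (ha : a ≠ bot) (h : ∀ x y, a = pair x y → ¬ IsVal a) :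
    redFst a = fst a := by
  unfold redFst
  split_ifs
  · cases a with
    | bot => exact absurd rfl ha
    | pair x y => exact if_neg (h x y rfl)
    | _ => rfl
  · rfl

theorem redSnd_eq_snd {a : Tm K B} (ha : a ≠ bot) (h : ∀ x y, a = pair x y → ¬ IsVal a) :
    redSnd a = snd a := by
  unfold redSnd
  split_ifs
  · cases a with
    | bot => exact absurd rfl ha
    | pair x y => exact if_neg (h x y rfl)
    | _ => rfl
  · rfl

theorem redApp_lam (F : Tm K B → Tm K B) {e b : Tm K B} (hc : Closed (app (lam e) b))
    (hb : IsVal b) : redApp F (lam e) b = F (subst0 e b) := by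
  have hb' : b ≠ bot := by rintro rfl; exact hb
  simp [redApp, hc, hb, hb']

theorem redFst_pair {a b : Tm K B} (hc : Closed (pair a b)) (ha : IsVal a) (hb : IsVal b) :
    redFst (pair a b) = a := by
  simp [redFst, hc, ha, hb]

theorem redSnd_pair {a b : Tm K B} (hc : Closed (pair a b)) (ha : IsVal a) (hb : IsVal b) :
    redSnd (pair a b) = b := by
  simp [redSnd, hc, ha, hb]

theorem IsVal.ne_bot {a : Tm K B} (h : IsVal a) : a ≠ bot := by
  rintro rfl
  exact h

end Tm

namespace Signature

variable {K : Type u} {B : Type v} {S : Signature K B}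

open Tm

/-- Inside a value, `bot` can occur only below an abstraction, where the dynamic type does not look.
-/
theorem _root_.Tm.Le.tmType_eq {e e' : Tm K B} (h : Le e e') (hv : IsVal e) :
    S.tmType e = S.tmType e' := by
  induction h with
  | const | lam => rfl
  | pair _ _ ih₁ ih₂ => rw [tmType, tmType, ih₁ hv.1, ih₂ hv.2]
  | _ => exact hv.elim

/-- A stuck normal term stays stuck when sub-terms `bot` are replaced. -/
theorem _root_.Tm.Le.stuck {e e' : Tm K B} (h : Le e e') (hn : S.Nf e) (hc : Closed e)
    (hv : ¬ IsVal e) (hb : e ≠ bot) : ¬ IsVal e' ∧ e' ≠ bot := by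
  induction h with
  | bot => exact absurd rfl hb
  | const | lam => exact absurd trivial hv
  | @pair a a' b b' _ _ ih₁ ih₂ =>
    refine ⟨fun hv' => ?_, by simp⟩
    -- A closed pair whose evaluation reaches `bot` would have been reduced. So the first component
    -- that is not a value is itself stuck, and the induction hypothesis applies to it.
    have hnb : ¬ (a = .bot ∨ IsVal a ∧ b = .bot) := fun h => by
      have h' := hn.2.2
      rw [redPair, if_pos ⟨hc, h⟩] at h'
      cases h'
    have hc' := closed_pair.1 hc
    by_cases ha : IsVal a
    · exact (ih₂ hn.2.1 hc'.2 (fun h => hv ⟨ha, h⟩) fun h => hnb (Or.inr ⟨ha, h⟩)).1 hv'.2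
    · exact (ih₁ hn.1 hc'.1 ha fun h => hnb (Or.inl h)).1 hv'.1
  | _ => exact ⟨id, by simp⟩

-- Monotonicity of reduction and approximation

/-- A `bot` in evaluation position makes the left side `bot`. Otherwise values stay values and, by
normality, stuck terms stay stuck, so the same alternative applies on both sides. The other
constructors follow the same pattern. -/
theorem le_redApp {F F' : Tm K B → Tm K B} (hF : S.Evaluator F')
    (hle : ∀ x y, Closed x → Le x y → Le (F x) (F' y)) {a a' b b' : Tm K B} (ha : Le a a')
    (hb : Le b b') (hna : S.Nf a) (hnb : S.Nf b) : Le (redApp F a b) (redApp F' a' b') := by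
  have happ := Le.app ha hb
  by_cases hc : Closed (app a b)
  · have hc' := happ.closed_iff.1 hc
    have hcl := closed_app.1 hc
    by_cases hbot : a = bot ∨ IsVal a ∧ b = bot
    · have : redApp F a b = bot := by unfold redApp; rw [if_pos hc, if_pos hbot]
      rw [this]
      exact .bot (closed_redApp hF.closed hc')
    · have ha0 : a ≠ bot := fun h => hbot (Or.inl h)
      by_cases hav : IsVal a
      · have hb0 : b ≠ bot := fun h => hbot (Or.inr ⟨hav, h⟩)
        by_cases hbv : IsVal b
        · have hbv' := hb.isVal hbv
          cases ha with
          | lam he =>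
            rw [redApp_lam F hc hbv, redApp_lam F' hc' hbv']
            refine hle _ _ (hcl.1.subst0 hcl.2) (he.subst fun n => ?_)
            cases n with
            | zero => exact hb
            | succ n => exact .var n
          | const =>
            rw [redApp_eq_app F ha0 (Or.inr ⟨hb0, Or.inr fun e => by simp⟩),
              redApp_eq_app F' (by simp) (Or.inr ⟨hbv'.ne_bot, Or.inr fun e => by simp⟩)]
            exact happ
          | pair =>
            rw [redApp_eq_app F ha0 (Or.inr ⟨hb0, Or.inr fun e => by simp⟩),
              redApp_eq_app F' (by simp) (Or.inr ⟨hbv'.ne_bot, Or.inr fun e => by simp⟩)]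
            exact happ
          | _ => exact hav.elim
        · have h' := hb.stuck hnb hcl.2 hbv hb0
          rw [redApp_eq_app F ha0 (Or.inr ⟨hb0, Or.inl hbv⟩),
            redApp_eq_app F' (ha.isVal hav).ne_bot (Or.inr ⟨h'.2, Or.inl h'.1⟩)]
          exact happ
      · have h' := ha.stuck hna hcl.1 hav ha0
        rw [redApp_eq_app F ha0 (Or.inl hav), redApp_eq_app F' h'.2 (Or.inl h'.1)]
        exact happ
  · rw [redApp_of_not_closed F hc, redApp_of_not_closed F' (mt happ.closed_iff.2 hc)]
    exact happ

theorem le_redPair {a a' b b' : Tm K B} (ha : Le a a') (hb : Le b b') (hna : S.Nf a)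
    (hnb : S.Nf b) : Le (redPair a b) (redPair a' b') := by
  have happ := Le.pair ha hb
  by_cases hc : Closed (pair a b)
  · have hcl := closed_pair.1 hc
    by_cases hbot : a = bot ∨ IsVal a ∧ b = bot
    · rw [redPair, if_pos ⟨hc, hbot⟩]
      exact .bot (closed_redPair (happ.closed_iff.1 hc))
    · have ha0 : a ≠ bot := fun h => hbot (Or.inl h)
      rw [redPair, if_neg fun h => hbot h.2]
      by_cases hav : IsVal a
      · have hb0 : b ≠ bot := fun h => hbot (Or.inr ⟨hav, h⟩)
        have hb' : b' ≠ bot := by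
          by_cases hbv : IsVal b
          · exact (hb.isVal hbv).ne_bot
          · exact (hb.stuck hnb hcl.2 hbv hb0).2
        rw [redPair_eq_pair (ha.isVal hav).ne_bot (Or.inr hb')]
        exact happ
      · have h' := ha.stuck hna hcl.1 hav ha0
        rw [redPair_eq_pair h'.2 (Or.inl h'.1)]
        exact happ
  · rw [redPair_of_not_closed hc, redPair_of_not_closed (mt happ.closed_iff.2 hc)]
    exact happ

theorem le_redFst {a a' : Tm K B} (ha : Le a a') (hna : S.Nf a) : Le (redFst a) (redFst a') := by
  by_cases hc : Closed a
  · have hc' := ha.closed_iff.1 hc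
    by_cases hbot : a = bot
    · subst hbot
      rw [redFst, if_pos closed_bot]
      exact .bot (closed_redFst hc')
    · by_cases hp : ∃ x y, a = pair x y ∧ IsVal a
      · obtain ⟨x, y, rfl, hv⟩ := hp
        cases ha with
        | pair h₁ h₂ =>
          rw [redFst_pair hc hv.1 hv.2, redFst_pair hc' (h₁.isVal hv.1) (h₂.isVal hv.2)]
          exact h₁
      · push Not at hp
        rw [redFst_eq_fst hbot hp]
        by_cases hv : IsVal a
        · rw [redFst_eq_fst (ha.isVal hv).ne_bot]
          · exact .fst ha
          · rintro x y rfl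
            cases ha with
            | pair => exact absurd hv (hp _ _ rfl)
            | bot => exact absurd rfl hbot
        · have h' := ha.stuck hna hc hv hbot
          rw [redFst_eq_fst h'.2 fun _ _ _ => h'.1]
          exact .fst ha
  · rw [redFst_of_not_closed hc, redFst_of_not_closed (mt ha.closed_iff.2 hc)]
    exact .fst ha

theorem le_redSnd {a a' : Tm K B} (ha : Le a a') (hna : S.Nf a) : Le (redSnd a) (redSnd a') := by
  by_cases hc : Closed a
  · have hc' := ha.closed_iff.1 hc
    by_cases hbot : a = bot
    · subst hbot
      rw [redSnd, if_pos closed_bot]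
      exact .bot (closed_redSnd hc')
    · by_cases hp : ∃ x y, a = pair x y ∧ IsVal a
      · obtain ⟨x, y, rfl, hv⟩ := hp
        cases ha with
        | pair h₁ h₂ =>
          rw [redSnd_pair hc hv.1 hv.2, redSnd_pair hc' (h₁.isVal hv.1) (h₂.isVal hv.2)]
          exact h₂
      · push Not at hp
        rw [redSnd_eq_snd hbot hp]
        by_cases hv : IsVal a
        · rw [redSnd_eq_snd (ha.isVal hv).ne_bot]
          · exact .snd ha
          · rintro x y rfl
            cases ha with
            | pair => exact absurd hv (hp _ _ rfl)
            | bot => exact absurd rfl hbot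
        · have h' := ha.stuck hna hc hv hbot
          rw [redSnd_eq_snd h'.2 fun _ _ _ => h'.1]
          exact .snd ha
  · rw [redSnd_of_not_closed hc, redSnd_of_not_closed (mt ha.closed_iff.2 hc)]
    exact .snd ha

theorem redCase_eq_tcase {a b c : Tm K B} {τ : TestTy B} (ha : a ≠ bot) (hv : ¬ IsVal a) :
    S.redCase a τ b c = tcase a τ b c := by
  unfold redCase
  rw [if_neg ha, if_neg hv, ite_self]

theorem le_redCase {a a' b b' c c' : Tm K B} {τ : TestTy B} (ha : Le a a') (hb : Le b b')
    (hc : Le c c') (hna : S.Nf a) : Le (S.redCase a τ b c) (S.redCase a' τ b' c') := by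
  have happ := Le.tcase τ ha hb hc
  by_cases hcl : Closed (tcase a τ b c)
  · have hcl' := happ.closed_iff.1 hcl
    by_cases hbot : a = bot
    · rw [redCase, if_pos hcl, if_pos hbot]
      exact .bot (closed_redCase hcl')
    · by_cases hv : IsVal a
      · have hv' := ha.isVal hv
        rw [redCase, if_pos hcl, if_neg hbot, if_pos hv, redCase, if_pos hcl', if_neg hv'.ne_bot,
          if_pos hv', ← ha.tmType_eq hv]
        split_ifs
        · exact hb
        · exact hc
      · have h' := ha.stuck hna (closed_tcase.1 hcl).1 hv hbot
        rw [redCase_eq_tcase hbot hv, redCase_eq_tcase h'.2 h'.1]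
        exact happ
  · rw [redCase_of_not_closed hcl, redCase_of_not_closed (mt happ.closed_iff.2 hcl)]
    exact happ

theorem le_norm {F F' : Tm K B → Tm K B} (hF : S.Evaluator F) (hF' : S.Evaluator F')
    (hle : ∀ x y, Closed x → Le x y → Le (F x) (F' y)) {e e' : Tm K B} (h : Le e e') :
    Le (S.norm F e) (S.norm F' e') := by
  induction h with
  | bot h => exact .bot (closed_norm hF'.closed h)
  | const | var => exact Le.refl _
  | lam _ ih => exact .lam ih
  | app _ _ ih₁ ih₂ => exact le_redApp hF' hle ih₁ ih₂ (nf_norm hF.nf _) (nf_norm hF.nf _)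
  | pair _ _ ih₁ ih₂ => exact le_redPair ih₁ ih₂ (nf_norm hF.nf _) (nf_norm hF.nf _)
  | fst _ ih => exact le_redFst ih (nf_norm hF.nf _)
  | snd _ ih => exact le_redSnd ih (nf_norm hF.nf _)
  | tcase τ _ _ _ ih ih₁ ih₂ => exact le_redCase ih ih₁ ih₂ (nf_norm hF.nf _)

theorem le_fuel {n m : ℕ} (hnm : n ≤ m) {x y : Tm K B} (hx : Closed x) (h : Le x y) :
    Le (S.fuel n x) (S.fuel m y) := by
  induction n generalizing m x y with
  | zero =>
    rw [fuel]
    exact .bot ((S.evaluator_fuel m).closed y (h.closed_iff.1 hx))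
  | succ n ih =>
    obtain ⟨m, rfl⟩ : ∃ k, m = k + 1 := ⟨m - 1, by omega⟩
    rw [fuel, fuel, approx, approx]
    exact le_norm (S.evaluator_fuel n) (S.evaluator_fuel m)
      (fun x y hx h => ih (by omega) hx h) h

theorem le_approx {n m : ℕ} (hnm : n ≤ m) {x y : Tm K B} (h : Le x y) :
    Le (S.approx n x) (S.approx m y) := by
  rw [approx, approx]
  exact le_norm (S.evaluator_fuel n) (S.evaluator_fuel m) (fun _ _ => le_fuel hnm) h

theorem approx_approx (n : ℕ) (e : Tm K B) : S.approx n (S.approx n e) = S.approx n e :=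
  approx_of_nf (nf_approx n e) n

/-- Approximations of a substitution instance depend monotonically on approximations of the
substitution. -/
theorem le_approx_subst {n m : ℕ} (hnm : n ≤ m) {θ θ' : ℕ → Tm K B}
    (hθ : ∀ k, Le (S.approx n (θ k)) (S.approx m (θ' k))) {e e' : Tm K B}
    (h : Le (S.approx n e) (S.approx m e')) :
    Le (S.approx n (subst θ e)) (S.approx m (subst θ' e')) := by
  rw [← approx_subst_approx n θ, ← approx_subst_approx m θ',
    approx_subst_congr (θ := θ) (θ' := fun k => S.approx n (θ k))
      (fun k => (approx_approx n _).symm),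
    approx_subst_congr (θ := θ') (θ' := fun k => S.approx m (θ' k))
      (fun k => (approx_approx m _).symm)]
  exact le_approx hnm (h.subst hθ)

-- Reduction steps and progress

theorem norm_toExpr (F : Tm K B → Tm K B) (v : Val K B) :
    IsVal (S.norm F v.toExpr.toTm) ∧ S.tmType (S.norm F v.toExpr.toTm) = S.typeof v := by
  induction v with
  | const c => exact ⟨trivial, rfl⟩
  | lam e => exact ⟨trivial, rfl⟩
  | pair v₁ v₂ ih₁ ih₂ =>
    have h : S.norm F (Val.pair v₁ v₂).toExpr.toTm =
        pair (S.norm F v₁.toExpr.toTm) (S.norm F v₂.toExpr.toTm) :=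
      redPair_eq_pair ih₁.1.ne_bot (Or.inr ih₂.1.ne_bot)
    rw [h]
    exact ⟨⟨ih₁.1, ih₂.1⟩, by rw [tmType, ih₁.2, ih₂.2, typeof]⟩

theorem Step.closed {e e' : Expr K B} (h : S.Step e e') (hc : Closed e.toTm) :
    Closed e'.toTm := by
  induction h with
  | beta e v =>
    have := closed_app.1 hc
    rw [Expr.toTm_subst0]
    exact Closed.subst0 this.1 this.2
  | fst v₁ v₂ => exact (closed_pair.1 (closed_fst.1 hc)).1
  | snd v₁ v₂ => exact (closed_pair.1 (closed_snd.1 hc)).2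
  | caseThen => exact (closed_tcase.1 hc).2.1
  | caseElse => exact (closed_tcase.1 hc).2.2
  | appL _ _ ih => exact closed_app.2 ⟨ih (closed_app.1 hc).1, (closed_app.1 hc).2⟩
  | appR _ _ ih => exact closed_app.2 ⟨(closed_app.1 hc).1, ih (closed_app.1 hc).2⟩
  | pairL _ _ ih => exact closed_pair.2 ⟨ih (closed_pair.1 hc).1, (closed_pair.1 hc).2⟩
  | pairR _ _ ih => exact closed_pair.2 ⟨(closed_pair.1 hc).1, ih (closed_pair.1 hc).2⟩
  | fstC _ ih => exact ih hc
  | sndC _ ih => exact ih hc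
  | caseC _ _ _ _ ih => exact closed_tcase.2 ⟨ih (closed_tcase.1 hc).1, (closed_tcase.1 hc).2⟩

/-- A reduct with fuel `n` is below the original expression with fuel `n + 1`. -/
theorem Step.le_approx {e e' : Expr K B} (h : S.Step e e') (hc : Closed e.toTm) (n : ℕ) :
    Le (S.approx n e'.toTm) (S.approx (n + 1) e.toTm) := by
  have hF := S.evaluator_fuel n
  have hF' := S.evaluator_fuel (n + 1)
  have hle : ∀ x y : Tm K B, Closed x → Le x y → Le (S.fuel n x) (S.fuel (n + 1) y) :=
    fun _ _ => le_fuel (Nat.le_succ n)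
  have hmono : ∀ x : Tm K B, Le (S.norm (S.fuel n) x) (S.norm (S.fuel (n + 1)) x) := fun x =>
    le_norm hF hF' hle (Le.refl x)
  have hcl : ∀ {x : Tm K B}, Closed x → Closed (S.norm (S.fuel (n + 1)) x) := fun hx =>
    closed_norm hF'.closed hx
  rw [approx, approx]
  induction h with
  | beta e v =>
    have hc' := closed_app.1 hc
    -- Contracting the redex costs the one unit of fuel by which the two sides differ.
    have hr : S.norm (S.fuel (n + 1)) (Expr.app (.lam e) v.toExpr).toTm =
        S.approx n (subst0 (S.norm (S.fuel (n + 1)) e.toTm)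
          (S.norm (S.fuel (n + 1)) v.toExpr.toTm)) := by
      have h1 := redApp_lam (S.fuel (n + 1)) (e := S.norm (S.fuel (n + 1)) e.toTm)
        (closed_app.2 ⟨hcl hc'.1, hcl hc'.2⟩) (norm_toExpr (S := S) (S.fuel (n + 1)) v).1
      rw [fuel] at h1 ⊢
      exact h1
    rw [hr, Expr.toTm_subst0, ← approx]
    refine le_approx_subst le_rfl (fun k => ?_) ?_
    · cases k with
      | zero =>
        rw [← approx_approx]
        refine Signature.le_approx le_rfl ?_
        rw [approx]
        exact hmono _
      | succ k => exact Le.refl _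
    · rw [← approx_approx]
      refine Signature.le_approx le_rfl ?_
      rw [approx]
      exact hmono _
  | fst v₁ v₂ =>
    have hc' := closed_fst.1 hc
    have h1 := (norm_toExpr (S := S) (S.fuel (n + 1)) v₁).1
    have h2 := (norm_toExpr (S := S) (S.fuel (n + 1)) v₂).1
    have hp := redPair_eq_pair h1.ne_bot (Or.inr h2.ne_bot)
    have hr := redFst_pair (closed_pair.2 ⟨hcl (closed_pair.1 hc').1, hcl (closed_pair.1 hc').2⟩)
      h1 h2
    rw [← hp] at hr
    exact (congrArg (Le _) hr).mpr (hmono _)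
  | snd v₁ v₂ =>
    have hc' := closed_snd.1 hc
    have h1 := (norm_toExpr (S := S) (S.fuel (n + 1)) v₁).1
    have h2 := (norm_toExpr (S := S) (S.fuel (n + 1)) v₂).1
    have hp := redPair_eq_pair h1.ne_bot (Or.inr h2.ne_bot)
    have hr := redSnd_pair (closed_pair.2 ⟨hcl (closed_pair.1 hc').1, hcl (closed_pair.1 hc').2⟩)
      h1 h2
    rw [← hp] at hr
    exact (congrArg (Le _) hr).mpr (hmono _)
  | caseThen v τ e₁ e₂ h =>
    have hc' := closed_tcase.1 hc
    obtain ⟨hv, ht⟩ := norm_toExpr (S := S) (S.fuel (n + 1)) v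
    have hr : S.redCase (S.norm (S.fuel (n + 1)) v.toExpr.toTm) τ
        (S.norm (S.fuel (n + 1)) e₁.toTm) (S.norm (S.fuel (n + 1)) e₂.toTm) =
        S.norm (S.fuel (n + 1)) e₁.toTm := by
      rw [redCase, if_pos (closed_tcase.2 ⟨hcl hc'.1, hcl hc'.2.1, hcl hc'.2.2⟩),
        if_neg hv.ne_bot, if_pos hv, if_pos (by rw [ht]; exact h)]
    exact (congrArg (Le _) hr).mpr (hmono _)
  | caseElse v τ e₁ e₂ h =>
    have hc' := closed_tcase.1 hc
    obtain ⟨hv, ht⟩ := norm_toExpr (S := S) (S.fuel (n + 1)) v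
    have hnot : ¬ S.Sub (S.tmType (S.norm (S.fuel (n + 1)) v.toExpr.toTm)) τ.1 := fun h' => by
      obtain ⟨d, hd⟩ := exists_mem_tmType (S := S) hv
      exact (S.mem_neg).1 (h d (ht ▸ hd)) (h' d hd)
    have hr : S.redCase (S.norm (S.fuel (n + 1)) v.toExpr.toTm) τ
        (S.norm (S.fuel (n + 1)) e₁.toTm) (S.norm (S.fuel (n + 1)) e₂.toTm) =
        S.norm (S.fuel (n + 1)) e₂.toTm := by
      rw [redCase, if_pos (closed_tcase.2 ⟨hcl hc'.1, hcl hc'.2.1, hcl hc'.2.2⟩),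
        if_neg hv.ne_bot, if_pos hv, if_neg hnot]
    exact (congrArg (Le _) hr).mpr (hmono _)
  | appL _ _ ih =>
    exact le_redApp hF' hle (ih (closed_app.1 hc).1) (hmono _) (nf_norm hF.nf _)
      (nf_norm hF.nf _)
  | appR _ _ ih =>
    exact le_redApp hF' hle (hmono _) (ih (closed_app.1 hc).2) (nf_norm hF.nf _)
      (nf_norm hF.nf _)
  | pairL _ _ ih =>
    exact le_redPair (ih (closed_pair.1 hc).1) (hmono _) (nf_norm hF.nf _) (nf_norm hF.nf _)
  | pairR _ _ ih =>
    exact le_redPair (hmono _) (ih (closed_pair.1 hc).2) (nf_norm hF.nf _) (nf_norm hF.nf _)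
  | fstC _ ih => exact le_redFst (ih hc) (nf_norm hF.nf _)
  | sndC _ ih => exact le_redSnd (ih hc) (nf_norm hF.nf _)
  | caseC _ _ _ _ ih =>
    exact le_redCase (ih (closed_tcase.1 hc).1) (hmono _) (hmono _) (nf_norm hF.nf _)

/-- A closed expression is a value, or reducible, or stuck in all approximations. -/
theorem value_or_step_or_stuck (hS : S.AtomicConsts) (e : Expr K B) (hc : Closed e.toTm) :
    (∃ v : Val K B, e = v.toExpr) ∨ (∃ e', S.Step e e') ∨
      ∀ F, ¬ IsVal (S.norm F e.toTm) ∧ S.norm F e.toTm ≠ bot := by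
  induction e with
  | const c => exact Or.inl ⟨.const c, rfl⟩
  | var n => exact absurd rfl (hc n)
  | lam e => exact Or.inl ⟨.lam e, rfl⟩
  | app e₁ e₂ ih₁ ih₂ =>
    rcases ih₁ (closed_app.1 hc).1 with ⟨v₁, rfl⟩ | ⟨e', h⟩ | h₁
    · rcases ih₂ (closed_app.1 hc).2 with ⟨v₂, rfl⟩ | ⟨e', h⟩ | h₂
      · have key : (∀ F e, S.norm F v₁.toExpr.toTm ≠ lam e) →
            ∀ F, ¬ IsVal (S.norm F (Expr.app v₁.toExpr v₂.toExpr).toTm) ∧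
              S.norm F (Expr.app v₁.toExpr v₂.toExpr).toTm ≠ bot := fun hl F => by
          have h : S.norm F (Expr.app v₁.toExpr v₂.toExpr).toTm = app _ _ :=
            redApp_eq_app F (norm_toExpr (S := S) F v₁).1.ne_bot
              (Or.inr ⟨(norm_toExpr (S := S) F v₂).1.ne_bot, Or.inr (hl F)⟩)
          rw [h]
          exact ⟨id, by simp⟩
        cases v₁ with
        | lam e => exact Or.inr (Or.inl ⟨_, .beta e v₂⟩)
        | const c => exact Or.inr (Or.inr (key fun F e => by simp [Val.toExpr, Expr.toTm, norm]))
        | pair a b =>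
          refine Or.inr (Or.inr (key fun F e he => ?_))
          have h : S.norm F (Val.pair a b).toExpr.toTm = pair _ _ :=
            redPair_eq_pair (norm_toExpr (S := S) F a).1.ne_bot
              (Or.inr (norm_toExpr (S := S) F b).1.ne_bot)
          rw [h] at he
          cases he
      · exact Or.inr (Or.inl ⟨_, .appR v₁ h⟩)
      · refine Or.inr (Or.inr fun F => ?_)
        have h : S.norm F (Expr.app v₁.toExpr e₂).toTm = app _ _ :=
          redApp_eq_app F (norm_toExpr (S := S) F v₁).1.ne_bot
            (Or.inr ⟨(h₂ F).2, Or.inl (h₂ F).1⟩)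
        rw [h]
        exact ⟨id, by simp⟩
    · exact Or.inr (Or.inl ⟨_, .appL e₂ h⟩)
    · refine Or.inr (Or.inr fun F => ?_)
      have h : S.norm F (Expr.app e₁ e₂).toTm = app _ _ :=
        redApp_eq_app F (h₁ F).2 (Or.inl (h₁ F).1)
      rw [h]
      exact ⟨id, by simp⟩
  | pair e₁ e₂ ih₁ ih₂ =>
    rcases ih₁ (closed_pair.1 hc).1 with ⟨v₁, rfl⟩ | ⟨e', h⟩ | h₁
    · rcases ih₂ (closed_pair.1 hc).2 with ⟨v₂, rfl⟩ | ⟨e', h⟩ | h₂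
      · exact Or.inl ⟨.pair v₁ v₂, rfl⟩
      · exact Or.inr (Or.inl ⟨_, .pairR v₁ h⟩)
      · refine Or.inr (Or.inr fun F => ?_)
        have h : S.norm F (Expr.pair v₁.toExpr e₂).toTm = pair _ _ :=
          redPair_eq_pair (norm_toExpr (S := S) F v₁).1.ne_bot (Or.inr (h₂ F).2)
        rw [h]
        exact ⟨fun h => (h₂ F).1 h.2, by simp⟩
    · exact Or.inr (Or.inl ⟨_, .pairL e₂ h⟩)
    · refine Or.inr (Or.inr fun F => ?_)
      have h : S.norm F (Expr.pair e₁ e₂).toTm = pair _ _ :=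
        redPair_eq_pair (h₁ F).2 (Or.inl (h₁ F).1)
      rw [h]
      exact ⟨fun h => (h₁ F).1 h.1, by simp⟩
  | fst e ih =>
    rcases ih hc with ⟨v, rfl⟩ | ⟨e', h⟩ | h
    · cases v with
      | pair a b => exact Or.inr (Or.inl ⟨_, .fst a b⟩)
      | const c =>
        refine Or.inr (Or.inr fun F => ?_)
        have h : S.norm F (Expr.fst (.const c)).toTm = fst _ :=
          redFst_eq_fst (a := .const c) (by simp) (by simp)
        rw [Val.toExpr, h]
        exact ⟨id, by simp⟩
      | lam e =>
        refine Or.inr (Or.inr fun F => ?_)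
        have h : S.norm F (Expr.fst (.lam e)).toTm = fst _ :=
          redFst_eq_fst (a := .lam (S.norm F e.toTm)) (by simp) (by simp)
        rw [Val.toExpr, h]
        exact ⟨id, by simp⟩
    · exact Or.inr (Or.inl ⟨_, .fstC h⟩)
    · refine Or.inr (Or.inr fun F => ?_)
      have h' : S.norm F (Expr.fst e).toTm = fst _ :=
        redFst_eq_fst (h F).2 fun _ _ _ => (h F).1
      rw [h']
      exact ⟨id, by simp⟩
  | snd e ih =>
    rcases ih hc with ⟨v, rfl⟩ | ⟨e', h⟩ | h
    · cases v with
      | pair a b => exact Or.inr (Or.inl ⟨_, .snd a b⟩)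
      | const c =>
        refine Or.inr (Or.inr fun F => ?_)
        have h : S.norm F (Expr.snd (.const c)).toTm = snd _ :=
          redSnd_eq_snd (a := .const c) (by simp) (by simp)
        rw [Val.toExpr, h]
        exact ⟨id, by simp⟩
      | lam e =>
        refine Or.inr (Or.inr fun F => ?_)
        have h : S.norm F (Expr.snd (.lam e)).toTm = snd _ :=
          redSnd_eq_snd (a := .lam (S.norm F e.toTm)) (by simp) (by simp)
        rw [Val.toExpr, h]
        exact ⟨id, by simp⟩
    · exact Or.inr (Or.inl ⟨_, .sndC h⟩)
    · refine Or.inr (Or.inr fun F => ?_)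
      have h' : S.norm F (Expr.snd e).toTm = snd _ :=
        redSnd_eq_snd (h F).2 fun _ _ _ => (h F).1
      rw [h']
      exact ⟨id, by simp⟩
  | tcase e τ e₁ e₂ ih _ _ =>
    rcases ih (closed_tcase.1 hc).1 with ⟨v, rfl⟩ | ⟨e', h⟩ | h
    -- Any continuation would do in place of `id`: the reduced term is used only as a value with the
    -- same dynamic type as `v`.
    · obtain ⟨hv, ht⟩ := norm_toExpr (S := S) id v
      have hor := sub_tmType_or hS hv τ.2
      rw [ht] at hor
      rcases hor with h | h
      · exact Or.inr (Or.inl ⟨_, .caseThen v τ e₁ e₂ h⟩)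
      · exact Or.inr (Or.inl ⟨_, .caseElse v τ e₁ e₂ h⟩)
    · exact Or.inr (Or.inl ⟨_, .caseC τ e₁ e₂ h⟩)
    · refine Or.inr (Or.inr fun F => ?_)
      have h' : S.norm F (Expr.tcase e τ e₁ e₂).toTm = tcase _ τ _ _ :=
        redCase_eq_tcase (h F).2 (h F).1
      rw [h']
      exact ⟨id, by simp⟩

end Signature

/-! ## Programs -/

namespace Expr

variable {K : Type u} {B : Type v}

theorem toTm_injective : Function.Injective (toTm : Expr K B → Tm K B) := by
  intro e
  induction e with
  | tcase _ _ _ _ ih ih₁ ih₂ =>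
    intro e' h
    cases e' <;> simp only [toTm, reduceCtorEq, Tm.tcase.injEq] at h
    rw [ih h.1, h.2.1, ih₁ h.2.2.1, ih₂ h.2.2.2]
  | app _ _ ih₁ ih₂ =>
    intro e' h
    cases e' <;> simp only [toTm, reduceCtorEq, Tm.app.injEq] at h
    rw [ih₁ h.1, ih₂ h.2]
  | pair _ _ ih₁ ih₂ =>
    intro e' h
    cases e' <;> simp only [toTm, reduceCtorEq, Tm.pair.injEq] at h
    rw [ih₁ h.1, ih₂ h.2]
  | lam _ ih =>
    intro e' h
    cases e' <;> simp only [toTm, reduceCtorEq, Tm.lam.injEq] at h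
    rw [ih h]
  | fst _ ih =>
    intro e' h
    cases e' <;> simp only [toTm, reduceCtorEq, Tm.fst.injEq] at h
    rw [ih h]
  | snd _ ih =>
    intro e' h
    cases e' <;> simp only [toTm, reduceCtorEq, Tm.snd.injEq] at h
    rw [ih h]
  | const =>
    intro e' h
    cases e' <;> simp only [toTm, reduceCtorEq, Tm.const.injEq] at h
    rw [h]
  | var =>
    intro e' h
    cases e' <;> simp only [toTm, reduceCtorEq, Tm.var.injEq] at h
    rw [h]

theorem subst_subst (θ θ' : ℕ → Expr K B) (e : Expr K B) :
    subst θ' (subst θ e) = subst (fun n => subst θ' (θ n)) e := by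
  apply toTm_injective
  simp only [toTm_subst, Tm.subst_subst]

theorem subst_up_up (θ θ' : ℕ → Expr K B) :
    (fun n => subst (up θ') (up θ n)) = up fun n => subst θ' (θ n) := by
  funext n
  cases n with
  | zero => rfl
  | succ n =>
    apply toTm_injective
    simp only [up, toTm_subst, toTm_rename, Tm.subst_rename, Tm.rename_subst]

/-- Extension of a substitution by an expression for the index `0`. -/
def cons (g : Expr K B) (θ : ℕ → Expr K B) : ℕ → Expr K B
  | 0 => g
  | n + 1 => θ n

end Expr

namespace Prog

variable {K : Type u} {B : Type v}

theorem subst_subst (θ θ' : ℕ → Expr K B) (p : Prog K B) :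
    subst θ' (subst θ p) = subst (fun n => (θ n).subst θ') p := by
  induction p generalizing θ θ' with
  | expr e => simp only [subst, Expr.subst_subst]
  | letIn e p ih => simp only [subst, Expr.subst_subst, ih, Expr.subst_up_up]

theorem subst0_subst_up (θ : ℕ → Expr K B) (g : Expr K B) (p : Prog K B) :
    subst0 (subst (Expr.up θ) p) g = subst (Expr.cons g θ) p := by
  rw [subst0, subst_subst]
  congr 1
  funext n
  cases n with
  | zero => rfl
  | succ n =>
    apply Expr.toTm_injective
    simp only [Expr.up, Expr.cons, Expr.toTm_subst, Expr.toTm_rename, Tm.subst_rename]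
    exact Tm.subst_var _

end Prog

/-- If no normal form is reachable, every reachable element has a successor, and dependent choice
builds the sequence. -/
theorem Relation.exists_infinite_or_normal {X : Type*} (r : X → X → Prop) (a : X) :
    (∃ f : ℕ → X, f 0 = a ∧ ∀ n, r (f n) (f (n + 1))) ∨
      ∃ b, Relation.ReflTransGen r a b ∧ ∀ c, ¬ r b c := by
  by_cases h : ∃ b, Relation.ReflTransGen r a b ∧ ∀ c, ¬ r b c
  · exact Or.inr h
  · push Not at h
    choose next hnext using h
    let g : ℕ → {b // Relation.ReflTransGen r a b} := fun n =>
      Nat.rec ⟨a, .refl⟩ (fun _ b => ⟨next b.1 b.2, .tail b.2 (hnext b.1 b.2)⟩) n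
    exact Or.inl ⟨fun n => (g n).1, rfl, fun n => hnext (g n).1 (g n).2⟩

namespace Signature

variable {K : Type u} {B : Type v} {S : Signature K B}

open Tm

/-! ### Free variables that are never evaluated -/

/-- A closed stuck expression. -/
def _root_.Expr.junk : Expr K B := .fst (.lam (.var 0))

/-- The replacement of all free variables by a stuck expression. -/
def _root_.Expr.junkSubst : ℕ → Expr K B := fun _ => .junk

/-- `junk` is a projection, so a variable never turns into a value; and dynamic types ignore the
bodies of abstractions. -/
theorem exists_val_of_subst {e : Expr K B} {v : Val K B} (h : e.subst Expr.junkSubst = v.toExpr) :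
    ∃ v' : Val K B, e = v'.toExpr ∧ S.typeof v' = S.typeof v := by
  induction v generalizing e with
  | const c =>
    cases e <;> simp only [Expr.subst, Val.toExpr, Expr.junkSubst, Expr.junk, reduceCtorEq] at h
    cases h
    exact ⟨.const c, rfl, rfl⟩
  | lam b =>
    cases e <;> simp only [Expr.subst, Val.toExpr, Expr.junkSubst, Expr.junk, reduceCtorEq] at h
    exact ⟨.lam _, rfl, rfl⟩
  | pair v₁ v₂ ih₁ ih₂ =>
    cases e <;> simp only [Expr.subst, Val.toExpr, Expr.junkSubst, Expr.junk, reduceCtorEq,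
      Expr.pair.injEq] at h
    obtain ⟨w₁, rfl, h₁⟩ := ih₁ h.1
    obtain ⟨w₂, rfl, h₂⟩ := ih₂ h.2
    exact ⟨.pair w₁ w₂, rfl, by rw [typeof, typeof, h₁, h₂]⟩

theorem subst_subst0_expr (θ : ℕ → Expr K B) (e e' : Expr K B) :
    (e.subst0 e').subst θ = (e.subst (Expr.up θ)).subst0 (e'.subst θ) := by
  apply Expr.toTm_injective
  rw [Expr.toTm_subst0, Expr.toTm_subst, Expr.toTm_subst0, Expr.toTm_subst, Expr.toTm_subst,
    subst_subst0]
  refine (subst_cons_up _ _ _).symm.trans ?_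
  congr 2
  funext n
  cases n with
  | zero => rfl
  | succ n => simp only [Expr.up, Tm.up, Expr.toTm_rename]

theorem not_step_junk {e' : Expr K B} : ¬ S.Step .junk e' := by
  intro h
  generalize he : (Expr.junk : Expr K B) = e at h
  cases h <;> cases he
  rename_i h
  generalize he : (Expr.lam (.var 0) : Expr K B) = e at h
  cases h <;> cases he

/-- Reductions do not depend on free variables. -/
theorem Step.of_subst {e x : Expr K B} (h : S.Step (e.subst Expr.junkSubst) x) :
    ∃ e', S.Step e e' ∧ e'.subst Expr.junkSubst = x := by
  generalize he : e.subst Expr.junkSubst = y at h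
  -- An instance of a variable is stuck, so the contracted redex must come from `e` itself.
  have hvar : ∀ n, e ≠ .var n := by
    rintro n rfl
    subst he
    exact not_step_junk h
  induction h generalizing e with
  | beta b v =>
    cases e <;> simp only [Expr.subst, reduceCtorEq, Expr.app.injEq] at he <;>
      first | exact absurd rfl (hvar _) | skip
    rename_i a₁ a₂
    obtain ⟨v₂, rfl, _⟩ := exists_val_of_subst (S := S) he.2
    cases a₁ <;> simp only [Expr.subst, reduceCtorEq, Expr.lam.injEq, Expr.junkSubst, Expr.junk,
      false_and] at he
    obtain ⟨rfl, h2⟩ := he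
    rw [← h2]
    exact ⟨_, .beta _ v₂, subst_subst0_expr _ _ _⟩
  | fst v₁ v₂ =>
    cases e <;> simp only [Expr.subst, reduceCtorEq, Expr.fst.injEq] at he <;>
      first | exact absurd rfl (hvar _) | skip
    obtain ⟨w, rfl, _⟩ := exists_val_of_subst (S := S) (v := .pair v₁ v₂) he
    cases w <;> simp only [Val.toExpr, Expr.subst, reduceCtorEq, Expr.pair.injEq] at he
    exact ⟨_, .fst _ _, he.1⟩
  | snd v₁ v₂ =>
    cases e <;> simp only [Expr.subst, reduceCtorEq, Expr.snd.injEq] at he <;>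
      first | exact absurd rfl (hvar _) | skip
    obtain ⟨w, rfl, _⟩ := exists_val_of_subst (S := S) (v := .pair v₁ v₂) he
    cases w <;> simp only [Val.toExpr, Expr.subst, reduceCtorEq, Expr.pair.injEq] at he
    exact ⟨_, .snd _ _, he.2⟩
  | caseThen v τ e₁ e₂ h =>
    cases e <;> simp only [Expr.subst, reduceCtorEq, Expr.tcase.injEq] at he <;>
      first | exact absurd rfl (hvar _) | skip
    obtain ⟨he, rfl, rfl, rfl⟩ := he
    obtain ⟨w, rfl, hw⟩ := exists_val_of_subst (S := S) he
    exact ⟨_, .caseThen w _ _ _ (by rw [Test, hw]; exact h), rfl⟩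
  | caseElse v τ e₁ e₂ h =>
    cases e <;> simp only [Expr.subst, reduceCtorEq, Expr.tcase.injEq] at he <;>
      first | exact absurd rfl (hvar _) | skip
    obtain ⟨he, rfl, rfl, rfl⟩ := he
    obtain ⟨w, rfl, hw⟩ := exists_val_of_subst (S := S) he
    exact ⟨_, .caseElse w _ _ _ (by rw [Test, hw]; exact h), rfl⟩
  | appL e₂ hs ih =>
    cases e <;> simp only [Expr.subst, reduceCtorEq, Expr.app.injEq] at he <;>
      first | exact absurd rfl (hvar _) | skip
    obtain ⟨he, rfl⟩ := he
    obtain ⟨e', h, rfl⟩ := ih he (by rintro n rfl; subst he; exact not_step_junk hs)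
    exact ⟨_, .appL _ h, rfl⟩
  | appR v hs ih =>
    cases e <;> simp only [Expr.subst, reduceCtorEq, Expr.app.injEq] at he <;>
      first | exact absurd rfl (hvar _) | skip
    obtain ⟨he, he'⟩ := he
    obtain ⟨w, rfl, hw⟩ := exists_val_of_subst (S := S) he
    obtain ⟨e', h, rfl⟩ := ih he' (by rintro n rfl; subst he'; exact not_step_junk hs)
    exact ⟨_, .appR w h, by rw [Expr.subst, he]⟩
  | pairL e₂ hs ih =>
    cases e <;> simp only [Expr.subst, reduceCtorEq, Expr.pair.injEq] at he <;>
      first | exact absurd rfl (hvar _) | skip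
    obtain ⟨he, rfl⟩ := he
    obtain ⟨e', h, rfl⟩ := ih he (by rintro n rfl; subst he; exact not_step_junk hs)
    exact ⟨_, .pairL _ h, rfl⟩
  | pairR v hs ih =>
    cases e <;> simp only [Expr.subst, reduceCtorEq, Expr.pair.injEq] at he <;>
      first | exact absurd rfl (hvar _) | skip
    obtain ⟨he, he'⟩ := he
    obtain ⟨w, rfl, hw⟩ := exists_val_of_subst (S := S) he
    obtain ⟨e', h, rfl⟩ := ih he' (by rintro n rfl; subst he'; exact not_step_junk hs)
    exact ⟨_, .pairR w h, by rw [Expr.subst, he]⟩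
  | fstC hs ih =>
    cases e <;> simp only [Expr.subst, reduceCtorEq, Expr.fst.injEq] at he <;>
      first | exact absurd rfl (hvar _) | skip
    obtain ⟨e', h, rfl⟩ := ih he (by rintro n rfl; subst he; exact not_step_junk hs)
    exact ⟨_, .fstC h, rfl⟩
  | sndC hs ih =>
    cases e <;> simp only [Expr.subst, reduceCtorEq, Expr.snd.injEq] at he <;>
      first | exact absurd rfl (hvar _) | skip
    obtain ⟨e', h, rfl⟩ := ih he (by rintro n rfl; subst he; exact not_step_junk hs)
    exact ⟨_, .sndC h, rfl⟩
  | caseC τ e₁ e₂ hs ih =>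
    cases e <;> simp only [Expr.subst, reduceCtorEq, Expr.tcase.injEq] at he <;>
      first | exact absurd rfl (hvar _) | skip
    obtain ⟨he, rfl, rfl, rfl⟩ := he
    obtain ⟨e', h, rfl⟩ := ih he (by rintro n rfl; subst he; exact not_step_junk hs)
    exact ⟨_, .caseC _ _ _ h, rfl⟩

theorem PStep.of_subst {p q : Prog K B} (h : S.PStep (p.subst Expr.junkSubst) q) :
    ∃ p', S.PStep p p' ∧ p'.subst Expr.junkSubst = q := by
  cases p with
  | expr e =>
    cases h with
    | expr h =>
      obtain ⟨e', h', rfl⟩ := h.of_subst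
      exact ⟨_, .expr h', rfl⟩
  | letIn e p =>
    generalize hx : (Prog.letIn e p).subst Expr.junkSubst = x at h
    cases h with
    | expr => cases hx
    | letV v p' =>
      rw [Prog.subst, Prog.letIn.injEq] at hx
      obtain ⟨he, rfl⟩ := hx
      obtain ⟨w, rfl, _⟩ := exists_val_of_subst (S := S) he
      refine ⟨_, .letV w p, ?_⟩
      rw [← he, Prog.subst0_subst_up, Prog.subst0, Prog.subst_subst]
      congr 1
      funext n
      cases n <;> rfl
    | letC p' h =>
      rw [Prog.subst, Prog.letIn.injEq] at hx
      obtain ⟨rfl, rfl⟩ := hx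
      obtain ⟨e', h', rfl⟩ := h.of_subst
      exact ⟨_, .letC p h', rfl⟩

theorem Diverges.of_subst {p : Prog K B} (h : S.Diverges (p.subst Expr.junkSubst)) :
    S.Diverges p := by
  obtain ⟨f, hf, hs⟩ := h
  -- The preimages are chosen along the given sequence, each one as a reduct of the preceding one.
  have step : ∀ n (q : {q : Prog K B // q.subst Expr.junkSubst = f n}),
      ∃ q' : {q : Prog K B // q.subst Expr.junkSubst = f (n + 1)}, S.PStep q.1 q'.1 := by
    rintro n ⟨q, hq⟩
    have h := hs n
    rw [← hq] at h
    obtain ⟨q', h, hq'⟩ := h.of_subst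
    exact ⟨⟨q', hq'⟩, h⟩
  choose next hnext using step
  let g : ∀ n, {q : Prog K B // q.subst Expr.junkSubst = f n} := fun n =>
    Nat.rec ⟨p, hf.symm⟩ (fun n q => next n q) n
  exact ⟨fun n => (g n).1, rfl, fun n => hnext n (g n)⟩

theorem reflTransGen_of_subst {p q : Prog K B}
    (h : Relation.ReflTransGen S.PStep (p.subst Expr.junkSubst) q) :
    ∃ p', Relation.ReflTransGen S.PStep p p' ∧ p'.subst Expr.junkSubst = q := by
  induction h with
  | refl => exact ⟨p, .refl, rfl⟩
  | tail _ h ih =>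
    obtain ⟨p', hp, rfl⟩ := ih
    obtain ⟨p'', h, hq⟩ := h.of_subst
    exact ⟨p'', hp.tail h, hq⟩

/-! ### Soundness -/

theorem Diverges.head {p q : Prog K B} (h : Relation.ReflTransGen S.PStep p q)
    (hq : S.Diverges q) : S.Diverges p := by
  induction h using Relation.ReflTransGen.head_induction_on with
  | refl => exact hq
  | @head p _ h _ ih =>
    obtain ⟨f, hf, hs⟩ := ih
    refine ⟨fun n => Nat.casesOn n p f, rfl, fun n => ?_⟩
    cases n with
    | zero => exact (congrArg (S.PStep p) hf).mpr h
    | succ n => exact hs n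

theorem steps_le_approx {e e' : Expr K B} (h : Relation.ReflTransGen S.Step e e')
    (hc : Closed e.toTm) : Closed e'.toTm ∧
      ∃ k, ∀ n, Le (S.approx n e'.toTm) (S.approx (n + k) e.toTm) := by
  induction h with
  | refl => exact ⟨hc, 0, fun n => Le.refl _⟩
  | tail _ h ih =>
    obtain ⟨hc, k, hk⟩ := ih
    refine ⟨h.closed hc, k + 1, fun n => (h.le_approx hc n).trans ?_⟩
    rw [show n + (k + 1) = n + 1 + k by omega]
    exact hk (n + 1)

/-- The approximations of an instance of a typed expression have its generalised type. -/
theorem Typing.good_approx (hS : S.AtomicConsts) {Γ : List (Ty B)} {e : Expr K B} {t : Ty B}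
    (h : S.Typing Γ e t) {φ : ℕ → Option ℕ}
    (hφ : ∀ s ∈ Γ, ∀ n, TVar.mono n ∈ s.vars → φ n = none) {θ : ℕ → Expr K B} (n : ℕ)
    (hcl : ∀ k, Closed (θ k).toTm)
    (hθ : ∀ k s, Γ[k]? = some s → S.Good (S.approx n (θ k).toTm) s) :
    S.Good (S.approx n (e.subst θ).toTm) (t.gen φ) := by
  have hclosed : Closed (S.approx n (e.subst θ).toTm) := by
    rw [Expr.toTm_subst]
    exact closed_approx (closed_subst hcl _) n
  have key : ∀ σ : ℕ → Ty B, (∀ n, (σ n).IsMono) → S.approx n (e.subst θ).toTm = bot ∨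
      IsVal (S.approx n (e.subst θ).toTm) ∧
        S.Sat S.Arrows (S.approx n (e.subst θ).toTm) ((t.gen φ).inst σ) := fun σ hσ => by
    -- By `gen_inst`, an instance of the generalised type comes from substituting the generalised
    -- variables in the derivation itself. This fixes `Γ`, as `φ` is undefined on its variables.
    let η : ℕ → Ty B := fun n => (φ n).elim (.var (.mono n)) σ
    have hη : ∀ n, (η n).IsMono := fun n => by
      simp only [η]
      cases φ n with
      | none => exact Ty.isMono_var n
      | some m => exact hσ m
    have hΓ : Γ.map (Ty.msubst η) = Γ := by
      refine (List.map_congr_left fun s hs => ?_).trans (List.map_id Γ)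
      refine Ty.subst_eq_self fun a ha => ?_
      cases a with
      | poly n => rfl
      | mono n => simp only [η, hφ s hs n ha, Option.elim]
    have h1 := h.msubst hη
    rw [hΓ] at h1
    -- Typing is known for the approximations of the `θ k`. They are substituted first; replacing
    -- them by the `θ k` does not change the result.
    have h2 := (h1.toDTyping S.ValTy).res_approx hS n (Δ := [])
      (θ := fun k => S.approx n (θ k).toTm) fun k s hk => Or.inl (hθ k s hk)
    rw [← approx_subst_congr (θ := fun k => (θ k).toTm) (fun k => (approx_approx n _).symm),
      ← Expr.toTm_subst] at h2
    rw [Ty.gen_inst φ hσ]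
    exact (h2.good hclosed).2.2.imp id fun h => ⟨h.1, h.2 σ hσ⟩
  refine ⟨hclosed, nf_approx n _, ?_⟩
  by_cases hb : S.approx n (e.subst θ).toTm = bot
  · exact Or.inl hb
  · exact Or.inr ⟨((key (fun _ => .empty) fun _ => Ty.isMono_empty).resolve_left hb).1,
      fun σ hσ => ((key σ hσ).resolve_left hb).2⟩

/-- Evaluation of a closed expression that lies below an expression with well-typed
approximations. -/
theorem diverges_or_value (hS : S.AtomicConsts) {e e₀ : Expr K B} (hc : Closed e.toTm) {t : Ty B}
    (hgood : ∀ n, S.Good (S.approx n e₀.toTm) t) {k : ℕ}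
    (hk : ∀ n, Le (S.approx n e.toTm) (S.approx (n + k) e₀.toTm)) :
    (∃ f : ℕ → Expr K B, f 0 = e ∧ ∀ n, S.Step (f n) (f (n + 1))) ∨
      ∃ v : Val K B, Relation.ReflTransGen S.Step e v.toExpr ∧ Closed v.toExpr.toTm ∧
        ∃ k, ∀ n, Le (S.approx n v.toExpr.toTm) (S.approx (n + k) e₀.toTm) := by
  refine (Relation.exists_infinite_or_normal S.Step e).imp id ?_
  rintro ⟨b, hb, hnorm⟩
  obtain ⟨hcb, j, hj⟩ := steps_le_approx hb hc
  have hle : ∀ n, Le (S.approx n b.toTm) (S.approx (n + (j + k)) e₀.toTm) := fun n => by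
    rw [← add_assoc]
    exact (hj n).trans (hk (n + j))
  rcases value_or_step_or_stuck hS b hcb with ⟨v, rfl⟩ | ⟨c, hbc⟩ | hst
  · exact ⟨v, hb, hcb, j + k, hle⟩
  · exact absurd hbc (hnorm c)
  · exfalso
    -- Stuckness shows already at fuel `0`. It passes up to an approximation of `e₀`, which is `bot`
    -- or a value.
    have h0 : ¬ IsVal (S.approx 0 b.toTm) ∧ S.approx 0 b.toTm ≠ bot := by
      rw [approx]; exact hst _
    have h1 := (hle 0).stuck (nf_approx 0 _) (closed_approx hcb 0) h0.1 h0.2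
    rcases (hgood (0 + (j + k))).2.2 with h | h
    · exact h1.2 h
    · exact h1.1 h.1

/-- `θ₀` holds the unevaluated definitions, typed through their approximations at every fuel; `θ`
holds the values computed from them, known only to lie below with `k` more units of fuel. The values
need no types of their own: the final one takes its dynamic type from a well-typed approximation
`w`. -/
theorem PTyping.sound (hS : S.AtomicConsts) {Γ : List (Ty B)} {p : Prog K B} {t : Ty B}
    (h : S.PTyping Γ p t) {θ θ₀ : ℕ → Expr K B} (hc : ∀ i, Closed (θ i).toTm)
    (hc₀ : ∀ i, Closed (θ₀ i).toTm)
    (hθ₀ : ∀ i s, Γ[i]? = some s → ∀ n, S.Good (S.approx n (θ₀ i).toTm) s) {k : ℕ}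
    (hθ : ∀ i n, Le (S.approx n (θ i).toTm) (S.approx (n + k) (θ₀ i).toTm)) :
    S.Diverges (p.subst θ) ∨
      ∃ v : Val K B, Relation.ReflTransGen S.PStep (p.subst θ) (.expr v.toExpr) ∧
        ∃ w : Tm K B, S.Good w t ∧ IsVal w ∧ S.tmType w = S.typeof v := by
  induction h generalizing θ θ₀ k with
  | @expr Γ e t φ hφ h =>
    have hgood := fun n => h.good_approx hS hφ n hc₀ fun i s hs => hθ₀ i s hs n
    have hcl : Closed (e.subst θ).toTm := by
      rw [Expr.toTm_subst]
      exact closed_subst hc _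
    have hle : ∀ n, Le (S.approx n (e.subst θ).toTm) (S.approx (n + k) (e.subst θ₀).toTm) := by
      intro n
      rw [Expr.toTm_subst, Expr.toTm_subst]
      exact le_approx_subst (Nat.le_add_right n k) (fun i => hθ i n)
        (Signature.le_approx (Nat.le_add_right n k) (Le.refl _))
    rcases diverges_or_value hS hcl hgood hle with ⟨f, hf, hs⟩ | ⟨v, hv, _, j, hj⟩
    · exact Or.inl ⟨fun n => .expr (f n), congrArg Prog.expr hf, fun n => .expr (hs n)⟩
    · have h1 := norm_toExpr (S := S) (S.fuel 0) v
      rw [← approx] at h1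
      refine Or.inr ⟨v, hv.lift Prog.expr fun _ _ => PStep.expr, _, hgood (0 + j),
        (hj 0).isVal h1.1, ?_⟩
      rw [← (hj 0).tmType_eq h1.1, h1.2]
  | @letIn Γ e p t t' h _ _ ih =>
    cases h with
    | @expr _ _ t φ hφ h =>
    have hgood := fun n => h.good_approx hS hφ n hc₀ fun i s hs => hθ₀ i s hs n
    have hcl : Closed (e.subst θ).toTm := by
      rw [Expr.toTm_subst]
      exact closed_subst hc _
    have hcl₀ : Closed (e.subst θ₀).toTm := by
      rw [Expr.toTm_subst]
      exact closed_subst hc₀ _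
    have hle : ∀ n, Le (S.approx n (e.subst θ).toTm) (S.approx (n + k) (e.subst θ₀).toTm) := by
      intro n
      rw [Expr.toTm_subst, Expr.toTm_subst]
      exact le_approx_subst (Nat.le_add_right n k) (fun i => hθ i n)
        (Signature.le_approx (Nat.le_add_right n k) (Le.refl _))
    rcases diverges_or_value hS hcl hgood hle with ⟨f, hf, hs⟩ | ⟨v, hv, hvc, j, hj⟩
    · exact Or.inl ⟨fun n => .letIn (f n) (p.subst (Expr.up θ)),
        congrArg (fun e => Prog.letIn e (p.subst (Expr.up θ))) hf, fun n => .letC _ (hs n)⟩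
    · have hred : Relation.ReflTransGen S.PStep ((Prog.letIn e p).subst θ)
          (p.subst (Expr.cons v.toExpr θ)) := by
        rw [← Prog.subst0_subst_up]
        exact (hv.lift (fun e => Prog.letIn e (p.subst (Expr.up θ)))
          fun _ _ => PStep.letC _).tail (.letV v _)
      -- The sum `j + k` bounds both the delay `j` of the new value and the delay `k` of the older
      -- entries.
      have hrec := ih (θ := Expr.cons v.toExpr θ) (θ₀ := Expr.cons (e.subst θ₀) θ₀) (k := j + k)
        (fun i => by
          cases i with
          | zero => exact hvc
          | succ i => exact hc i)
        (fun i => by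
          cases i with
          | zero => exact hcl₀
          | succ i => exact hc₀ i)
        (fun i s hs => by
          cases i with
          | zero => cases hs; exact hgood
          | succ i => exact hθ₀ i s hs)
        (fun i n => by
          cases i with
          | zero => exact (hj n).trans (Signature.le_approx (by omega) (Le.refl _))
          | succ i => exact (hθ i n).trans (Signature.le_approx (by omega) (Le.refl _)))
      rcases hrec with hd | ⟨v', hv', hw⟩
      · exact Or.inl (hd.head hred)
      · exact Or.inr ⟨v', hred.trans hv', hw⟩

end Signature

theorem mainTheorem1 {K : Type*} {B : Type*} (S : Signature K B) (hS : S.AtomicConsts)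
    (p : Prog K B) (τ : TestTy B) (hp : S.PTyping [] p τ.1) :
    S.Diverges p ∨
      ∃ v : Val K B, Relation.ReflTransGen S.PStep p (.expr v.toExpr) ∧ S.Test v τ.1 := by
  have hc : ∀ i, Tm.Closed (Expr.junkSubst (K := K) (B := B) i).toTm := fun _ n hn => by
    cases hn
  -- Even in the empty environment, free variables may remain in branches that the typing rules
  -- ignore. They are closed off by `junk`, and the outcome is carried back to `p`.
  rcases hp.sound hS hc hc (fun i s hs => by cases hs) (k := 0) (fun i n => Tm.Le.refl _) with
    hd | ⟨v, hv, w, hgood, hw, htype⟩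
  · exact Or.inl hd.of_subst
  · obtain ⟨p', hp', he⟩ := Signature.reflTransGen_of_subst hv
    cases p' with
    | letIn => cases he
    | expr e =>
      rw [Prog.subst, Prog.expr.injEq] at he
      obtain ⟨v', rfl, hv'⟩ := Signature.exists_val_of_subst (S := S) he
      refine Or.inr ⟨v', hp', ?_⟩
      have hsat := (hgood.sat_instance hw.ne_bot).2
      rw [Ty.inst, Ty.subst_of_isTest τ.2] at hsat
      rw [Signature.Test, hv', ← htype]
      exact (Signature.sub_tmType_iff hS hw τ.2).2 hsat
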